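/- Let $K$ be a number field. For a place $w$ of $K$ let $|\cdot|_w$ be the normalized absolute value on the completion $K_w$ ($q_w^{-w(\cdot)}$ if $w$ is finite with residue field of $q_w$ elements, the usual absolute value if $w$ is real, the square of the modulus if $w$ is complex). Let $V$ be a smooth, projective, geometrically integral variety over $K$, of dimension $n$. An adelic metric on $V$ is a family, indexed by the places $w$ of $K$, of continuous maps $\|\cdot\|_w : TV(K_w)\to\mathbb R_{\ge 0}$ on the tangent bundle such that: (1) for $w$ finite, the restriction of $\|\cdot\|_w$ to each fibre $T_PV$, $P\in V(K_w)$, is an ultrametric norm with values in the image of $|\cdot|_w$; (2) for $w$ real, it is a euclidean norm; (3) for $w$ complex, $\|y\|_w=\phi_P(y,y)$ for a positive definite hermitian form $\phi_P$ on $T_PV$; (4) there are a finite set $S$ of places containing the archimedean ones and a model $\mathcal E\to\mathcal V$ of $TV\to V$ over $\mathcal O_S$ ($\mathcal V$ proper over $\mathcal O_S$ with generic fibre $V$, $\mathcal E$ a vector bundle on $\mathcal V$ with generic fibre $TV$) such that for all $w\notin S$ and $P\in\mathcal V(\mathcal O_w)$ one has $\mathcal E_P=\{y\in T_PV : \|y\|_w\le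 1\}$. Fix an adelic metric on $V$ and let $P\in V(K)$. For a $K$-subspace $F$ of $T_PV$ with basis $b_1,\dots,b_m$, put $\deg F=-\sum_w\log\|b_1\wedge\dots\wedge b_m\|_w$, where $\|\cdot\|_w$ is the norm induced on the top exterior power of $F\otimes_K K_w$ by the restriction of $\|\cdot\|_w$: it takes the value $1$ at $e_1\wedge\dots\wedge e_m$ when $(e_i)$ is an orthonormal basis ($w$ archimedean), or a basis of the $\mathcal O_w$-module $\{\|y\|_w\le 1\}$ ($w$ finite). Let $m_P(x)$, $0\le x\le n$, be the upper boundary of the convex hull in $\mathbb R^2$ of the points $(\dim F,\deg F)$, where $F$ runs over all subspaces of $T_PV$. The slopes of $P$ are $\mu_i(P)=m_P(i)-m_P(i-1)$ for $1\le i\le n$, the height is $h(P)=\deg T_PV$, and the freeness is $l(P)=n\,\mu_n(P)/h(P)$ if $\mu_n(P)>0$, and $l(P)=0$ otherwise. Let two adelic metrics on $V$ be given, with slopes $\mu_i$ and $\mu_i'$ and freenesses $l$ and $l'$, and let $h$ be the height defined by the first one. Then: (i) for each $i\in\{1,\dots,n\}$ the function $|\mu_i-\mu'_i|$ is bounded on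 $V(K)$; (ii) there is a real number $C>0$ such that $|l(P)-l'(P)|<C/h(P)$ for every $P\in V(K)$ with $h(P)>0$. -/

import Mathlib

open CategoryTheory AlgebraicGeometry NumberField IsDedekindDomain Module
open scoped TensorProduct

universe u

noncomputable section

namespace Slopes

/-! ### Vector bundles, through their functors of points -/

/-- A functor of points in modules over a scheme `X`: to each `X`-scheme `T` a `Γ(T, 𝒪_T)`-module,
with semilinear pull-back maps. A vector bundle `π : Y ⟶ X` gives `T ↦ Hom_X(T, Y)`; see
`IsVectorBundle` below for the functors that arise in this way. -/
structure RelModule (X : Scheme.{u}) where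
  obj : Over X → Type u
  addCommGroup : ∀ T, AddCommGroup (obj T)
  module : ∀ T : Over X, Module Γ(T.left, ⊤) (obj T)
  map : ∀ {T T' : Over X}, (T' ⟶ T) → obj T →+ obj T'
  map_smul : ∀ {T T' : Over X} (g : T' ⟶ T) (a : Γ(T.left, ⊤)) (x : obj T),
    map g (a • x) = g.left.appTop.hom a • map g x
  map_id : ∀ (T : Over X) (x : obj T), map (𝟙 T) x = x
  map_comp : ∀ {T T' T'' : Over X} (h : T'' ⟶ T') (g : T' ⟶ T) (x : obj T),
    map (h ≫ g) x = map h (map g x)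

attribute [instance] RelModule.addCommGroup RelModule.module

namespace RelModule

variable {X : Scheme.{u}}

/-- The sections `s₁, …, s_r` over the open subset `U` form a frame: over every `X`-scheme that
factors through `U`, each section is a unique linear combination of their pull-backs. -/
def IsFrame (E : RelModule X) (U : X.Opens) {r : ℕ} (s : Fin r → E.obj (Over.mk U.ι)) : Prop :=
  ∀ (T : Over X) (g : T ⟶ Over.mk U.ι),
    Function.Bijective fun c : Fin r → Γ(T.left, ⊤) => ∑ i, c i • E.map g (s i)

/-- `E` is a vector bundle: it is the functor of points of an `X`-scheme `Y` (the total space, with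
tautological section `e`), and it has frames locally on `X`. -/
structure IsVectorBundle (E : RelModule X) : Prop where
  representable : ∃ (Y : Over X) (e : E.obj Y),
    ∀ T : Over X, Function.Bijective fun g : T ⟶ Y => E.map g e
  exists_frame : ∀ x : X, ∃ U : X.Opens, x ∈ U ∧
    ∃ (r : ℕ) (s : Fin r → E.obj (Over.mk U.ι)), E.IsFrame U s

/-- The pull-back of `E` along `j : Z ⟶ X`. -/
def pullback (E : RelModule X) {Z : Scheme.{u}} (j : Z ⟶ X) : RelModule Z where
  obj T := E.obj ((Over.map j).obj T)
  addCommGroup _ := E.addCommGroup _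
  module T := E.module ((Over.map j).obj T)
  map g := E.map ((Over.map j).map g)
  map_smul g a x := E.map_smul ((Over.map j).map g) a x
  map_id T x := by
    rw [CategoryTheory.Functor.map_id]
    exact E.map_id _ x
  map_comp h g x := by
    rw [CategoryTheory.Functor.map_comp]
    exact E.map_comp _ _ x

/-- Isomorphisms: natural families of linear bijections. -/
structure Iso (E F : RelModule X) where
  equiv : ∀ T : Over X, E.obj T ≃ₗ[Γ(T.left, ⊤)] F.obj T
  naturality : ∀ {T T' : Over X} (g : T' ⟶ T) (x : E.obj T),
    equiv T' (E.map g x) = F.map g (equiv T x)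

end RelModule

/-! ### The tangent bundle -/

section Tangent

variable {V B : Scheme.{u}} (str : V ⟶ B)

/-- Restriction of functions on a scheme. -/
abbrev res {Y : Scheme.{u}} {U U' : Y.Opens} (h : U' ≤ U) : Γ(Y, U) →+* Γ(Y, U') :=
  (Y.presheaf.map (homOfLE h).op).hom

/-- For `f : T ⟶ V`, the group of `B`-linear derivations `𝒪_V → f_* 𝒪_T`, that is, of sections
over `T` of the pull-back along `f` of the tangent bundle of `V` over `B`. -/
def tangentFields (T : Over V) : AddSubgroup (∀ U : V.Opens, Γ(V, U) →+ Γ(T.left, T.hom ⁻¹ᵁ U)) where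
  carrier := {D |
    (∀ (U : V.Opens) (a b : Γ(V, U)),
      D U (a * b) = (T.hom.app U).hom a * D U b + (T.hom.app U).hom b * D U a) ∧
    (∀ (W : B.Opens) (U : V.Opens) (h : U ≤ str ⁻¹ᵁ W) (c : Γ(B, W)),
      D U ((str.appLE W U h).hom c) = 0) ∧
    (∀ (U U' : V.Opens) (h : U' ≤ U) (a : Γ(V, U)),
      D U' (res h a) = res (T.hom.preimage_mono h) (D U a))}
  zero_mem' := by
    refine ⟨?_, ?_, ?_⟩ <;> intros <;> simp
  add_mem' := by
    rintro D D' ⟨h1, h2, h3⟩ ⟨h1', h2', h3'⟩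
    refine ⟨fun U a b => ?_, fun W U h c => ?_, fun U U' h a => ?_⟩
    · simp only [Pi.add_apply, AddMonoidHom.add_apply, h1, h1']
      ring
    · simp only [Pi.add_apply, AddMonoidHom.add_apply, h2, h2', add_zero]
    · simp only [Pi.add_apply, AddMonoidHom.add_apply, h3, h3', map_add]
  neg_mem' := by
    rintro D ⟨h1, h2, h3⟩
    refine ⟨fun U a b => ?_, fun W U h c => ?_, fun U U' h a => ?_⟩
    · simp only [Pi.neg_apply, AddMonoidHom.neg_apply, h1]
      ring
    · simp only [Pi.neg_apply, AddMonoidHom.neg_apply, h2, neg_zero]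
    · simp only [Pi.neg_apply, AddMonoidHom.neg_apply, h3, map_neg]

variable {str} in
lemma tangentFields_ext {T : Over V} {D D' : tangentFields str T}
    (h : ∀ (U : V.Opens) (a : Γ(V, U)), D.1 U a = D'.1 U a) : D = D' :=
  Subtype.ext (funext fun U => AddMonoidHom.ext fun a => h U a)

lemma res_res {Y : Scheme.{u}} {U U' U'' : Y.Opens} (h : U' ≤ U) (h' : U'' ≤ U') (a : Γ(Y, U)) :
    res h' (res h a) = res (h'.trans h) a := by
  simp only [res, ← CommRingCat.comp_apply, ← Functor.map_comp]
  rfl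

instance (T : Over V) : SMul Γ(T.left, ⊤) (tangentFields str T) where
  smul a D := ⟨fun U => (AddMonoidHom.mulLeft (res le_top a)).comp (D.1 U), by
    obtain ⟨D, h1, h2, h3⟩ := D
    refine ⟨fun U a b => ?_, fun W U h c => ?_, fun U U' h b => ?_⟩
    · simp only [AddMonoidHom.comp_apply, AddMonoidHom.coe_mulLeft, h1]
      ring
    · simp only [AddMonoidHom.comp_apply, AddMonoidHom.coe_mulLeft, h2, mul_zero]
    · simp only [AddMonoidHom.comp_apply, AddMonoidHom.coe_mulLeft, h3, map_mul, res_res]⟩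

lemma tangentFields_smul_apply (T : Over V) (a : Γ(T.left, ⊤)) (D : tangentFields str T)
    (U : V.Opens) (b : Γ(V, U)) : (a • D).1 U b = res le_top a * D.1 U b := rfl

instance (T : Over V) : Module Γ(T.left, ⊤) (tangentFields str T) where
  one_smul D := tangentFields_ext fun U a => by
    rw [tangentFields_smul_apply, map_one, one_mul]
  mul_smul a b D := tangentFields_ext fun U c => by
    simp only [tangentFields_smul_apply, map_mul, mul_assoc]
  smul_zero a := tangentFields_ext fun U c => by
    rw [tangentFields_smul_apply]
    exact mul_zero _
  smul_add a D D' := tangentFields_ext fun U c => by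
    rw [tangentFields_smul_apply]
    exact mul_add _ _ _
  add_smul a b D := tangentFields_ext fun U c => by
    rw [tangentFields_smul_apply, map_add, add_mul]
    rfl
  zero_smul D := tangentFields_ext fun U c => by
    rw [tangentFields_smul_apply, map_zero, zero_mul]
    rfl

lemma over_preimage_le {T T' : Over V} (g : T' ⟶ T) (U : V.Opens) :
    T'.hom ⁻¹ᵁ U ≤ g.left ⁻¹ᵁ (T.hom ⁻¹ᵁ U) := by
  rw [← Over.w g]
  rfl

/-- The map `Γ(T, f⁻¹ U) → Γ(T', f'⁻¹ U)` given by a morphism `T' ⟶ T` over `V`. -/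
abbrev overApp {T T' : Over V} (g : T' ⟶ T) (U : V.Opens) :
    Γ(T.left, T.hom ⁻¹ᵁ U) →+* Γ(T'.left, T'.hom ⁻¹ᵁ U) :=
  (g.left.appLE (T.hom ⁻¹ᵁ U) (T'.hom ⁻¹ᵁ U) (over_preimage_le g U)).hom

lemma overApp_app {T T' : Over V} (g : T' ⟶ T) (U : V.Opens) (a : Γ(V, U)) :
    overApp g U ((T.hom.app U).hom a) = (T'.hom.app U).hom a := by
  have key : ∀ (f : T'.left ⟶ V) (_ : f = T'.hom) (e : T'.hom ⁻¹ᵁ U ≤ f ⁻¹ᵁ U),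
      f.appLE U (T'.hom ⁻¹ᵁ U) e = T'.hom.app U := by
    rintro _ rfl e
    exact Scheme.Hom.appLE_eq_app _
  have e : T'.hom ⁻¹ᵁ U ≤ (g.left ≫ T.hom) ⁻¹ᵁ U := over_preimage_le g U
  rw [← key _ (Over.w g) e, Scheme.Hom.comp_appLE]
  rfl

lemma overApp_res {T T' : Over V} (g : T' ⟶ T) {U U' : V.Opens} (h : U' ≤ U)
    (a : Γ(T.left, T.hom ⁻¹ᵁ U)) :
    overApp g U' (res (T.hom.preimage_mono h) a) = res (T'.hom.preimage_mono h) (overApp g U a) := by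
  simp only [res, overApp, ← CommRingCat.comp_apply, Scheme.Hom.appLE_map, Scheme.Hom.map_appLE]

lemma overApp_res_top {T T' : Over V} (g : T' ⟶ T) (U : V.Opens) (a : Γ(T.left, ⊤)) :
    overApp g U (res le_top a) = res le_top (g.left.appTop.hom a) := by
  simp only [res, overApp, ← CommRingCat.comp_apply, Scheme.Hom.map_appLE]
  rfl

lemma overApp_id (T : Over V) (U : V.Opens) (a : Γ(T.left, T.hom ⁻¹ᵁ U)) :
    overApp (𝟙 T) U a = a := by
  have h : (𝟙 T : T ⟶ T).left.appLE (T.hom ⁻¹ᵁ U) (T.hom ⁻¹ᵁ U) (over_preimage_le (𝟙 T) U) = 𝟙 _ :=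
    (congrArg (· ≫ _) (Scheme.Hom.id_app _)).trans
      ((Category.id_comp _).trans (T.left.presheaf.map_id _))
  rw [overApp, h]
  rfl

lemma overApp_comp {T T' T'' : Over V} (h : T'' ⟶ T') (g : T' ⟶ T) (U : V.Opens)
    (a : Γ(T.left, T.hom ⁻¹ᵁ U)) : overApp (h ≫ g) U a = overApp h U (overApp g U a) := by
  simp only [overApp, ← CommRingCat.comp_apply, Scheme.Hom.appLE_comp_appLE]
  rfl

/-- The tangent bundle of `V` over `B`. -/
def tangentBundle : RelModule V where
  obj T := tangentFields str T
  addCommGroup _ := inferInstance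
  module _ := inferInstance
  map {T T'} g :=
    { toFun D := ⟨fun U => (overApp g U).toAddMonoidHom.comp (D.1 U), by
        obtain ⟨D, h1, h2, h3⟩ := D
        refine ⟨fun U a b => ?_, fun W U h c => ?_, fun U U' h a => ?_⟩
        · simp only [AddMonoidHom.comp_apply, RingHom.toAddMonoidHom_eq_coe,
            AddMonoidHom.coe_coe, h1, map_add, map_mul, overApp_app]
        · simp only [AddMonoidHom.comp_apply, h2, map_zero]
        · simp only [AddMonoidHom.comp_apply, RingHom.toAddMonoidHom_eq_coe,
            AddMonoidHom.coe_coe, h3]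
          exact overApp_res g h _⟩
      map_zero' := tangentFields_ext fun U a => map_zero (overApp g U)
      map_add' D D' := tangentFields_ext fun U a => map_add (overApp g U) _ _ }
  map_smul g a D := tangentFields_ext fun U b =>
    (map_mul (overApp g U) _ _).trans (congrArg (· * _) (overApp_res_top g U a))
  map_id T D := tangentFields_ext fun U b => overApp_id T U _
  map_comp h g D := tangentFields_ext fun U b => overApp_comp h g U _

end Tangent

/-! ### Points with values in a field, and their topology -/

section Points

variable {K : Type u} [Field K] {V : Scheme.{u}} (str : V ⟶ Spec (.of K))

/-- The set `V(k)` of points of the `K`-scheme `V` with values in a field extension `k` of `K`. -/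
def Points (k : Type u) [Field k] [Algebra K k] : Type u :=
  {P : Spec (.of k) ⟶ V // P ≫ str = Spec.map (CommRingCat.ofHom (algebraMap K k))}

variable {str}

/-- The point of `V(k)` given by a point of `V(K)`. -/
def Points.baseChange (P : Points str K) (k : Type u) [Field k] [Algebra K k] : Points str k :=
  ⟨Spec.map (CommRingCat.ofHom (algebraMap K k)) ≫ P.1, by
    rw [Category.assoc, P.2, Algebra.algebraMap_self, CommRingCat.ofHom_id, Spec.map_id]
    exact Category.comp_id _⟩

variable (str) in
/-- The subset `U(k)` of `V(k)`, for `U` open in `V`. -/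
def PointsIn (k : Type u) [Field k] [Algebra K k] (U : V.Opens) : Type u :=
  {P : Points str k // ⊤ ≤ P.1 ⁻¹ᵁ U}

/-- The value in `k` of a function on `U` at a point of `U(k)`. -/
def PointsIn.eval {k : Type u} [Field k] [Algebra K k] {U : V.Opens} (P : PointsIn str k U)
    (a : Γ(V, U)) : k :=
  (Scheme.ΓSpecIso (.of k)).hom.hom ((P.1.1.appLE U ⊤ P.2).hom a)

section Topology

variable (k : Type u) [NormedField k] [Algebra K k]

/-- The topology on `V(k)` induced by the topology of `k`: for `U` affine, the set `U(k)` has the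
coarsest topology for which the functions on `U` are continuous, and a subset of `V(k)` is open if
its traces on all these `U(k)` are. -/
instance : TopologicalSpace (Points str k) :=
  ⨆ U : V.affineOpens,
    TopologicalSpace.coinduced (fun P : PointsIn str k U.1 => P.1)
      (TopologicalSpace.induced (fun P a => PointsIn.eval P a) inferInstance)

instance (U : V.Opens) : TopologicalSpace (PointsIn str k U) :=
  TopologicalSpace.induced (fun P => P.1) inferInstance

end Topology

/-- The fibre at a point `P` of `V(k)`. -/
def Fibre (E : RelModule V) {k : Type u} [Field k] [Algebra K k] (P : Points str k) : Type u :=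
  E.obj (Over.mk P.1)

instance (E : RelModule V) {k : Type u} [Field k] [Algebra K k] (P : Points str k) :
    AddCommGroup (Fibre E P) :=
  E.addCommGroup _

instance (E : RelModule V) {k : Type u} [Field k] [Algebra K k] (P : Points str k) :
    Module k (Fibre E P) :=
  letI : Module Γ(Spec (.of k), ⊤) (Fibre E P) := E.module (Over.mk P.1)
  Module.compHom (Fibre E P) (Scheme.ΓSpecIso (.of k)).inv.hom

/-- The canonical map `E_P → E_{P_k}`, for `P ∈ V(K)`. -/
def fibreMap (E : RelModule V) (P : Points str K) (k : Type u) [Field k] [Algebra K k] :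
    Fibre E P →ₛₗ[algebraMap K k] Fibre E (P.baseChange k) where
  toFun := E.map (T := Over.mk P.1) (T' := Over.mk (P.baseChange k).1)
    (Over.homMk (Spec.map (CommRingCat.ofHom (algebraMap K k))))
  map_add' := map_add _
  map_smul' c x := by
    refine (E.map_smul _ _ _).trans ?_
    refine congrArg (fun a : Γ(Spec (.of k), ⊤) => E.module (Over.mk (P.baseChange k).1) |>.smul a _) ?_
    exact congr($((Scheme.ΓSpecIso_inv_naturality
      (CommRingCat.ofHom (algebraMap K k))).symm).hom c)

/-- The canonical map `k ⊗ E_P → E_{P_k}` (an isomorphism if `E` is a vector bundle). -/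
def fibreTensor (E : RelModule V) (P : Points str K) (k : Type u) [Field k] [Algebra K k] :
    k ⊗[K] Fibre E P →+ Fibre E (P.baseChange k) :=
  TensorProduct.liftAddHom
    { toFun c := (DistribSMul.toAddMonoidHom _ c).comp (fibreMap E P k).toAddMonoidHom
      map_zero' := by ext x; simp
      map_add' c d := by ext x; simp [add_smul] }
    (fun a c x => by
      change (a • c) • fibreMap E P k x = c • fibreMap E P k (a • x)
      rw [LinearMap.map_smulₛₗ, smul_smul, Algebra.smul_def, mul_comm])

/-- The set `E(k)` of points of the total space of `E` with values in `k`. -/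
def TotalPoints (str : V ⟶ Spec (.of K)) (E : RelModule V) (k : Type u) [Field k] [Algebra K k] :
    Type u :=
  Σ P : Points str k, Fibre E P

/-- The value at a point of `U(k)` of a section over `U`. -/
def sectionValue (E : RelModule V) {U : V.Opens} (s : E.obj (Over.mk U.ι)) {k : Type u} [Field k]
    [Algebra K k] (P : PointsIn str k U) : Fibre E P.1 :=
  E.map (T := Over.mk U.ι) (T' := Over.mk P.1.1)
    (Over.homMk (IsOpenImmersion.lift U.ι P.1.1 (by
      rintro _ ⟨x, rfl⟩
      simpa using P.2 (Set.mem_univ x))) (IsOpenImmersion.lift_fac _ _ _)) s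

/-- The map `U(k) × kʳ → E(k)` defined by the family `s` of sections over `U`. -/
def chart (E : RelModule V) {U : V.Opens} {r : ℕ} (s : Fin r → E.obj (Over.mk U.ι))
    {k : Type u} [Field k] [Algebra K k] (x : PointsIn str k U × (Fin r → k)) :
    TotalPoints str E k :=
  ⟨x.1.1, ∑ i, x.2 i • sectionValue E (s i) x.1⟩

/-- The topology on `E(k)` induced by the topology of `k`: it is glued from the
topologies of `U(k) × kʳ` through the charts that are given by the frames of `E`. -/
instance (E : RelModule V) (k : Type u) [NormedField k] [Algebra K k] :
    TopologicalSpace (TotalPoints str E k) :=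
  ⨆ (U : V.Opens) (r : ℕ) (s : Fin r → E.obj (Over.mk U.ι)) (_ : E.IsFrame U s),
    TopologicalSpace.coinduced (chart E s) inferInstance

end Points

/-! ### Adelic norms -/

section AdelicNorm

/-- `N` is an ultrametric norm on the `k`-vector space `M` with values in the image of the absolute
value of `k`. -/
structure IsUltrametricNorm (k : Type u) [NormedField k] {M : Type u} [AddCommGroup M] [Module k M]
    (N : M → ℝ) : Prop where
  eq_zero_iff : ∀ y, N y = 0 ↔ y = 0
  smul : ∀ (c : k) (y : M), N (c • y) = ‖c‖ * N y
  add_le : ∀ x y, N (x + y) ≤ max (N x) (N y)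
  mem_range : ∀ y, N y ∈ Set.range fun c : k => ‖c‖

/-- `N` is a euclidean norm, the scalars acting through an isomorphism `σ` from `k` to `ℝ`. -/
def IsEuclideanNorm {k : Type u} [Field k] (σ : k →+* ℝ) {M : Type u} [AddCommGroup M] [Module k M]
    (N : M → ℝ) : Prop :=
  ∃ b : M → M → ℝ, (∀ x x' y, b (x + x') y = b x y + b x' y) ∧
    (∀ c x y, b (c • x) y = σ c * b x y) ∧ (∀ x y, b y x = b x y) ∧
    (∀ x, x ≠ 0 → 0 < b x x) ∧ ∀ x, N x = √(b x x)

/-- `N y = φ(y, y)` for a positive definite hermitian form `φ`, the scalars acting through an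
isomorphism `σ` from `k` to `ℂ`. -/
def IsHermitianSquare {k : Type u} [Field k] (σ : k →+* ℂ) {M : Type u} [AddCommGroup M]
    [Module k M] (N : M → ℝ) : Prop :=
  ∃ φ : M → M → ℂ, (∀ x x' y, φ (x + x') y = φ x y + φ x' y) ∧
    (∀ c x y, φ (c • x) y = σ c * φ x y) ∧ (∀ x y, φ y x = star (φ x y)) ∧
    (∀ x, x ≠ 0 → 0 < (φ x x).re) ∧ ∀ x, (N x : ℂ) = φ x x

variable {K : Type u} [Field K] [NumberField K]

/-- The ring of `S`-integers of `K`. -/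
abbrev SInt (S : Finset (HeightOneSpectrum (𝓞 K))) : Subalgebra (𝓞 K) K :=
  (S : Set (HeightOneSpectrum (𝓞 K))).integer K

variable {V : Scheme.{u}} (str : V ⟶ Spec (.of K))

/-- A model over `𝒪_S` of the vector bundle `E` on the projective variety `V`: a proper
`𝒪_S`-scheme `𝒱` with generic fibre `V`, and a vector bundle `ℰ` on `𝒱` with generic fibre `E`. -/
structure Model (E : RelModule V) (S : Finset (HeightOneSpectrum (𝓞 K))) where
  scheme : Scheme.{u}
  toSpec : scheme ⟶ Spec (.of (SInt S))
  proper : IsProper toSpec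
  generic : V ⟶ scheme
  isPullback : IsPullback generic str toSpec
    (Spec.map (CommRingCat.ofHom (algebraMap (SInt S) K)))
  bundle : RelModule scheme
  isVectorBundle : bundle.IsVectorBundle
  iso : (bundle.pullback generic).Iso E

/-- The inclusion `Spec K_v → Spec 𝒪_v`. -/
abbrev specInteger (v : HeightOneSpectrum (𝓞 K)) :
    Spec (.of (v.adicCompletion K)) ⟶ Spec (.of (v.adicCompletionIntegers K)) :=
  Spec.map (CommRingCat.ofHom (algebraMap (v.adicCompletionIntegers K) (v.adicCompletion K)))

variable {str} in
/-- For a point `P ∈ 𝒱(𝒪_v)` with generic point `Q ∈ V(K_v)`, the `𝒪_v`-submodule `ℰ_P` of `E_Q`. -/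
def Model.lattice {E : RelModule V} {S : Finset (HeightOneSpectrum (𝓞 K))} (m : Model str E S)
    {v : HeightOneSpectrum (𝓞 K)} (Q : Points str (v.adicCompletion K))
    (P : Spec (.of (v.adicCompletionIntegers K)) ⟶ m.scheme)
    (h : specInteger v ≫ P = Q.1 ≫ m.generic) : Set (Fibre E Q) :=
  Set.range fun z : m.bundle.obj (Over.mk P) =>
    m.iso.equiv (Over.mk Q.1)
      (m.bundle.map (T := Over.mk P) (T' := Over.mk (Q.1 ≫ m.generic))
        (Over.homMk (specInteger v) h) z)

/-- Classical adelic norms on the vector bundle `E` over the `K`-variety `V`. At a finite place `v`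
the norm of Mathlib on the completion is `|·|_v = q_v ^ (-v(·))`. -/
structure AdelicNorm (E : RelModule V) where
  inf : ∀ (w : InfinitePlace K) (P : Points str w.Completion), Fibre E P → ℝ
  fin : ∀ (v : HeightOneSpectrum (𝓞 K)) (P : Points str (v.adicCompletion K)), Fibre E P → ℝ
  continuous_inf : ∀ w, Continuous fun x : TotalPoints str E w.Completion => inf w x.1 x.2
  continuous_fin : ∀ v, Continuous fun x : TotalPoints str E (v.adicCompletion K) => fin v x.1 x.2
  ultrametric : ∀ v P, IsUltrametricNorm (v.adicCompletion K) (fin v P)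
  euclidean : ∀ (w : InfinitePlace K) (hw : w.IsReal) (P : Points str w.Completion),
    IsEuclideanNorm (InfinitePlace.Completion.extensionEmbeddingOfIsReal hw) (inf w P)
  hermitian : ∀ (w : InfinitePlace K) (_ : w.IsComplex) (P : Points str w.Completion),
    IsHermitianSquare (InfinitePlace.Completion.extensionEmbedding w) (inf w P)
  exists_model : ∃ (S : Finset (HeightOneSpectrum (𝓞 K))) (m : Model str E S),
    ∀ v ∉ S, ∀ (Q : Points str (v.adicCompletion K))
      (P : Spec (.of (v.adicCompletionIntegers K)) ⟶ m.scheme)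
      (h : specInteger v ≫ P = Q.1 ≫ m.generic),
      m.lattice Q P h = {y | fin v Q y ≤ 1}

end AdelicNorm

/-! ### Arakelov degree and slopes of a normed `K`-vector space -/

section Slopes

variable (K : Type u) [Field K] [NumberField K]

/-- A family of functions on the spaces `E_w = K_w ⊗ E`, one for each place `w` of `K`. -/
structure NormFamily (E : Type u) [AddCommGroup E] [Module K E] where
  inf : ∀ w : InfinitePlace K, w.Completion ⊗[K] E → ℝ
  fin : ∀ v : HeightOneSpectrum (𝓞 K), v.adicCompletion K ⊗[K] E → ℝ

namespace NormFamily

variable {K} {E : Type u} [AddCommGroup E] [Module K E] (N : NormFamily K E)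

/-- The restriction of the norms to a subspace. -/
def restrict (F : Submodule K E) : NormFamily K F where
  inf w x := N.inf w (F.subtype.baseChange w.Completion x)
  fin v x := N.fin v (F.subtype.baseChange (v.adicCompletion K) x)

/-- `e` is an orthonormal basis for the euclidean norm `N` (`w` real), or for the hermitian form
`φ` with `N y = φ(y, y)` (`w` complex). -/
def IsOrthonormal (w : InfinitePlace K) {m : ℕ} (e : Basis (Fin m) w.Completion (w.Completion ⊗[K] E)) :
    Prop :=
  (w.IsReal → ∀ c : Fin m → w.Completion, N.inf w (∑ i, c i • e i) ^ 2 = ∑ i, ‖c i‖ ^ 2) ∧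
  (w.IsComplex → ∀ c : Fin m → w.Completion, N.inf w (∑ i, c i • e i) = ∑ i, ‖c i‖ ^ 2)

/-- `e` is a basis of the `𝒪_v`-module `{y | ‖y‖_v ≤ 1}`. -/
def IsLatticeBasis (v : HeightOneSpectrum (𝓞 K)) {m : ℕ}
    (e : Basis (Fin m) (v.adicCompletion K) (v.adicCompletion K ⊗[K] E)) : Prop :=
  ∀ c : Fin m → v.adicCompletion K, N.fin v (∑ i, c i • e i) ≤ 1 ↔ ∀ i, ‖c i‖ ≤ 1

open Classical in
/-- The value at `b₁ ∧ ⋯ ∧ b_m` of the norm induced on the top exterior power of `E_w`, which takes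
the value `1` at `e₁ ∧ ⋯ ∧ e_m` for an orthonormal basis `e`. Recall that `|x|_w` is the square of
the modulus at a complex place. -/
def detInf (w : InfinitePlace K) {m : ℕ} (b : Basis (Fin m) K E) : ℝ :=
  if h : ∃ e : Basis (Fin m) w.Completion (w.Completion ⊗[K] E), N.IsOrthonormal w e then
    ‖h.choose.det (b.baseChange w.Completion)‖ ^ w.mult
  else 0

open Classical in
/-- The value at `b₁ ∧ ⋯ ∧ b_m` of the norm induced on the top exterior power of `E_v`, which is the
norm defined by the top exterior power of the `𝒪_v`-module `{y | ‖y‖_v ≤ 1}`. -/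
def detFin (v : HeightOneSpectrum (𝓞 K)) {m : ℕ} (b : Basis (Fin m) K E) : ℝ :=
  if h : ∃ e : Basis (Fin m) (v.adicCompletion K) (v.adicCompletion K ⊗[K] E),
      N.IsLatticeBasis v e then
    ‖h.choose.det (b.baseChange (v.adicCompletion K))‖
  else 0

open Classical in
/-- The Arakelov degree `- ∑_w log ‖b₁ ∧ ⋯ ∧ b_m‖_w`, where `b` is a basis of `E` over `K`; by the
product formula it does not depend on `b`. -/
def degree : ℝ :=
  if _h : Module.Finite K E then
    -(∑ w : InfinitePlace K, Real.log (N.detInf w (finBasis K E)) +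
      ∑ᶠ v : HeightOneSpectrum (𝓞 K), Real.log (N.detFin v (finBasis K E)))
  else 0

/-- The convex hull of the points `(dim F, deg F)`, for `F` a subspace of `E`. -/
def newtonPolygon : Set (ℝ × ℝ) :=
  convexHull ℝ (Set.range fun F : Submodule K E => ((finrank K F : ℝ), (N.restrict F).degree))

/-- The upper boundary of the Newton polygon. -/
def upperBoundary (x : ℝ) : ℝ :=
  sSup {y | (x, y) ∈ N.newtonPolygon}

/-- The `i`-th slope, for `1 ≤ i ≤ dim E`. -/
def slope (i : ℕ) : ℝ :=
  N.upperBoundary i - N.upperBoundary ((i : ℝ) - 1)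

end NormFamily

end Slopes

/-! ### Varieties: slopes, height and freeness of rational points -/

section Varieties

attribute [local instance] MvPolynomial.gradedAlgebra

variable {K : Type u} [Field K]

/-- The structure morphism of the projective space `ℙ^N` over `K`. -/
def projectiveSpaceStr (K : Type u) [Field K] (N : ℕ) :
    Proj (MvPolynomial.homogeneousSubmodule (Fin (N + 1)) K) ⟶ Spec (.of K) :=
  Proj.toSpecZero (MvPolynomial.homogeneousSubmodule (Fin (N + 1)) K) ≫
    Spec.map (CommRingCat.ofHom
      (algebraMap K (MvPolynomial.homogeneousSubmodule (Fin (N + 1)) K 0)))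

/-- Nice varieties: smooth, projective and geometrically integral. -/
structure IsNice {V : Scheme.{u}} (str : V ⟶ Spec (.of K)) : Prop where
  smooth : Smooth str
  projective : ∃ (N : ℕ) (i : V ⟶ Proj (MvPolynomial.homogeneousSubmodule (Fin (N + 1)) K)),
    IsClosedImmersion i ∧ i ≫ projectiveSpaceStr K N = str
  geometricallyIntegral : GeometricallyIntegral str

variable [NumberField K] {V : Scheme.{u}} {str : V ⟶ Spec (.of K)}

/-- The norms induced on the fibre of `E` at a rational point. -/
def AdelicNorm.atPoint {E : RelModule V} (N : AdelicNorm str E) (P : Points str K) :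
    NormFamily K (Fibre E P) where
  inf w x := N.inf w (P.baseChange w.Completion) (fibreTensor E P w.Completion x)
  fin v x := N.fin v (P.baseChange (v.adicCompletion K)) (fibreTensor E P (v.adicCompletion K) x)

variable (str) in
/-- An adelic metric on `V` is an adelic norm on the tangent bundle of `V`. -/
abbrev AdelicMetric : Type _ := AdelicNorm str (tangentBundle str)

namespace AdelicMetric

variable (N : AdelicMetric str)

/-- The slopes `μ_i(P)` of the rational point `P`. -/
def slope (i : ℕ) (P : Points str K) : ℝ :=
  (AdelicNorm.atPoint N P).slope i

/-- The logarithmic height `h(P)`, which is the degree of the tangent space at `P`. -/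
def height (P : Points str K) : ℝ :=
  (AdelicNorm.atPoint N P).degree

open Classical in
/-- The freeness `l(P)` of the rational point `P` of a variety of dimension `n`. -/
def freeness (n : ℕ) (P : Points str K) : ℝ :=
  if 0 < slope N n P then n * slope N n P / height N P else 0

end AdelicMetric

end Varieties

end Slopes

end

/-! Everything rests on one estimate: for two adelic norms on the same bundle, the degrees of a
subspace F of the fibre at P differ by at most a constant independent of P and F
(`AdelicNorm.exists_abs_degree_sub_le`). Displacing the points (dim F, deg F) vertically by at most
C moves the upper boundary of their convex hull by at most C, hence each slope by at most 2C. For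
the freeness, l h = n max(μ_n, 0), so that (l - l') h = n (max(μ_n, 0) - max(μ'_n, 0)) + l' (h' -
h). The right side is bounded, because |l'| ≤ n: the last slope is at most the mean slope.

The estimate of degrees is local. At a fixed place w, V is projective and K_w is locally compact, so
V(K_w) is covered by finitely many compact boxes and two continuous families of norms are equivalent
with a constant uniform in the point (`IsGauge.exists_le_mul`). Equivalent norms have orthonormal
(or lattice) bases whose transition matrices have bounded entries, so the logarithms of the induced
determinant norms differ by a bounded amount.

At almost all finite places the two unit balls coincide (`AdelicNorm.eventually_fin_le_one`). By
properness a K_v-point extends to an O_v-point of both models. On the intersection of two charts,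
the transition matrix between the frames is a polynomial expression in functions from the two models
and finitely many constants of K, so it is integral at integral points for almost all v. Only
finitely many places contribute.

The degree is computed in a chosen K-basis, the same for both norms, so the comparison needs no
product formula; that formula only serves to identify the degree of the full subspace ⊤ with the
height. Neither the boundedness of the Newton polygon nor the equality dim T_P V = n is established:
the default value 0 of `sSup` is shown to be harmless and dim T_P V ≤ n is enough. -/

namespace Slopes

/-! ### Comparison of determinants -/

section Determinants

variable {k : Type*} [NormedField k] {M : Type*} [AddCommGroup M] [Module k M] {m : ℕ}

/-- The Leibniz expansion and the triangle inequality work at every place. The factor m! is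
superfluous at finite places, but only finitely many of those will be estimated this way. -/
lemma norm_det_le_of_repr_le (e e' : Basis (Fin m) k M) {A : ℝ}
    (h : ∀ i j, ‖e.repr (e' j) i‖ ≤ A) : ‖e.det e'‖ ≤ m.factorial * A ^ m := by
  rw [Basis.det_apply]
  have := Matrix.det_le (A := e.toMatrix e') (abv := NormedField.toAbsoluteValue k) (x := A)
    (fun i j => h i j)
  rw [nsmul_eq_mul, Fintype.card_fin] at this
  exact this

lemma log_norm_det_le (e e' b : Basis (Fin m) k M) {A : ℝ}
    (h : ∀ i j, ‖e.repr (e' j) i‖ ≤ A) :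
    Real.log ‖e.det b‖ ≤ Real.log (m.factorial * A ^ m) + Real.log ‖e'.det b‖ := by
  have hmul : e.det b = e.det e' * e'.det b := by
    rw [Basis.det_apply, Basis.det_apply, Basis.det_apply, ← Matrix.det_mul,
      Basis.toMatrix_mul_toMatrix]
  have h1 : e.det e' ≠ 0 := (e.isUnit_det e').ne_zero
  have h2 : e'.det b ≠ 0 := (e'.isUnit_det b).ne_zero
  rw [hmul, norm_mul, Real.log_mul (norm_ne_zero_iff.2 h1) (norm_ne_zero_iff.2 h2)]
  gcongr
  exact norm_det_le_of_repr_le e e' h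

lemma abs_log_norm_det_sub_le (e e' b : Basis (Fin m) k M) {A : ℝ}
    (h : ∀ i j, ‖e.repr (e' j) i‖ ≤ A) (h' : ∀ i j, ‖e'.repr (e j) i‖ ≤ A) :
    |Real.log ‖e.det b‖ - Real.log ‖e'.det b‖| ≤ Real.log (m.factorial * A ^ m) := by
  rw [abs_le]
  constructor
  · linarith [log_norm_det_le e' e b h']
  · linarith [log_norm_det_le e e' b h]

end Determinants

/-! ### Orthonormal bases -/

section Orthonormal

/-- Gram–Schmidt, after transport of the scalars along σ; real and complex completions are thus
treated together. -/
lemma exists_orthonormal_basis {𝕜 k : Type*} [RCLike 𝕜] [Field k] (σ : k ≃+* 𝕜) {M : Type*}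
    [AddCommGroup M] [Module k M] {m : ℕ} (b : Basis (Fin m) k M) (φ : M → M → 𝕜)
    (hadd : ∀ x x' y, φ (x + x') y = φ x y + φ x' y)
    (hsmul : ∀ c x y, φ (c • x) y = σ c * φ x y) (hsymm : ∀ x y, φ y x = star (φ x y))
    (hpos : ∀ x, x ≠ 0 → 0 < RCLike.re (φ x x)) :
    ∃ e : Basis (Fin m) k M, ∀ c : Fin m → k,
      φ (∑ i, c i • e i) (∑ i, c i • e i) = ((∑ i, ‖σ (c i)‖ ^ 2 : ℝ) : 𝕜) := by
  let : Module 𝕜 M := Module.compHom M (σ.symm : 𝕜 →+* k)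
  have hsmul' : ∀ (c : 𝕜) (x : M), c • x = σ.symm c • x := fun _ _ => rfl
  have hzero : ∀ y, φ 0 y = 0 := fun y => by simpa using hadd 0 0 y
  let core : InnerProductSpace.Core 𝕜 M :=
    -- The inner product is conjugate-linear in its first argument, whereas φ is linear there.
    { inner x y := φ y x
      conj_inner_symm x y := (hsymm x y).symm
      re_inner_nonneg x := by
        by_cases hx : x = 0
        · simp [hx, hzero]
        · exact (hpos x hx).le
      add_left x y z := by
        rw [hsymm (x + y), hadd, star_add, ← hsymm, ← hsymm]
      smul_left x y r := by
        change φ y (r • x) = star r * φ y x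
        rw [hsymm (r • x), hsmul', hsmul, RingEquiv.apply_symm_apply, star_mul', ← hsymm]
      definite x h := by
        by_contra hx
        have := hpos x hx
        rw [show φ x x = 0 from h] at this
        simp at this }
  let := core.toNormedAddCommGroup
  let : InnerProductSpace 𝕜 M := InnerProductSpace.ofCore core.toCore
  let b' : Basis (Fin m) 𝕜 M := b.mapCoeffs σ fun c x => by
    rw [hsmul', RingEquiv.symm_apply_apply]
  have : FiniteDimensional 𝕜 M := b'.finiteDimensional_of_finite
  have hfr : finrank 𝕜 M = m := by simpa using finrank_eq_card_basis b'
  let o : OrthonormalBasis (Fin m) 𝕜 M := (stdOrthonormalBasis 𝕜 M).reindex (finCongr hfr)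
  refine ⟨o.toBasis.mapCoeffs σ.symm fun c x => (hsmul' c x).symm, fun c => ?_⟩
  have key : ∑ i, c i • (o.toBasis.mapCoeffs σ.symm fun c x => (hsmul' c x).symm) i =
      ∑ i, σ (c i) • o i := by
    refine Finset.sum_congr rfl fun i _ => ?_
    rw [hsmul', RingEquiv.symm_apply_apply]
    simp
  rw [key]
  change inner 𝕜 (∑ i, σ (c i) • o i) (∑ i, σ (c i) • o i) = _
  rw [o.orthonormal.inner_sum]
  push_cast
  refine Finset.sum_congr rfl fun i _ => ?_
  rw [RCLike.conj_mul]

lemma IsEuclideanNorm.exists_basis {k : Type u} [Field k] (σ : k ≃+* ℝ) {M : Type u}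
    [AddCommGroup M] [Module k M] {N : M → ℝ} (hN : IsEuclideanNorm (σ : k →+* ℝ) N) {m : ℕ}
    (b : Basis (Fin m) k M) :
    ∃ e : Basis (Fin m) k M, ∀ c : Fin m → k, N (∑ i, c i • e i) ^ 2 = ∑ i, ‖σ (c i)‖ ^ 2 := by
  obtain ⟨φ, hadd, hsmul, hsymm, hpos, hφ⟩ := hN
  obtain ⟨e, he⟩ := exists_orthonormal_basis σ b φ hadd hsmul
    (fun x y => by simpa using hsymm x y) hpos
  refine ⟨e, fun c => ?_⟩
  rw [hφ, he, RCLike.ofReal_real_eq_id, id, Real.sq_sqrt]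
  exact Finset.sum_nonneg fun i _ => sq_nonneg _

lemma IsHermitianSquare.exists_basis {k : Type u} [Field k] (σ : k ≃+* ℂ) {M : Type u}
    [AddCommGroup M] [Module k M] {N : M → ℝ} (hN : IsHermitianSquare (σ : k →+* ℂ) N) {m : ℕ}
    (b : Basis (Fin m) k M) :
    ∃ e : Basis (Fin m) k M, ∀ c : Fin m → k, N (∑ i, c i • e i) = ∑ i, ‖σ (c i)‖ ^ 2 := by
  obtain ⟨φ, hadd, hsmul, hsymm, hpos, hφ⟩ := hN
  obtain ⟨e, he⟩ := exists_orthonormal_basis σ b φ hadd hsmul hsymm hpos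
  refine ⟨e, fun c => ?_⟩
  exact Complex.ofReal_injective ((hφ _).trans (he c))

end Orthonormal

/-! ### Lattice bases -/

section Lattice

/-- The unit ball is an O-module. Norms on a finite-dimensional space over a complete field are
equivalent, so the ball lies in a multiple of a standard lattice; it is therefore finite and
torsion-free over a principal ideal domain, hence free. An O-basis of it is a k-basis because every
vector can be scaled into the ball. -/
lemma IsUltrametricNorm.exists_basis {k : Type u} [NormedField k] [CompleteSpace k]
    (hk : ∃ x : k, 1 < ‖x‖) (O : Type u) [CommRing O] [IsDomain O] [IsPrincipalIdealRing O]
    [Algebra O k] [IsFractionRing O k] (hO : ∀ x : k, ‖x‖ ≤ 1 ↔ x ∈ (algebraMap O k).range)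
    {M : Type u} [AddCommGroup M] [Module k M] {N : M → ℝ} (hN : IsUltrametricNorm k N) {m : ℕ}
    (b : Basis (Fin m) k M) :
    ∃ e : Basis (Fin m) k M, ∀ c : Fin m → k, N (∑ i, c i • e i) ≤ 1 ↔ ∀ i, ‖c i‖ ≤ 1 := by
  let : NontriviallyNormedField k := { ‹NormedField k› with non_trivial := hk }
  have hbound : ∃ α : k, α ≠ 0 ∧ ∀ y i, N y ≤ 1 → ‖b.repr y i‖ ≤ ‖α‖ := by
    let : Norm M := ⟨N⟩
    have core : NormedSpace.Core k M :=
      { norm_nonneg y := by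
          obtain ⟨c, hc⟩ := hN.mem_range y
          exact (norm_nonneg c).trans_eq hc
        norm_smul := hN.smul
        norm_triangle x y := by
          have h1 := hN.add_le x y
          obtain ⟨c, hc⟩ := hN.mem_range x
          obtain ⟨d, hd⟩ := hN.mem_range y
          have := norm_nonneg c
          have := norm_nonneg d
          simp only at hc hd
          change N (x + y) ≤ N x + N y
          exact h1.trans (max_le (by linarith) (by linarith))
        norm_eq_zero_iff := hN.eq_zero_iff }
    let := NormedAddCommGroup.ofCore core
    let : NormedSpace k M := NormedSpace.ofCore core
    obtain ⟨α, hα⟩ := NormedField.exists_lt_norm k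
      ‖(b.equivFunL : M →L[k] (Fin m → k))‖
    refine ⟨α, fun h => ?_, fun y i hy => ?_⟩
    · rw [h, norm_zero] at hα
      exact absurd hα (not_lt.2 (norm_nonneg _))
    · have h1 : ‖b.equivFunL y‖ ≤ ‖(b.equivFunL : M →L[k] (Fin m → k))‖ * ‖y‖ :=
        (b.equivFunL : M →L[k] (Fin m → k)).le_opNorm y
      have h2 : ‖b.repr y i‖ ≤ ‖b.equivFunL y‖ := norm_le_pi_norm (b.equivFunL y) i
      have h3 : ‖y‖ ≤ 1 := hy
      calc _ ≤ _ := h2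
        _ ≤ _ := h1
        _ ≤ ‖(b.equivFunL : M →L[k] (Fin m → k))‖ * 1 := by gcongr
        _ ≤ _ := by rw [mul_one]; exact hα.le
  obtain ⟨α, hα0, hα⟩ := hbound
  let : Module O M := Module.compHom M (algebraMap O k)
  have : IsScalarTower O k M := ⟨fun a c y => by
    change (a • c) • y = algebraMap O k a • c • y
    rw [smul_smul, Algebra.smul_def]⟩
  let L : Submodule O M :=
    { carrier := {y | N y ≤ 1}
      zero_mem' := by simp [(hN.eq_zero_iff 0).2 rfl]
      add_mem' {x y} hx hy := (hN.add_le x y).trans (max_le hx hy)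
      smul_mem' a y hy := by
        change N (a • y) ≤ 1
        rw [← algebraMap_smul k a y, hN.smul]
        exact mul_le_one₀ ((hO _).2 ⟨a, rfl⟩) (by
          obtain ⟨c, hc⟩ := hN.mem_range y
          exact (norm_nonneg c).trans_eq hc) hy }
  have hmemL : ∀ y, y ∈ L ↔ N y ≤ 1 := fun _ => Iff.rfl
  have hinj : Function.Injective (algebraMap O k) := IsFractionRing.injective O k
  -- Division by α makes the coordinates integral on the ball, which embeds it in `Fin m → O`.
  have hint : ∀ (y : L) i, ∃ a : O, algebraMap O k a = α⁻¹ * b.repr y.1 i := fun y i => by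
    refine (hO _).1 ?_
    rw [norm_mul, norm_inv, inv_mul_le_iff₀ (norm_pos_iff.2 hα0), mul_one]
    exact hα y.1 i y.2
  choose f hf using hint
  let F : L →ₗ[O] (Fin m → O) :=
    { toFun y := f y
      map_add' x y := by
        ext i
        apply hinj
        simp [hf, mul_add]
      map_smul' a y := by
        ext i
        apply hinj
        have : ((a • y : L) : M) = algebraMap O k a • y.1 := (algebraMap_smul k a y.1).symm
        simp only [Pi.smul_apply, smul_eq_mul, map_mul, hf, this, map_smul, Finsupp.smul_apply,
          RingHom.id_apply]
        ring }
  have hF : Function.Injective F := fun x y hxy => by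
    refine Subtype.ext (b.repr.injective (Finsupp.ext fun i => ?_))
    have h1 := congrArg (algebraMap O k) (congrFun hxy i)
    change algebraMap O k (f x i) = algebraMap O k (f y i) at h1
    rw [hf, hf] at h1
    exact mul_left_cancel₀ (inv_ne_zero hα0) h1
  have : Module.Finite O L := Module.Finite.of_injective F hF
  have : Module.Free O L := by
    have : IsTorsionFree O L := hF.moduleIsTorsionFree F F.map_smul
    infer_instance
  let c := Module.Free.chooseBasis O L
  have hli : LinearIndependent k fun i => (c i : M) := by
    refine (LinearIndependent.iff_fractionRing O k).1 ?_
    exact c.linearIndependent.map' L.subtype L.ker_subtype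
  have hsp : ⊤ ≤ Submodule.span k (Set.range fun i => (c i : M)) := by
    have h1 : ∀ y ∈ L, y ∈ Submodule.span k (Set.range fun i => (c i : M)) := fun y hy => by
      have : (⟨y, hy⟩ : L) = ∑ i, c.repr ⟨y, hy⟩ i • c i := (c.sum_repr _).symm
      have h2 : y = ∑ i, algebraMap O k (c.repr ⟨y, hy⟩ i) • (c i : M) := by
        have := congrArg Subtype.val this
        simpa only [Submodule.coe_sum, Submodule.coe_smul, algebraMap_smul] using this
      rw [h2]
      exact Submodule.sum_mem _ fun i _ =>
        Submodule.smul_mem _ _ (Submodule.subset_span ⟨i, rfl⟩)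
    intro y _
    by_cases hy : y = 0
    · rw [hy]
      exact Submodule.zero_mem _
    -- The norm has its values in the image of the absolute value, so y can be scaled to norm
    -- exactly 1.
    obtain ⟨d, hd⟩ := hN.mem_range y
    have hd0 : d ≠ 0 := by
      rintro rfl
      exact hy ((hN.eq_zero_iff y).1 (by simpa using hd.symm))
    have h2 := h1 (d⁻¹ • y) (by
      rw [hmemL, hN.smul, norm_inv, ← hd]
      exact (inv_mul_cancel₀ (norm_ne_zero_iff.2 hd0)).le)
    have := Submodule.smul_mem _ d h2
    rwa [smul_inv_smul₀ hd0] at this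
  let e₀ := Basis.mk hli hsp
  let e := e₀.reindex (e₀.indexEquiv b)
  have heL : ∀ i, e i ∈ L := fun i => by
    simp only [e, Basis.reindex_apply, e₀, Basis.mk_apply]
    exact (c _).2
  refine ⟨e, fun x => ⟨fun hx i => ?_, fun hx => ?_⟩⟩
  · have h1 := c.sum_repr ⟨_, (hmemL _).2 hx⟩
    have h2 := congrArg Subtype.val h1
    simp only [Submodule.coe_sum, Submodule.coe_smul] at h2
    have h3 : e.repr (∑ i, x i • e i) i = x i := by
      rw [← e.equivFun_symm_apply, ← e.equivFun_apply, LinearEquiv.apply_symm_apply]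
    rw [hO, ← h3, ← h2]
    have h4 : ∀ j, (c j : M) = e (e₀.indexEquiv b j) := fun j => by
      simp [e, e₀]
    simp only [← algebraMap_smul k (_ : O) (_ : M), h4, map_sum, map_smul, Finsupp.coe_finsetSum,
      Finset.sum_apply, Basis.repr_self, Finsupp.smul_apply, smul_eq_mul]
    refine Subring.sum_mem _ fun j _ => Subring.mul_mem _ ⟨_, rfl⟩ ?_
    rw [Finsupp.single_apply]
    split_ifs
    · exact Subring.one_mem _
    · exact Subring.zero_mem _
  · rw [← hmemL]
    refine Submodule.sum_mem _ fun i _ => ?_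
    obtain ⟨a, ha⟩ := (hO _).1 (hx i)
    rw [← ha, algebraMap_smul]
    exact L.smul_mem _ (heL i)

end Lattice

/-! ### Comparison of Newton polygons -/

namespace NormFamily

variable {K : Type u} [Field K] [NumberField K] {E : Type u} [AddCommGroup E] [Module K E]

/-- The points at vertical distance at most C from the second polygon form a convex set, so only the
generators of the first one have to be tested. -/
lemma exists_mem_newtonPolygon {N N' : NormFamily K E} {C : ℝ}
    (hC : ∀ F : Submodule K E, |(N.restrict F).degree - (N'.restrict F).degree| ≤ C)
    {p : ℝ × ℝ} (hp : p ∈ N.newtonPolygon) :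
    ∃ y, (p.1, y) ∈ N'.newtonPolygon ∧ |p.2 - y| ≤ C := by
  have hconv : Convex ℝ {p : ℝ × ℝ | ∃ y, (p.1, y) ∈ N'.newtonPolygon ∧ |p.2 - y| ≤ C} := by
    rintro p ⟨y, hy, hpy⟩ q ⟨z, hz, hqz⟩ a b ha hb hab
    refine ⟨a * y + b * z, ?_, ?_⟩
    · have := convex_convexHull ℝ _ hy hz ha hb hab
      simpa [newtonPolygon] using this
    · simp only [Prod.snd_add, Prod.smul_snd, smul_eq_mul]
      rw [abs_le] at hpy hqz ⊢
      have hb' : b = 1 - a := by linarith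
      subst hb'
      constructor <;> nlinarith
  refine convexHull_min ?_ hconv hp
  rintro _ ⟨F, rfl⟩
  exact ⟨_, subset_convexHull ℝ _ ⟨F, rfl⟩, hC F⟩

/-- `sSup` has the default value 0 on empty sets and on sets unbounded above. Vertical slices of the
two polygons are empty, or unbounded, simultaneously, so the inequality holds without knowing that
the polygons are bounded. -/
lemma upperBoundary_le {N N' : NormFamily K E} {C : ℝ} (hC0 : 0 ≤ C)
    (hC : ∀ F : Submodule K E, |(N.restrict F).degree - (N'.restrict F).degree| ≤ C) (x : ℝ) :
    N.upperBoundary x ≤ N'.upperBoundary x + C := by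
  have hC' : ∀ F : Submodule K E, |(N'.restrict F).degree - (N.restrict F).degree| ≤ C :=
    fun F => by rw [abs_sub_comm]; exact hC F
  unfold upperBoundary
  rcases Set.eq_empty_or_nonempty {y | (x, y) ∈ N.newtonPolygon} with h | h
  · have h' : {y | (x, y) ∈ N'.newtonPolygon} = ∅ := by
      rw [Set.eq_empty_iff_forall_notMem] at h ⊢
      intro y hy
      obtain ⟨z, hz, -⟩ := exists_mem_newtonPolygon hC' hy
      exact h z hz
    rw [h, h']
    simpa using hC0
  by_cases hb : BddAbove {y | (x, y) ∈ N'.newtonPolygon}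
  · refine csSup_le h fun y hy => ?_
    obtain ⟨z, hz, hyz⟩ := exists_mem_newtonPolygon hC hy
    have := le_csSup hb hz
    have := (abs_le.1 hyz).2
    simp only at this
    linarith
  · have hb' : ¬ BddAbove {y | (x, y) ∈ N.newtonPolygon} := by
      rintro ⟨B, hB⟩
      refine hb ⟨B + C, fun y hy => ?_⟩
      obtain ⟨z, hz, hyz⟩ := exists_mem_newtonPolygon hC' hy
      have := hB hz
      have := (abs_le.1 hyz).2
      simp only at this
      linarith
    rw [Real.sSup_of_not_bddAbove hb, Real.sSup_of_not_bddAbove hb']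
    simpa using hC0

lemma abs_upperBoundary_sub_le {N N' : NormFamily K E} {C : ℝ}
    (hC : ∀ F : Submodule K E, |(N.restrict F).degree - (N'.restrict F).degree| ≤ C) (x : ℝ) :
    |N.upperBoundary x - N'.upperBoundary x| ≤ C := by
  have hC0 : 0 ≤ C := (abs_nonneg _).trans (hC ⊥)
  have h1 := upperBoundary_le hC0 hC x
  have h2 := upperBoundary_le hC0 (fun F => by rw [abs_sub_comm]; exact hC F) x
  rw [abs_le]
  constructor <;> linarith

lemma abs_slope_sub_le {N N' : NormFamily K E} {C : ℝ}
    (hC : ∀ F : Submodule K E, |(N.restrict F).degree - (N'.restrict F).degree| ≤ C) (i : ℕ) :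
    |N.slope i - N'.slope i| ≤ 2 * C := by
  have h1 := abs_le.1 (abs_upperBoundary_sub_le hC i)
  have h2 := abs_le.1 (abs_upperBoundary_sub_le hC ((i : ℝ) - 1))
  unfold slope
  rw [abs_le]
  constructor <;> linarith

/-! ### The right end of the Newton polygon and the last slope -/

lemma degree_eq_zero_of_finrank_eq_zero (N : NormFamily K E) (h : finrank K E = 0) :
    N.degree = 0 := by
  have : IsEmpty (Fin (finrank K E)) := by rw [h]; infer_instance
  unfold degree
  split_ifs
  · have h1 : ∀ w : InfinitePlace K, Real.log (N.detInf w (finBasis K E)) = 0 := fun w => by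
      unfold detInf
      split_ifs
      · simp [Basis.det_isEmpty]
      · simp
    have h2 : ∀ v : HeightOneSpectrum (𝓞 K), Real.log (N.detFin v (finBasis K E)) = 0 := fun v => by
      unfold detFin
      split_ifs
      · simp [Basis.det_isEmpty]
      · simp
    simp [h1, h2]
  · rfl

variable [Module.Finite K E] (N : NormFamily K E)

/-- A convex combination attains the maximal abscissa dim E only if every point of positive weight
does, and ⊤ is the only subspace of that dimension. -/
lemma mem_newtonPolygon_finrank {p : ℝ × ℝ} (hp : p ∈ N.newtonPolygon) :
    p.1 ≤ finrank K E ∧ (p.1 = finrank K E → p.2 = (N.restrict ⊤).degree) := by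
  refine convexHull_min
    (t := {p : ℝ × ℝ | p.1 ≤ finrank K E ∧ (p.1 = finrank K E → p.2 = (N.restrict ⊤).degree)})
    ?_ ?_ hp
  · rintro _ ⟨F, rfl⟩
    refine ⟨by simpa using Submodule.finrank_le F, fun h => ?_⟩
    have h' : finrank K F = finrank K E := Nat.cast_injective (R := ℝ) h
    rw [Submodule.eq_top_of_finrank_eq h']
  · rintro p ⟨hp1, hp2⟩ q ⟨hq1, hq2⟩ a b ha hb hab
    simp only [Set.mem_ofPred_eq, Prod.fst_add, Prod.smul_fst, smul_eq_mul, Prod.snd_add,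
      Prod.smul_snd]
    have hb' : b = 1 - a := by linarith
    subst hb'
    refine ⟨by nlinarith, fun h => ?_⟩
    rcases ha.eq_or_lt with rfl | ha
    · simp only [zero_mul, sub_zero, one_mul, zero_add] at h ⊢
      exact hq2 h
    rcases hb.eq_or_lt with hb | hb
    · have : a = 1 := by linarith
      subst this
      simp only [sub_self, zero_mul, one_mul, add_zero] at h ⊢
      exact hp2 h
    have e1 : p.1 = finrank K E := by nlinarith
    have e2 : q.1 = finrank K E := by nlinarith
    rw [hp2 e1, hq2 e2]
    ring

lemma upperBoundary_of_finrank_lt {x : ℝ} (hx : finrank K E < x) : N.upperBoundary x = 0 := by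
  have : {y | (x, y) ∈ N.newtonPolygon} = ∅ := Set.eq_empty_iff_forall_notMem.2 fun y hy =>
    absurd (N.mem_newtonPolygon_finrank hy).1 (not_le.2 hx)
  rw [upperBoundary, this, Real.sSup_empty]

omit [Module.Finite K E] in
lemma top_mem_newtonPolygon : ((finrank K E : ℝ), (N.restrict ⊤).degree) ∈ N.newtonPolygon :=
  subset_convexHull ℝ _ ⟨⊤, by simp⟩

lemma upperBoundary_finrank : N.upperBoundary (finrank K E) = (N.restrict ⊤).degree := by
  have : {y | ((finrank K E : ℝ), y) ∈ N.newtonPolygon} = {(N.restrict ⊤).degree} := by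
    ext y
    refine ⟨fun hy => (N.mem_newtonPolygon_finrank hy).2 rfl, ?_⟩
    rintro rfl
    exact N.top_mem_newtonPolygon
  rw [upperBoundary, this, csSup_singleton]

/-- The chord from (0, 0) to (n, deg) lies in the polygon, so the boundary at n - 1 is at least (n -
1)/n · deg. -/
lemma mul_slope_le {n : ℕ} (hn : 1 ≤ n) (hE : finrank K E = n)
    (hb : BddAbove {y | ((n : ℝ) - 1, y) ∈ N.newtonPolygon}) :
    n * N.slope n ≤ (N.restrict ⊤).degree := by
  have h0 : ((0 : ℝ), (0 : ℝ)) ∈ N.newtonPolygon := subset_convexHull ℝ _ ⟨⊥, by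
    have := (N.restrict ⊥).degree_eq_zero_of_finrank_eq_zero (by simp)
    simp [this]⟩
  have h1 := N.top_mem_newtonPolygon
  rw [hE] at h1
  have hn' : (1 : ℝ) ≤ n := by exact_mod_cast hn
  have h2 := convex_convexHull ℝ _ h0 h1 (a := 1 / n) (b := ((n : ℝ) - 1) / n) (by positivity)
    (div_nonneg (by linarith) (by linarith)) (by field_simp; ring)
  have h3 : ((n : ℝ) - 1, ((n : ℝ) - 1) / n * (N.restrict ⊤).degree) ∈ N.newtonPolygon := by
    have e : ((n : ℝ) - 1) / n * n = n - 1 := by field_simp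
    simpa [e, newtonPolygon] using h2
  have h4 := le_csSup hb h3
  have h5 := N.upperBoundary_finrank
  rw [hE] at h5
  have h6 : N.slope n ≤ (N.restrict ⊤).degree - ((n : ℝ) - 1) / n * (N.restrict ⊤).degree := by
    unfold slope
    rw [h5]
    unfold upperBoundary
    linarith
  calc n * N.slope n
      ≤ n * ((N.restrict ⊤).degree - ((n : ℝ) - 1) / n * (N.restrict ⊤).degree) := by gcongr
    _ = _ := by field_simp; ring

/-- This bounds the freeness by n. Besides the concavity argument of `mul_slope_le`, it covers the
degenerate cases left open by `finrank K E ≤ n` and by the default value of `sSup`. -/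
lemma abs_mul_slope_div_le {n : ℕ} (hE : finrank K E ≤ n) (hpos : 0 < N.slope n) :
    ((N.restrict ⊤).degree = 0 → n = 0) ∧ |n * N.slope n / (N.restrict ⊤).degree| ≤ n := by
  rcases Nat.eq_zero_or_pos n with rfl | hn
  · simp
  have hn' : (1 : ℝ) ≤ n := by exact_mod_cast hn
  rcases hE.lt_or_eq with h | h
  -- The abscissa n lies beyond the polygon, where the boundary reads 0. A positive slope then
  -- forces dim E = n - 1, and it equals minus the degree.
  · have h1 : N.upperBoundary n = 0 := N.upperBoundary_of_finrank_lt (by exact_mod_cast h)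
    have hs : N.slope n = - N.upperBoundary ((n : ℝ) - 1) := by
      rw [slope, h1, zero_sub]
    rcases (Nat.le_sub_one_of_lt h).lt_or_eq with h' | h'
    · have : N.upperBoundary ((n : ℝ) - 1) = 0 := by
        apply N.upperBoundary_of_finrank_lt
        rw [← Nat.cast_pred hn]
        exact_mod_cast h'
      rw [hs, this] at hpos
      simp at hpos
    · have : N.upperBoundary ((n : ℝ) - 1) = (N.restrict ⊤).degree := by
        rw [← Nat.cast_pred hn, ← h']
        exact N.upperBoundary_finrank
      rw [this] at hs
      rw [hs] at hpos ⊢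
      have h0 : (N.restrict ⊤).degree ≠ 0 := by
        intro h
        rw [h] at hpos
        simp at hpos
      refine ⟨fun h => absurd h h0, ?_⟩
      rw [mul_neg, neg_div, mul_div_cancel_right₀ _ h0, abs_neg, abs_of_nonneg (by positivity)]
  · by_cases hb : BddAbove {y | ((n : ℝ) - 1, y) ∈ N.newtonPolygon}
    · have h1 := N.mul_slope_le hn h hb
      have h2 : 0 < n * N.slope n := by positivity
      have h3 : 0 < (N.restrict ⊤).degree := h2.trans_le h1
      refine ⟨fun h => absurd h h3.ne', ?_⟩
      rw [abs_of_pos (by positivity)]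
      exact ((div_le_one h3).2 h1).trans hn'
    -- The supremum of an unbounded slice reads 0, so the slope is the whole degree and the quotient
    -- is n.
    · have h1 : N.slope n = (N.restrict ⊤).degree := by
        have h5 := N.upperBoundary_finrank
        rw [h] at h5
        rw [slope, h5, upperBoundary, Real.sSup_of_not_bddAbove hb, sub_zero]
      rw [← h1]
      refine ⟨fun h => absurd h hpos.ne', ?_⟩
      rw [mul_div_cancel_right₀ _ hpos.ne', abs_of_nonneg (by positivity)]

end NormFamily

/-! ### From bounded differences of degrees to slopes and freeness -/

/-- Multiplication by the height removes the case distinction: l h = n max(a, 0), and likewise for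
l'. Then (l - l') h = n (max(a, 0) - max(a', 0)) + l' (h' - h) with |l'| ≤ n, and only h needs to be
positive. -/
lemma abs_freeness_sub_le {h h' a a' C D l l' : ℝ} {n : ℕ} (hh : 0 < h) (hD : |h - h'| ≤ D)
    (hC : |a - a'| ≤ C) (hl : l = if 0 < a then n * a / h else 0)
    (hl' : l' = if 0 < a' then n * a' / h' else 0) (hln : 0 < a' → |n * a' / h'| ≤ n)
    (hh' : 0 < a' → h' = 0 → n = 0) :
    |l - l'| ≤ (n * C + n * D) / h := by
  have e1 : l * h = n * max a 0 := by
    rw [hl]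
    split_ifs with ha
    · rw [div_mul_cancel₀ _ hh.ne', max_eq_left ha.le]
    · rw [max_eq_right (not_lt.1 ha)]; simp
  have e2 : l' * h' = n * max a' 0 := by
    rw [hl']
    split_ifs with ha
    · rw [max_eq_left ha.le]
      -- Division by h' = 0 gives 0; the identity survives because then n = 0.
      by_cases h0 : h' = 0
      · simp [hh' ha h0]
      · rw [div_mul_cancel₀ _ h0]
    · rw [max_eq_right (not_lt.1 ha)]; simp
  have e3 : |l'| ≤ n := by
    rw [hl']
    split_ifs with ha
    · exact hln ha
    · simp
  have e4 : |max a 0 - max a' 0| ≤ C := (abs_max_sub_max_le_abs a a' 0).trans hC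
  have e5 : (l - l') * h = n * (max a 0 - max a' 0) + l' * (h' - h) := by
    have : (l - l') * h = l * h - l' * h' + l' * (h' - h) := by ring
    rw [this, e1, e2]
    ring
  rw [le_div_iff₀ hh]
  calc |l - l'| * h = |(l - l') * h| := by rw [abs_mul, abs_of_pos hh]
    _ ≤ |n * (max a 0 - max a' 0)| + |l' * (h' - h)| := by rw [e5]; exact abs_add_le _ _
    _ ≤ n * C + n * D := by
        rw [abs_mul, abs_mul, Nat.abs_cast, abs_sub_comm h' h]
        gcongr

namespace AdelicMetric

variable {K : Type u} [Field K] [NumberField K] {V : Scheme.{u}} {str : V ⟶ Spec (.of K)}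

theorem slope_freeness_of_degree (N N' : AdelicMetric str) (n : ℕ)
    (hfin : ∀ P : Points str K, Module.Finite K (Fibre (tangentBundle str) P))
    (hdim : ∀ P : Points str K, finrank K (Fibre (tangentBundle str) P) ≤ n)
    (htop : ∀ P : Points str K, ((AdelicNorm.atPoint N P).restrict ⊤).degree = height N P)
    (htop' : ∀ P : Points str K, ((AdelicNorm.atPoint N' P).restrict ⊤).degree = height N' P)
    {C : ℝ} (hC : ∀ (P : Points str K) (F : Submodule K (Fibre (tangentBundle str) P)),
      |((AdelicNorm.atPoint N P).restrict F).degree -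
        ((AdelicNorm.atPoint N' P).restrict F).degree| ≤ C) :
    (∀ i : ℕ, 1 ≤ i → i ≤ n → ∃ C : ℝ, ∀ P : Points str K, |slope N i P - slope N' i P| ≤ C) ∧
    ∃ C : ℝ, 0 < C ∧ ∀ P : Points str K, 0 < height N P →
      |freeness N n P - freeness N' n P| < C / height N P := by
  refine ⟨fun i _ _ => ⟨2 * C, fun P => NormFamily.abs_slope_sub_le (hC P) i⟩, ?_⟩
  -- C could be negative if V(K) is empty, hence |C|. The summand 1 gives both positivity and the
  -- strict inequality.
  refine ⟨n * (2 * |C|) + n * |C| + 1, by positivity, fun P hP => ?_⟩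
  have hC' := fun F => (hC P F).trans (le_abs_self C)
  have := abs_freeness_sub_le (n := n) (C := 2 * |C|) (D := |C|) hP (h' := height N' P)
    (by rw [← htop, ← htop']; exact hC' ⊤)
    (NormFamily.abs_slope_sub_le hC' n)
    (l := freeness N n P) (l' := freeness N' n P) (by unfold freeness slope; rfl)
    (by unfold freeness slope; rfl) ?_ ?_
  · refine this.trans_lt ?_
    exact div_lt_div_of_pos_right (lt_add_one _) hP
  · intro h
    rw [← htop']
    exact (NormFamily.abs_mul_slope_div_le _ (hdim P) h).2
  · intro h h0
    rw [← htop'] at h0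
    exact (NormFamily.abs_mul_slope_div_le _ (hdim P) h).1 h0

end AdelicMetric

/-! ### Completions of number fields -/

section Completions

variable {K : Type u} [Field K] [NumberField K]

open HeightOneSpectrum in
lemma norm_adicCompletion_le_one_iff (v : HeightOneSpectrum (𝓞 K)) (x : v.adicCompletion K) :
    ‖x‖ ≤ 1 ↔ x ∈ v.adicCompletionIntegers K := by
  rw [NumberField.FinitePlace.norm_def, mem_adicCompletionIntegers]
  norm_cast
  exact WithZeroMulInt.toNNReal_le_one_iff (NumberField.HeightOneSpectrum.one_lt_absNorm_nnreal v)

lemma norm_adicCompletion_lt_one_iff (v : HeightOneSpectrum (𝓞 K)) (x : v.adicCompletion K) :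
    ‖x‖ < 1 ↔ Valued.v x < 1 := by
  rw [NumberField.FinitePlace.norm_def]
  norm_cast
  exact WithZeroMulInt.toNNReal_lt_one_iff (NumberField.HeightOneSpectrum.one_lt_absNorm_nnreal v)

lemma norm_adicCompletion_le_one_iff_mem_range (v : HeightOneSpectrum (𝓞 K))
    (x : v.adicCompletion K) :
    ‖x‖ ≤ 1 ↔ x ∈ (algebraMap (v.adicCompletionIntegers K) (v.adicCompletion K)).range := by
  rw [norm_adicCompletion_le_one_iff]
  exact ⟨fun h => ⟨⟨x, h⟩, rfl⟩, fun ⟨y, hy⟩ => hy ▸ y.2⟩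

lemma exists_one_lt_norm_adicCompletion (v : HeightOneSpectrum (𝓞 K)) :
    ∃ x : v.adicCompletion K, 1 < ‖x‖ := by
  let _ := Valued.toNontriviallyNormedField (L := v.adicCompletion K) (Γ₀ := WithZero (Multiplicative ℤ))
  exact NontriviallyNormedField.non_trivial

/-- K is dense in K_v, and a v-integral element of K is congruent modulo v to an element of 𝓞 K, so
𝓞 K / v surjects onto the residue field. This finiteness is what makes closed balls of K_v compact.
-/
lemma finite_residueField_adicCompletionIntegers (v : HeightOneSpectrum (𝓞 K)) :
    Finite (IsLocalRing.ResidueField (v.adicCompletionIntegers K)) := by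
  have hunit : ∀ y : v.adicCompletionIntegers K, Valued.v (y : v.adicCompletion K) < 1 →
      IsLocalRing.residue (v.adicCompletionIntegers K) y = 0 := fun y hy => by
    rw [IsLocalRing.residue_eq_zero_iff, IsLocalRing.mem_maximalIdeal, mem_nonunits_iff,
      HeightOneSpectrum.adicCompletionIntegers.isUnit_iff_valued_eq_one]
    exact hy.ne
  let f : 𝓞 K →+* IsLocalRing.ResidueField (v.adicCompletionIntegers K) :=
    (IsLocalRing.residue _).comp (algebraMap (𝓞 K) (v.adicCompletionIntegers K))
  have hcoe : ∀ r : 𝓞 K, ((algebraMap (𝓞 K) (v.adicCompletionIntegers K) r :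
      v.adicCompletionIntegers K) : v.adicCompletion K) =
      algebraMap K (v.adicCompletion K) (algebraMap (𝓞 K) K r) := fun r => rfl
  have hval : ∀ c : K, Valued.v (algebraMap K (v.adicCompletion K) c) = v.valuation K c :=
    fun c => HeightOneSpectrum.valuedAdicCompletion_eq_valuation' v c
  have hf : ∀ a ∈ v.asIdeal, f a = 0 := fun a ha => hunit _ <| by
    rw [hcoe, hval, HeightOneSpectrum.valuation_lt_one_iff_mem]
    exact ha
  have hsurj : Function.Surjective (Ideal.Quotient.lift v.asIdeal f hf) := by
    intro z
    obtain ⟨x, rfl⟩ := IsLocalRing.residue_surjective z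
    obtain ⟨k, hk⟩ := (HeightOneSpectrum.denseRange_algebraMap K v).exists_dist_lt
      (x : v.adicCompletion K) one_pos
    rw [dist_eq_norm, norm_adicCompletion_lt_one_iff] at hk
    have hk1 : v.valuation K k ≤ 1 := by
      rw [← hval, ← sub_sub_cancel (x : v.adicCompletion K) (algebraMap K _ k)]
      exact (Valuation.map_sub _ _ _).trans (max_le x.2 hk.le)
    obtain ⟨a, ha⟩ := v.exists_valuation_sub_lt_of_integer hk1 1
    rw [← hval, map_sub] at ha
    refine ⟨Ideal.Quotient.mk _ a, ?_⟩
    rw [Ideal.Quotient.lift_mk, ← sub_eq_zero]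
    refine (map_sub (IsLocalRing.residue _) _ _).symm.trans (hunit _ ?_)
    have e : ((algebraMap (𝓞 K) (v.adicCompletionIntegers K) a - x : v.adicCompletionIntegers K) :
        v.adicCompletion K) = (algebraMap K (v.adicCompletion K) (algebraMap (𝓞 K) K a) -
          algebraMap K (v.adicCompletion K) k) - (x - algebraMap K (v.adicCompletion K) k) := by
      rw [sub_sub_sub_cancel_right, ← hcoe]
      rfl
    rw [e]
    exact (Valuation.map_sub _ _ _).trans_lt (max_lt ha hk)
  have : Finite (𝓞 K ⧸ v.asIdeal) := v.asIdeal.finiteQuotientOfFreeOfNeBot v.ne_bot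
  exact Finite.of_surjective _ hsurj

instance properSpace_adicCompletion (v : HeightOneSpectrum (𝓞 K)) :
    ProperSpace (v.adicCompletion K) := by
  have := finite_residueField_adicCompletionIntegers v
  refine Valued.integer.properSpace_iff_completeSpace_and_isDiscreteValuationRing_integer_and_finite_residueField.2 ⟨inferInstance, ?_, ?_⟩
  · exact inferInstanceAs (IsDiscreteValuationRing (v.adicCompletionIntegers K))
  · exact this

omit [NumberField K] in
lemma exists_one_lt_norm_completion (w : InfinitePlace K) : ∃ x : w.Completion, 1 < ‖x‖ := by
  refine ⟨algebraMap K _ 2, ?_⟩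
  have := InfinitePlace.Completion.norm_coe w ((WithAbs.equiv w.1).symm 2)
  refine lt_of_lt_of_eq ?_ this.symm
  rw [RingEquiv.apply_symm_apply, ← InfinitePlace.norm_embedding_eq, map_ofNat]
  norm_num

instance properSpace_completion (w : InfinitePlace K) : ProperSpace w.Completion := by
  let _ : NontriviallyNormedField w.Completion :=
    { (inferInstance : NormedField w.Completion) with non_trivial := exists_one_lt_norm_completion w }
  exact .of_nontriviallyNormedField_of_weaklyLocallyCompactSpace w.Completion

omit [NumberField K] in
lemma norm_algebraMap_completion (w : InfinitePlace K) (c : K) :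
    ‖algebraMap K w.Completion c‖ = w c :=
  InfinitePlace.Completion.norm_coe w ((WithAbs.equiv w.1).symm c)

lemma eventually_norm_algebraMap_le_one (c : K) :
    ∀ᶠ v : HeightOneSpectrum (𝓞 K) in Filter.cofinite, ‖algebraMap K (v.adicCompletion K) c‖ ≤ 1 := by
  rw [Filter.eventually_cofinite]
  refine (HeightOneSpectrum.Support.finite (𝓞 K) c).subset fun v hv => ?_
  simp only [Set.mem_ofPred_eq, norm_adicCompletion_le_one_iff] at hv
  change 1 < v.valuation K c
  rw [HeightOneSpectrum.mem_adicCompletionIntegers, not_le] at hv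
  exact hv.trans_eq (HeightOneSpectrum.valuedAdicCompletion_eq_valuation' v c)

/-- Finiteness of the support accompanies the formula because `finsum` is additive only for finite
supports. -/
lemma product_formula {c : K} (hc : c ≠ 0) :
    (Set.Finite (Function.support fun v : HeightOneSpectrum (𝓞 K) =>
      Real.log ‖algebraMap K (v.adicCompletion K) c‖)) ∧
    ∑ w : InfinitePlace K, Real.log (‖algebraMap K w.Completion c‖ ^ w.mult) +
      ∑ᶠ v : HeightOneSpectrum (𝓞 K), Real.log ‖algebraMap K (v.adicCompletion K) c‖ = 0 := by
  have hsupp : Set.Finite (Function.mulSupport fun v : HeightOneSpectrum (𝓞 K) =>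
      ‖algebraMap K (v.adicCompletion K) c‖) := by
    have := FinitePlace.hasFiniteMulSupport hc
    refine (this.image FinitePlace.equivHeightOneSpectrum).subset fun v hv => ?_
    refine ⟨FinitePlace.equivHeightOneSpectrum.symm v, ?_, Equiv.apply_symm_apply _ _⟩
    exact hv
  have hfin : Set.Finite (Function.support fun v : HeightOneSpectrum (𝓞 K) =>
      Real.log ‖algebraMap K (v.adicCompletion K) c‖) := by
    refine hsupp.subset fun v hv h => hv ?_
    simp only at h ⊢
    rw [h, Real.log_one]
  refine ⟨hfin, ?_⟩
  have h1 := NumberField.prod_abs_eq_one hc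
  have hne : ∀ v : HeightOneSpectrum (𝓞 K), ‖algebraMap K (v.adicCompletion K) c‖ ≠ 0 :=
    fun v => norm_ne_zero_iff.2 ((map_ne_zero _).2 hc)
  have hne' : ∀ w : InfinitePlace K, ‖algebraMap K w.Completion c‖ ^ w.mult ≠ 0 :=
    fun w => pow_ne_zero _ (norm_ne_zero_iff.2 ((map_ne_zero _).2 hc))
  have h2 : ∏ᶠ w : FinitePlace K, w c =
      ∏ᶠ v : HeightOneSpectrum (𝓞 K), ‖algebraMap K (v.adicCompletion K) c‖ := by
    rw [← finprod_comp_equiv FinitePlace.equivHeightOneSpectrum.symm]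
    rfl
  have hsub : (Function.support fun v : HeightOneSpectrum (𝓞 K) =>
      Real.log ‖algebraMap K (v.adicCompletion K) c‖) ⊆ hsupp.toFinset := fun v hv => by
    rw [Set.Finite.coe_toFinset]
    intro h
    refine hv ?_
    simp only at h ⊢
    rw [h, Real.log_one]
  rw [h2, finprod_eq_prod _ hsupp] at h1
  rw [finsum_eq_sum_of_support_subset _ hsub, ← Real.log_prod fun v _ => hne v,
    ← Real.log_prod fun w _ => hne' w, ← Real.log_mul, ← Real.log_one, ← h1]
  · simp only [norm_algebraMap_completion]
  · exact Finset.prod_ne_zero_iff.2 fun w _ => hne' w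
  · exact Finset.prod_ne_zero_iff.2 fun v _ => hne v

end Completions

end Slopes

noncomputable section

namespace Slopes

/-! ### Frames and fibres -/

namespace RelModule

variable {X : Scheme.{u}} (E : RelModule X)

lemma over_hom_ext {U : X.Opens} {T : Over X} (f g : T ⟶ Over.mk U.ι) : f = g := by
  ext1
  rw [← cancel_mono U.ι]
  exact (Over.w f).trans (Over.w g).symm

lemma map_eq_of_opens {U : X.Opens} {T : Over X} (f g : T ⟶ Over.mk U.ι)
    (x : E.obj (Over.mk U.ι)) :
    E.map f x = E.map g x := by
  rw [over_hom_ext f g]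

/-- The module `E` has frames locally on `X`. -/
def HasLocalFrames : Prop :=
  ∀ x : X, ∃ U : X.Opens, x ∈ U ∧ ∃ (r : ℕ) (s : Fin r → E.obj (Over.mk U.ι)), E.IsFrame U s

variable {E}

/-- Restriction of a section over `U` to a smaller open subset. -/
def resSection (E : RelModule X) {U U' : X.Opens} (h : U' ≤ U) (s : E.obj (Over.mk U.ι)) :
    E.obj (Over.mk U'.ι) :=
  E.map (Over.homMk (X.homOfLE h) (by simp) : Over.mk U'.ι ⟶ Over.mk U.ι) s

lemma IsFrame.restrict {U U' : X.Opens} (h : U' ≤ U) {r : ℕ} {s : Fin r → E.obj (Over.mk U.ι)}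
    (hs : E.IsFrame U s) : E.IsFrame U' fun i => E.resSection h (s i) := by
  intro T g
  have := hs T (g ≫ (Over.homMk (X.homOfLE h) (by simp) : Over.mk U'.ι ⟶ Over.mk U.ι))
  simpa only [resSection, ← E.map_comp] using this

end RelModule

section Fibres

variable {K : Type u} [Field K] {V : Scheme.{u}} {str : V ⟶ Spec (.of K)} {E : RelModule V}
  {k : Type u} [Field k] [Algebra K k]

lemma fibre_smul_def (P : Points str k) (c : k) (x : Fibre E P) :
    c • x = (E.module (Over.mk P.1)).toSMul.smul ((Scheme.ΓSpecIso (.of k)).inv.hom c) x := rfl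

/-- A point of `U(k)`, as a morphism over `V` to `U`. -/
def PointsIn.toOver {U : V.Opens} (P : PointsIn str k U) : Over.mk P.1.1 ⟶ Over.mk U.ι :=
  Over.homMk (IsOpenImmersion.lift U.ι P.1.1 (by
      rintro _ ⟨x, rfl⟩
      simpa using P.2 (Set.mem_univ x))) (IsOpenImmersion.lift_fac _ _ _)

lemma appLE_comp_ι {T X : Scheme.{u}} {U : X.Opens} (f : T ⟶ U.toScheme)
    (e : ⊤ ≤ (f ≫ U.ι) ⁻¹ᵁ U) : (f ≫ U.ι).appLE U ⊤ e = U.topIso.inv ≫ f.appTop := by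
  rw [← Scheme.Hom.appLE_comp_appLE (U := U) (V := ⊤) (W := ⊤) f U.ι (by simp) le_top]
  refine congrArg₂ (· ≫ ·) ?_ ?_
  · rw [Scheme.Hom.appLE, Scheme.Opens.ι_app]
    exact (X.presheaf.map_comp _ _).symm
  · exact (congrArg (_ ≫ ·) (T.presheaf.map_id _)).trans (Category.comp_id _)

lemma sectionValue_eq {U : V.Opens} (s : E.obj (Over.mk U.ι)) (P : PointsIn str k U) :
    sectionValue E s P = E.map P.toOver s := rfl

lemma sectionValue_sum {U : V.Opens} {ι : Type*} (t : Finset ι) (s : ι → E.obj (Over.mk U.ι))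
    (P : PointsIn str k U) :
    sectionValue E (∑ i ∈ t, s i) P = ∑ i ∈ t, sectionValue E (s i) P :=
  map_sum (E.map P.toOver) s t

lemma sectionValue_resSection {U U' : V.Opens} (h : U' ≤ U) (s : E.obj (Over.mk U.ι))
    (P : PointsIn str k U') :
    sectionValue E (E.resSection h s) P =
      sectionValue E s (⟨P.1, P.2.trans (P.1.1.preimage_mono h)⟩ : PointsIn str k U) := by
  exact (E.map_comp _ _ s).symm.trans (E.map_eq_of_opens _ _ _)

lemma bijective_linearCombination {U : V.Opens} {r : ℕ} {s : Fin r → E.obj (Over.mk U.ι)}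
    (hs : E.IsFrame U s) (P : PointsIn str k U) :
    Function.Bijective
      (Fintype.linearCombination k (fun i => sectionValue E (s i) P)) := by
  have h1 := hs (Over.mk P.1.1) P.toOver
  have h2 : Function.Bijective fun c : Fin r → k => fun i => (Scheme.ΓSpecIso (.of k)).inv.hom (c i) :=
    Function.Bijective.piMap fun _ =>
      (ConcreteCategory.bijective_of_isIso (Scheme.ΓSpecIso (.of k)).inv)
  exact h1.comp h2

/-- The basis of the fibre at a point of `U(k)` given by a frame over `U`. -/
def frameBasis {U : V.Opens} {r : ℕ} {s : Fin r → E.obj (Over.mk U.ι)}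
    (hs : E.IsFrame U s) (P : PointsIn str k U) : Basis (Fin r) k (Fibre E P.1) :=
  Basis.ofEquivFun (LinearEquiv.ofBijective _ (bijective_linearCombination hs P)).symm

@[simp]
lemma frameBasis_apply {U : V.Opens} {r : ℕ} {s : Fin r → E.obj (Over.mk U.ι)}
    (hs : E.IsFrame U s) (P : PointsIn str k U) (i : Fin r) :
    frameBasis hs P i = sectionValue E (s i) P := by
  simp [frameBasis, Fintype.linearCombination_apply]

/-- The point of `U(k)` given by a point of `U(K)`. -/
def PointsIn.baseChange {U : V.Opens} (P : PointsIn str K U) (k : Type u) [Field k] [Algebra K k] :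
    PointsIn str k U :=
  ⟨P.1.baseChange k, by
    change ⊤ ≤ (Spec.map (CommRingCat.ofHom (algebraMap K k)) ≫ P.1.1) ⁻¹ᵁ U
    intro x _
    exact P.2 (Set.mem_univ _)⟩

lemma sectionValue_baseChange {U : V.Opens} (s : E.obj (Over.mk U.ι)) (P : PointsIn str K U) :
    sectionValue E s (P.baseChange k) = fibreMap E P.1 k (sectionValue E s P) := by
  exact (E.map_eq_of_opens _ _ _).trans (E.map_comp _ _ s)

lemma fibreTensor_tmul (P : Points str K) (c : k) (x : Fibre E P) :
    fibreTensor E P k (c ⊗ₜ x) = c • fibreMap E P k x := rfl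

/-- The map `fibreTensor`, as a linear map. -/
def fibreTensorₗ (E : RelModule V) (P : Points str K) (k : Type u) [Field k] [Algebra K k] :
    k ⊗[K] Fibre E P →ₗ[k] Fibre E (P.baseChange k) :=
  { fibreTensor E P k with
    map_smul' c x := by
      change fibreTensor E P k (c • x) = c • fibreTensor E P k x
      induction x with
      | zero => simp
      | tmul d x => rw [TensorProduct.smul_tmul', fibreTensor_tmul, fibreTensor_tmul, smul_assoc]
      | add x y hx hy => rw [smul_add, map_add, map_add, smul_add, hx, hy] }

lemma fibreTensorₗ_apply (P : Points str K) (x : k ⊗[K] Fibre E P) :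
    fibreTensorₗ E P k x = fibreTensor E P k x := rfl

lemma fibreTensorₗ_frameBasis {U : V.Opens} {r : ℕ} {s : Fin r → E.obj (Over.mk U.ι)}
    (hs : E.IsFrame U s) (P : PointsIn str K U) (i : Fin r) :
    fibreTensorₗ E P.1 k ((frameBasis hs P).baseChange k i) = frameBasis hs (P.baseChange k) i := by
  rw [Basis.baseChange_apply, fibreTensorₗ_apply, fibreTensor_tmul, one_smul, frameBasis_apply,
    frameBasis_apply, sectionValue_baseChange]

/-- Spec k has a single point, so a chart around its image contains the whole k-point. -/
lemma exists_pointsIn (hE : E.HasLocalFrames) (P : Points str k) :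
    ∃ (U : V.Opens) (r : ℕ) (s : Fin r → E.obj (Over.mk U.ι)) (_ : E.IsFrame U s)
      (Q : PointsIn str k U), Q.1 = P := by
  obtain ⟨U, hU, r, s, hs⟩ := hE (P.1 (IsLocalRing.closedPoint k))
  refine ⟨U, r, s, hs, ⟨P, fun x _ => ?_⟩, rfl⟩
  rwa [Subsingleton.elim x (IsLocalRing.closedPoint k)]

/-- A frame provides corresponding bases of both sides. Injectivity ensures that the norm of the
fibre pulls back to a norm on k ⊗ E_P, and not merely to a seminorm. -/
lemma fibreTensorₗ_injective (hE : E.HasLocalFrames) (P : Points str K) :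
    Function.Injective (fibreTensorₗ E P k) := by
  obtain ⟨U, r, s, hs, Q, rfl⟩ := exists_pointsIn hE P
  let e := ((frameBasis hs Q).baseChange k).equiv (frameBasis hs (Q.baseChange k)) (Equiv.refl _)
  have : fibreTensorₗ E Q.1 k = e.toLinearMap := by
    refine ((frameBasis hs Q).baseChange k).ext fun i => ?_
    rw [fibreTensorₗ_frameBasis]
    exact (((frameBasis hs Q).baseChange k).equiv_apply i (frameBasis hs (Q.baseChange k))
      (Equiv.refl _)).symm
  rw [this]
  exact e.injective

lemma finite_fibre (hE : E.HasLocalFrames) (P : Points str k) : Module.Finite k (Fibre E P) := by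
  obtain ⟨U, r, s, hs, Q, rfl⟩ := exists_pointsIn hE P
  exact Module.Finite.of_basis (frameBasis hs Q)

end Fibres

/-! ### Frames given by a model -/

section ModelFrames

variable {K : Type u} [Field K] [NumberField K] {V : Scheme.{u}} {str : V ⟶ Spec (.of K)}
  {E : RelModule V} {S : Finset (HeightOneSpectrum (𝓞 K))} (m : Model str E S)

/-- The restriction of the generic fibre to the preimage of an open subset of a model. -/
def Model.genericIn (W : m.scheme.Opens) :
    (Over.map m.generic).obj (Over.mk (m.generic ⁻¹ᵁ W).ι) ⟶ Over.mk W.ι :=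
  Over.homMk (m.generic ∣_ W) (morphismRestrict_ι _ _)

/-- The section of `E` given by a section of a model. -/
def Model.section {W : m.scheme.Opens} (s : m.bundle.obj (Over.mk W.ι)) :
    E.obj (Over.mk (m.generic ⁻¹ᵁ W).ι) :=
  m.iso.equiv (Over.mk (m.generic ⁻¹ᵁ W).ι) (m.bundle.map (m.genericIn W) s)

lemma Model.map_section {W : m.scheme.Opens} (s : m.bundle.obj (Over.mk W.ι)) {T : Over V}
    (g : T ⟶ Over.mk (m.generic ⁻¹ᵁ W).ι) :
    E.map g (m.section s) =
      m.iso.equiv T (m.bundle.map ((Over.map m.generic).map g ≫ m.genericIn W) s) := by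
  refine (m.iso.naturality g _).symm.trans (congrArg (m.iso.equiv T) ?_)
  exact (m.bundle.map_comp _ _ _).symm

/-- Frames are tested on all schemes over their domain, in particular on V-schemes regarded as
schemes over the model. -/
lemma Model.isFrame_section {W : m.scheme.Opens} {r : ℕ} {s : Fin r → m.bundle.obj (Over.mk W.ι)}
    (hs : m.bundle.IsFrame W s) : E.IsFrame (m.generic ⁻¹ᵁ W) fun i => m.section (s i) := by
  intro T g
  let t : Fin r → (m.bundle.pullback m.generic).obj T := fun i =>
    m.bundle.map ((Over.map m.generic).map g ≫ m.genericIn W) (s i)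
  have h : Function.Bijective fun c : Fin r → Γ(T.left, ⊤) => ∑ i, c i • t i :=
    hs ((Over.map m.generic).obj T) ((Over.map m.generic).map g ≫ m.genericIn W)
  have h3 : (fun c : Fin r → Γ(T.left, ⊤) => ∑ i, c i • E.map g (m.section (s i))) =
      fun c => m.iso.equiv T (∑ i, c i • t i) := by
    funext c
    simp only [map_sum, m.map_section]
    exact Finset.sum_congr rfl fun i _ => ((m.iso.equiv T).map_smul (c i) (t i)).symm
  rw [h3]
  exact (m.iso.equiv T).bijective.comp h

include m in
lemma Model.hasLocalFrames : E.HasLocalFrames := fun x => by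
  obtain ⟨U, hU, r, s, hs⟩ := m.isVectorBundle.exists_frame (m.generic x)
  exact ⟨_, hU, r, _, m.isFrame_section hs⟩

end ModelFrames

/-! ### The degree does not depend on the basis -/

section DetIsometry

variable {k : Type*} [NormedField k] {M : Type*} [AddCommGroup M] [Module k M] {m : ℕ}

/-- All powers of f preserve B, so their matrices have entries of norm at most 1 and |det f|^j ≤ m!
for every j. It does not matter whether B is a euclidean ball or a lattice. -/
lemma norm_det_le_one (e : Basis (Fin m) k M) (B : Set M) (f : M →ₗ[k] M)
    (hf : ∀ y ∈ B, f y ∈ B) (he : ∀ i, e i ∈ B) (hB : ∀ y ∈ B, ∀ i, ‖e.repr y i‖ ≤ 1) :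
    ‖LinearMap.det f‖ ≤ 1 := by
  by_contra! h
  obtain ⟨j, hj⟩ := pow_unbounded_of_one_lt (m.factorial : ℝ) h
  have hfj : ∀ j : ℕ, ∀ y ∈ B, (f ^ j) y ∈ B := fun j => by
    induction j with
    | zero => intro y hy; simpa using hy
    | succ j ih => intro y hy; rw [pow_succ]; exact ih _ (hf _ hy)
  have h1 := Matrix.det_le (A := LinearMap.toMatrix e e (f ^ j))
    (abv := NormedField.toAbsoluteValue k) (x := 1)
    (fun a b => by
      rw [LinearMap.toMatrix_apply]
      exact hB _ (hfj j _ (he b)) a)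
  rw [LinearMap.det_toMatrix, map_pow, nsmul_eq_mul, Fintype.card_fin, one_pow, mul_one] at h1
  refine absurd hj (not_lt.2 ?_)
  rw [← norm_pow]
  exact h1

/-- The automorphism taking e to e' preserves B, and so does its inverse. Hence `detInf` and
`detFin` do not depend on the basis chosen in their definitions. -/
lemma norm_det_eq_one (e e' : Basis (Fin m) k M) (B : Set M)
    (hB : ∀ c : Fin m → k, ∑ i, c i • e i ∈ B ↔ ∑ i, c i • e' i ∈ B) (he : ∀ i, e i ∈ B)
    (hB1 : ∀ c : Fin m → k, ∑ i, c i • e i ∈ B → ∀ i, ‖c i‖ ≤ 1) :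
    ‖e.det e'‖ = 1 := by
  have key : ∀ e e' : Basis (Fin m) k M,
      (∀ c : Fin m → k, ∑ i, c i • e i ∈ B ↔ ∑ i, c i • e' i ∈ B) → (∀ i, e i ∈ B) →
      (∀ c : Fin m → k, ∑ i, c i • e i ∈ B → ∀ i, ‖c i‖ ≤ 1) → ‖e.det e'‖ ≤ 1 := by
    intro e e' hB he hB1
    have h1 := norm_det_le_one e B (e.equiv e' (Equiv.refl _)).toLinearMap (fun y hy => ?_) he
      (fun y hy i => hB1 (fun i => e.repr y i) (by rwa [e.sum_repr]) i)
    · rw [Basis.det_apply]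
      rw [← LinearMap.det_toMatrix e] at h1
      convert! h1 using 3
      ext i j
      simp [LinearMap.toMatrix_apply, Basis.toMatrix_apply]
    · rw [← e.sum_repr y, hB] at hy
      convert! hy using 1
      conv_lhs => rw [← e.sum_repr y]
      simp only [map_sum, map_smul, LinearEquiv.coe_coe, Basis.equiv_apply, Equiv.refl_apply]
  have he' : ∀ i, e' i ∈ B := fun i => by
    have := (hB (Pi.single i 1)).1 (by simpa [Pi.single_apply] using he i)
    simpa [Pi.single_apply] using this
  have h1 := key e e' hB he hB1
  have h2 := key e' e (fun c => (hB c).symm) he' (fun c hc => hB1 c ((hB c).2 hc))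
  have h3 : e.det e' * e'.det e = 1 := by
    rw [Basis.det_apply, Basis.det_apply, ← Matrix.det_mul, Basis.toMatrix_mul_toMatrix,
      Basis.toMatrix_self, Matrix.det_one]
  have h4 : ‖e.det e'‖ * ‖e'.det e‖ = 1 := by rw [← norm_mul, h3, norm_one]
  refine le_antisymm h1 ?_
  nlinarith [norm_nonneg (e.det e'), norm_nonneg (e'.det e)]

lemma det_eq_det_mul_det {R M : Type*} [CommRing R] [AddCommGroup M] [Module R M] {m : ℕ}
    (e e' b : Basis (Fin m) R M) : e.det b = e.det e' * e'.det b := by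
  rw [Basis.det_apply, Basis.det_apply, Basis.det_apply, ← Matrix.det_mul,
    Basis.toMatrix_mul_toMatrix]

lemma det_baseChange {K k E : Type*} [Field K] [Field k] [Algebra K k] [AddCommGroup E]
    [Module K E] {m : ℕ} (b b' : Basis (Fin m) K E) :
    (b.baseChange k).det (b'.baseChange k) = algebraMap K k (b.det b') := by
  rw [Basis.det_apply, Basis.det_apply, RingHom.map_det]
  congr 1
  ext i j
  simp [Basis.toMatrix_apply, Algebra.algebraMap_eq_smul_one]

end DetIsometry

namespace NormFamily

variable {K : Type u} [Field K] [NumberField K] {E : Type u} [AddCommGroup E] [Module K E]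

/-- The family consists of classical norms. -/
structure IsClassical (N : NormFamily K E) : Prop where
  euclidean : ∀ (w : InfinitePlace K) (hw : w.IsReal),
    IsEuclideanNorm (InfinitePlace.Completion.extensionEmbeddingOfIsReal hw) (N.inf w)
  hermitian : ∀ (w : InfinitePlace K) (_ : w.IsComplex),
    IsHermitianSquare (InfinitePlace.Completion.extensionEmbedding w) (N.inf w)
  ultrametric : ∀ v, IsUltrametricNorm (v.adicCompletion K) (N.fin v)

/-- Almost all the unit balls are generated by a basis of `E` over `K`. -/
def IsCoherent (N : NormFamily K E) : Prop :=
  ∃ (m : ℕ) (b : Basis (Fin m) K E),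
    ∀ᶠ v : HeightOneSpectrum (𝓞 K) in Filter.cofinite,
      N.IsLatticeBasis v (b.baseChange (v.adicCompletion K))

variable {N : NormFamily K E}

/-- The natural-number quotient 2 / w.mult is 2 at a real place, and 1 at a complex place, where the
norm is already a square. -/
lemma isOrthonormal_iff {w : InfinitePlace K} {m : ℕ}
    {e : Basis (Fin m) w.Completion (w.Completion ⊗[K] E)} :
    N.IsOrthonormal w e ↔ ∀ c : Fin m → w.Completion,
      N.inf w (∑ i, c i • e i) ^ (2 / w.mult) = ∑ i, ‖c i‖ ^ 2 := by
  unfold IsOrthonormal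
  by_cases hw : w.IsReal
  · have h : ¬ w.IsComplex := InfinitePlace.not_isComplex_iff_isReal.2 hw
    simp [hw, h, InfinitePlace.mult]
  · have h : w.IsComplex := InfinitePlace.not_isReal_iff_isComplex.1 hw
    simp [hw, h, InfinitePlace.mult]

lemma IsClassical.exists_isOrthonormal (hN : N.IsClassical) (w : InfinitePlace K) {m : ℕ}
    (b : Basis (Fin m) K E) :
    ∃ e : Basis (Fin m) w.Completion (w.Completion ⊗[K] E), N.IsOrthonormal w e := by
  by_cases hw : w.IsReal
  · obtain ⟨e, he⟩ := IsEuclideanNorm.exists_basis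
      (InfinitePlace.Completion.ringEquivRealOfIsReal hw) (hN.euclidean w hw)
      (b.baseChange w.Completion)
    refine ⟨e, fun _ c => (he c).trans ?_,
      fun h => absurd h (InfinitePlace.not_isComplex_iff_isReal.2 hw)⟩
    refine Finset.sum_congr rfl fun i _ => ?_
    congr 1
    exact (InfinitePlace.Completion.isometry_extensionEmbeddingOfIsReal hw).norm_map_of_map_zero
      (map_zero _) _
  · have hw' : w.IsComplex := InfinitePlace.not_isReal_iff_isComplex.1 hw
    obtain ⟨e, he⟩ := IsHermitianSquare.exists_basis
      (InfinitePlace.Completion.ringEquivComplexOfIsComplex hw') (hN.hermitian w hw')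
      (b.baseChange w.Completion)
    refine ⟨e, fun h => absurd h hw, fun _ c => (he c).trans ?_⟩
    refine Finset.sum_congr rfl fun i _ => ?_
    congr 1
    exact (InfinitePlace.Completion.isometry_extensionEmbedding w).norm_map_of_map_zero
      (map_zero _) _

lemma IsClassical.exists_isLatticeBasis (hN : N.IsClassical) (v : HeightOneSpectrum (𝓞 K)) {m : ℕ}
    (b : Basis (Fin m) K E) :
    ∃ e : Basis (Fin m) (v.adicCompletion K) (v.adicCompletion K ⊗[K] E), N.IsLatticeBasis v e :=
  (hN.ultrametric v).exists_basis (exists_one_lt_norm_adicCompletion v)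
    (v.adicCompletionIntegers K) (norm_adicCompletion_le_one_iff_mem_range v)
    (b.baseChange (v.adicCompletion K))

lemma IsClassical.inf_nonneg (hN : N.IsClassical) (w : InfinitePlace K)
    (y : w.Completion ⊗[K] E) : 0 ≤ N.inf w y := by
  by_cases hw : w.IsReal
  · obtain ⟨φ, -, -, -, -, hφ⟩ := hN.euclidean w hw
    rw [hφ]
    exact Real.sqrt_nonneg _
  · obtain ⟨φ, hadd, -, -, hpos, hφ⟩ :=
      hN.hermitian w (InfinitePlace.not_isReal_iff_isComplex.1 hw)
    have h := congrArg Complex.re (hφ y)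
    rw [Complex.ofReal_re] at h
    rw [h]
    by_cases hy : y = 0
    · have : φ 0 y = 0 := by simpa using hadd 0 0 y
      rw [hy] at this ⊢
      simp [this]
    · exact (hpos y hy).le

lemma norm_det_eq_one_of_isOrthonormal {w : InfinitePlace K} {m : ℕ}
    {e e' : Basis (Fin m) w.Completion (w.Completion ⊗[K] E)} (he : N.IsOrthonormal w e)
    (he' : N.IsOrthonormal w e') : ‖e.det e'‖ = 1 := by
  rw [isOrthonormal_iff] at he he'
  refine norm_det_eq_one e e' {y | N.inf w y ^ (2 / w.mult) ≤ 1} (fun c => ?_) (fun i => ?_)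
    (fun c hc i => ?_)
  · simp only [Set.mem_ofPred_eq, he, he']
  · have := he (Pi.single i 1)
    simp only [Pi.single_apply, ite_smul, one_smul, zero_smul, Finset.sum_ite_eq',
      Finset.mem_univ, if_true] at this
    rw [Set.mem_ofPred_eq, this, Finset.sum_eq_single i (by simp +contextual) (by simp)]
    simp
  · rw [Set.mem_ofPred_eq, he] at hc
    have := Finset.single_le_sum (f := fun i => ‖c i‖ ^ 2) (fun i _ => by positivity)
      (Finset.mem_univ i)
    exact (sq_le_one_iff₀ (norm_nonneg _)).1 (this.trans hc)

lemma norm_det_eq_one_of_isLatticeBasis {v : HeightOneSpectrum (𝓞 K)} {m : ℕ}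
    {e e' : Basis (Fin m) (v.adicCompletion K) (v.adicCompletion K ⊗[K] E)}
    (he : N.IsLatticeBasis v e) (he' : N.IsLatticeBasis v e') : ‖e.det e'‖ = 1 := by
  refine norm_det_eq_one e e' {y | N.fin v y ≤ 1} (fun c => ?_) (fun i => ?_)
    (fun c hc i => ?_)
  · simp only [Set.mem_ofPred_eq, he c, he' c]
  · have := (he (Pi.single i 1)).2 fun j => by
      rw [Pi.single_apply]
      split_ifs <;> simp
    simpa only [Pi.single_apply, ite_smul, one_smul, zero_smul, Finset.sum_ite_eq',
      Finset.mem_univ, if_true, Set.mem_ofPred_eq] using this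
  · exact (he c).1 hc i

lemma detInf_eq {w : InfinitePlace K} {m : ℕ}
    {e : Basis (Fin m) w.Completion (w.Completion ⊗[K] E)} (he : N.IsOrthonormal w e)
    (b : Basis (Fin m) K E) : N.detInf w b = ‖e.det (b.baseChange w.Completion)‖ ^ w.mult := by
  have h : ∃ e : Basis (Fin m) w.Completion (w.Completion ⊗[K] E), N.IsOrthonormal w e := ⟨e, he⟩
  rw [detInf, dif_pos h, det_eq_det_mul_det h.choose e, norm_mul,
    norm_det_eq_one_of_isOrthonormal h.choose_spec he, one_mul]

lemma detFin_eq {v : HeightOneSpectrum (𝓞 K)} {m : ℕ}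
    {e : Basis (Fin m) (v.adicCompletion K) (v.adicCompletion K ⊗[K] E)}
    (he : N.IsLatticeBasis v e) (b : Basis (Fin m) K E) :
    N.detFin v b = ‖e.det (b.baseChange (v.adicCompletion K))‖ := by
  have h : ∃ e : Basis (Fin m) (v.adicCompletion K) (v.adicCompletion K ⊗[K] E),
      N.IsLatticeBasis v e := ⟨e, he⟩
  rw [detFin, dif_pos h, det_eq_det_mul_det h.choose e, norm_mul,
    norm_det_eq_one_of_isLatticeBasis h.choose_spec he, one_mul]

lemma IsClassical.log_detInf (hN : N.IsClassical) (w : InfinitePlace K) {m : ℕ}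
    (b b' : Basis (Fin m) K E) : Real.log (N.detInf w b') =
      Real.log (N.detInf w b) + Real.log (‖algebraMap K w.Completion (b.det b')‖ ^ w.mult) := by
  obtain ⟨e, he⟩ := hN.exists_isOrthonormal w b
  rw [detInf_eq he, detInf_eq he, det_eq_det_mul_det e (b.baseChange _), norm_mul, mul_pow,
    det_baseChange, Real.log_mul]
  · exact pow_ne_zero _ (norm_ne_zero_iff.2 (e.isUnit_det _).ne_zero)
  · exact pow_ne_zero _ (norm_ne_zero_iff.2 ((map_ne_zero _).2 (b.isUnit_det _).ne_zero))

lemma IsClassical.log_detFin (hN : N.IsClassical) (v : HeightOneSpectrum (𝓞 K)) {m : ℕ}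
    (b b' : Basis (Fin m) K E) : Real.log (N.detFin v b') =
      Real.log (N.detFin v b) + Real.log ‖algebraMap K (v.adicCompletion K) (b.det b')‖ := by
  obtain ⟨e, he⟩ := hN.exists_isLatticeBasis v b
  rw [detFin_eq he, detFin_eq he, det_eq_det_mul_det e (b.baseChange _), norm_mul,
    det_baseChange, Real.log_mul]
  · exact norm_ne_zero_iff.2 (e.isUnit_det _).ne_zero
  · exact norm_ne_zero_iff.2 ((map_ne_zero _).2 (b.isUnit_det _).ne_zero)

/-- Where b₀ generates the unit ball, the local term is log |det|_v of b relative to b₀, and this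
vanishes at almost every v. -/
lemma IsCoherent.finite_support (hN : N.IsClassical) (hc : N.IsCoherent) {m : ℕ}
    (b : Basis (Fin m) K E) :
    (Function.support fun v : HeightOneSpectrum (𝓞 K) => Real.log (N.detFin v b)).Finite := by
  obtain ⟨m', b₀, hb₀⟩ := hc
  obtain rfl : m' = m := Fin.equiv_iff_eq.1 ⟨b₀.indexEquiv b⟩
  refine ((Filter.eventually_cofinite.1 hb₀).union
    (product_formula (b₀.isUnit_det b).ne_zero).1).subset fun v hv => ?_
  by_contra h
  simp only [Set.mem_union, not_or, Set.mem_ofPred_eq, not_not, Function.mem_support] at h hv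
  refine hv ?_
  rw [hN.log_detFin v b₀ b, h.2, detFin_eq h.1, Basis.det_self]
  simp

lemma IsCoherent.sum_log_eq (hN : N.IsClassical) (hc : N.IsCoherent) {m : ℕ}
    (b b' : Basis (Fin m) K E) :
    ∑ w : InfinitePlace K, Real.log (N.detInf w b') +
      ∑ᶠ v : HeightOneSpectrum (𝓞 K), Real.log (N.detFin v b') =
    ∑ w : InfinitePlace K, Real.log (N.detInf w b) +
      ∑ᶠ v : HeightOneSpectrum (𝓞 K), Real.log (N.detFin v b) := by
  have h := product_formula (b.isUnit_det b').ne_zero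
  simp only [hN.log_detInf _ b b', hN.log_detFin _ b b']
  rw [Finset.sum_add_distrib, finsum_add_distrib (hc.finite_support hN b) h.1]
  linarith [h.2]

lemma IsCoherent.degree_eq (hN : N.IsClassical) (hc : N.IsCoherent) {m : ℕ}
    (b : Basis (Fin m) K E) :
    N.degree = -(∑ w : InfinitePlace K, Real.log (N.detInf w b) +
      ∑ᶠ v : HeightOneSpectrum (𝓞 K), Real.log (N.detFin v b)) := by
  have hfin : Module.Finite K E := Module.Finite.of_basis b
  obtain rfl : finrank K E = m := by simpa using finrank_eq_card_basis b
  rw [degree, dif_pos hfin, hc.sum_log_eq hN b]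

/-- The submodule ⊤ is a different type, with its own `finBasis`. Comparing the two degrees requires
independence of the basis, hence the product formula and coherence. -/
lemma IsClassical.degree_restrict_top (hN : N.IsClassical) (hc : N.IsCoherent)
    (hN' : (N.restrict ⊤).IsClassical) : (N.restrict ⊤).degree = N.degree := by
  have hfin : Module.Finite K E := by
    obtain ⟨m, b, -⟩ := hc
    exact Module.Finite.of_basis b
  let φ : (⊤ : Submodule K E) ≃ₗ[K] E := Submodule.topEquiv
  let b := finBasis K (⊤ : Submodule K E)
  rw [hc.degree_eq hN (b.map φ), degree,
    dif_pos (inferInstance : Module.Finite K (⊤ : Submodule K E))]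
  have hbc : ∀ (k : Type u) [Field k] [Algebra K k] (i),
      φ.baseChange K k _ _ (b.baseChange k i) = (b.map φ).baseChange k i := fun k _ _ i => by
    simp [Basis.baseChange_apply]
  have hdet : ∀ (k : Type u) [Field k] [Algebra K k] (e : Basis _ k (k ⊗[K] (⊤ : Submodule K E))),
      (e.map (φ.baseChange K k _ _)).det ((b.map φ).baseChange k) = e.det (b.baseChange k) := by
    intro k _ _ e
    rw [Basis.det_map]
    congr 1
    ext i
    simp only [Function.comp_apply, ← hbc, LinearEquiv.symm_apply_apply]
  congr 2
  · refine Finset.sum_congr rfl fun w _ => ?_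
    obtain ⟨e, he⟩ := hN'.exists_isOrthonormal w b
    have he' : N.IsOrthonormal w (e.map (φ.baseChange K w.Completion _ _)) := by
      rw [isOrthonormal_iff] at he ⊢
      intro c
      rw [← he c]
      simp only [Basis.map_apply, ← map_smul, ← map_sum]
      rfl
    rw [detInf_eq he, detInf_eq he', hdet]
  · refine finsum_congr fun v => ?_
    obtain ⟨e, he⟩ := hN'.exists_isLatticeBasis v b
    have he' : N.IsLatticeBasis v (e.map (φ.baseChange K (v.adicCompletion K) _ _)) := by
      intro c
      rw [← he c]
      simp only [Basis.map_apply, ← map_smul, ← map_sum]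
      rfl
    rw [detFin_eq he, detFin_eq he', hdet]

end NormFamily

/-! ### Comparison of degrees -/

section Restrict

lemma IsEuclideanNorm.comp {k : Type u} [Field k] {σ : k →+* ℝ} {M M' : Type u}
    [AddCommGroup M] [Module k M] [AddCommGroup M'] [Module k M'] {N : M → ℝ}
    (hN : IsEuclideanNorm σ N) (f : M' →ₗ[k] M) (hf : Function.Injective f) :
    IsEuclideanNorm σ fun x => N (f x) := by
  obtain ⟨b, h1, h2, h3, h4, h5⟩ := hN
  refine ⟨fun x y => b (f x) (f y), ?_, ?_, ?_, ?_, ?_⟩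
  · intro x x' y
    simp only [map_add, h1]
  · intro c x y
    simp only [map_smul, h2]
  · exact fun x y => h3 _ _
  · exact fun x hx => h4 _ ((map_ne_zero_iff f hf).2 hx)
  · exact fun x => h5 _

lemma IsHermitianSquare.comp {k : Type u} [Field k] {σ : k →+* ℂ} {M M' : Type u}
    [AddCommGroup M] [Module k M] [AddCommGroup M'] [Module k M'] {N : M → ℝ}
    (hN : IsHermitianSquare σ N) (f : M' →ₗ[k] M) (hf : Function.Injective f) :
    IsHermitianSquare σ fun x => N (f x) := by
  obtain ⟨b, h1, h2, h3, h4, h5⟩ := hN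
  refine ⟨fun x y => b (f x) (f y), ?_, ?_, ?_, ?_, ?_⟩
  · intro x x' y
    simp only [map_add, h1]
  · intro c x y
    simp only [map_smul, h2]
  · exact fun x y => h3 _ _
  · exact fun x hx => h4 _ ((map_ne_zero_iff f hf).2 hx)
  · exact fun x => h5 _

lemma IsUltrametricNorm.comp {k : Type u} [NormedField k] {M M' : Type u}
    [AddCommGroup M] [Module k M] [AddCommGroup M'] [Module k M'] {N : M → ℝ}
    (hN : IsUltrametricNorm k N) (f : M' →ₗ[k] M) (hf : Function.Injective f) :
    IsUltrametricNorm k fun x => N (f x) where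
  eq_zero_iff y := by rw [hN.eq_zero_iff, map_eq_zero_iff f hf]
  smul c y := by rw [map_smul, hN.smul]
  add_le x y := by rw [map_add]; exact hN.add_le _ _
  mem_range y := hN.mem_range _

end Restrict

namespace NormFamily

variable {K : Type u} [Field K] [NumberField K] {E : Type u} [AddCommGroup E] [Module K E]

/-- By flatness K_w ⊗ F embeds in K_w ⊗ E, so positivity is inherited. -/
lemma IsClassical.restrict {N : NormFamily K E} (hN : N.IsClassical) (F : Submodule K E) :
    (N.restrict F).IsClassical := by
  have hinj : ∀ (k : Type u) [Field k] [Algebra K k],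
      Function.Injective (F.subtype.baseChange k) := fun k _ _ =>
    Module.Flat.lTensor_preserves_injective_linearMap F.subtype F.injective_subtype
  exact
    { euclidean := fun w hw => (hN.euclidean w hw).comp _ (hinj _)
      hermitian := fun w hw => (hN.hermitian w hw).comp _ (hinj _)
      ultrametric := fun v => (hN.ultrametric v).comp _ (hinj _) }

lemma norm_repr_le_of_isOrthonormal {N N' : NormFamily K E} (hN : N.IsClassical)
    (hN' : N'.IsClassical) {w : InfinitePlace K} {C : ℝ} (hC : ∀ y, N.inf w y ≤ C * N'.inf w y) {m : ℕ}
    {e e' : Basis (Fin m) w.Completion (w.Completion ⊗[K] E)} (he : N.IsOrthonormal w e)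
    (he' : N'.IsOrthonormal w e') (i j : Fin m) : ‖e.repr (e' j) i‖ ≤ max C 1 := by
  rw [isOrthonormal_iff] at he he'
  have h1 : N'.inf w (e' j) ^ (2 / w.mult) = 1 := by
    have := he' (Pi.single j 1)
    simp only [Pi.single_apply, ite_smul, one_smul, zero_smul, Finset.sum_ite_eq',
      Finset.mem_univ, if_true] at this
    rw [this, Finset.sum_eq_single j (by simp +contextual) (by simp)]
    simp
  have h2 : ‖e.repr (e' j) i‖ ^ 2 ≤ N.inf w (e' j) ^ (2 / w.mult) := by
    have h := he fun i => e.repr (e' j) i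
    rw [e.sum_repr] at h
    rw [h]
    exact Finset.single_le_sum (f := fun i => ‖e.repr (e' j) i‖ ^ 2) (fun i _ => by positivity)
      (Finset.mem_univ i)
  have h3 := hC (e' j)
  have h4 := hN.inf_nonneg w (e' j)
  have hp : 2 / w.mult = 1 ∨ 2 / w.mult = 2 := by
    unfold InfinitePlace.mult
    split_ifs <;> simp
  have hm1 := le_max_left C 1
  have hm2 := le_max_right C 1
  have h5 : N'.inf w (e' j) = 1 := by
    rcases hp with hp | hp
    · rwa [hp, pow_one] at h1
    · rw [hp] at h1
      exact (pow_eq_one_iff_of_nonneg (hN'.inf_nonneg w _) two_ne_zero).1 h1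
  have h6 : N.inf w (e' j) ≤ max C 1 := by
    rw [h5] at h3
    linarith
  -- At a complex place N is a squared length and is only known to be at most max C 1; this suffices
  -- because max C 1 ≥ 1.
  refine (sq_le_sq₀ (norm_nonneg _) (by positivity)).1 (h2.trans ?_)
  rcases hp with hp | hp <;> rw [hp]
  · nlinarith
  · exact pow_le_pow_left₀ h4 h6 2

/-- Since the bound is the absolute value of an element α of K_v, dividing e' j by α puts it in the
unit ball of N, where coordinates are integral. -/
lemma norm_repr_le_of_isLatticeBasis {N N' : NormFamily K E} (hN : N.IsClassical)
    {v : HeightOneSpectrum (𝓞 K)} {α : v.adicCompletion K} (hα : α ≠ 0)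
    (hC : ∀ y, N'.fin v y ≤ 1 → N.fin v y ≤ ‖α‖) {m : ℕ}
    {e e' : Basis (Fin m) (v.adicCompletion K) (v.adicCompletion K ⊗[K] E)}
    (he : N.IsLatticeBasis v e) (he' : N'.IsLatticeBasis v e') (i j : Fin m) :
    ‖e.repr (e' j) i‖ ≤ ‖α‖ := by
  have hα' : 0 < ‖α‖ := norm_pos_iff.2 hα
  have h1 : N'.fin v (e' j) ≤ 1 := by
    have := (he' (Pi.single j 1)).2 fun i => by
      rw [Pi.single_apply]
      split_ifs <;> simp
    simpa only [Pi.single_apply, ite_smul, one_smul, zero_smul, Finset.sum_ite_eq',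
      Finset.mem_univ, if_true] using this
  have h2 : N.fin v (α⁻¹ • e' j) ≤ 1 := by
    rw [(hN.ultrametric v).smul, norm_inv, inv_mul_le_iff₀ hα', mul_one]
    exact hC _ h1
  have h3 := (he fun i => e.repr (α⁻¹ • e' j) i).1 (by rwa [e.sum_repr]) i
  rw [map_smul, Finsupp.smul_apply, smul_eq_mul, norm_mul, norm_inv, inv_mul_le_iff₀ hα',
    mul_one] at h3
  exact h3

lemma log_factorial_mul_pow_le {m n : ℕ} (hmn : m ≤ n) {A : ℝ} (hA : 1 ≤ A) :
    Real.log (m.factorial * A ^ m) ≤ Real.log (n.factorial * A ^ n) := by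
  have := Nat.factorial_pos m
  gcongr

lemma abs_log_detInf_sub_le {N N' : NormFamily K E} (hN : N.IsClassical) (hN' : N'.IsClassical)
    {w : InfinitePlace K} {C : ℝ} (hC : ∀ y, N.inf w y ≤ C * N'.inf w y)
    (hC' : ∀ y, N'.inf w y ≤ C * N.inf w y) {m n : ℕ} (hmn : m ≤ n) (b : Basis (Fin m) K E) :
    |Real.log (N.detInf w b) - Real.log (N'.detInf w b)| ≤
      2 * Real.log (n.factorial * max C 1 ^ n) := by
  obtain ⟨e, he⟩ := hN.exists_isOrthonormal w b
  obtain ⟨e', he'⟩ := hN'.exists_isOrthonormal w b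
  have h1 := abs_log_norm_det_sub_le e e' (b.baseChange w.Completion)
    (norm_repr_le_of_isOrthonormal hN hN' hC he he')
    (norm_repr_le_of_isOrthonormal hN' hN hC' he' he)
  have h2 := h1.trans (log_factorial_mul_pow_le hmn (le_max_right C 1))
  rw [detInf_eq he, detInf_eq he', Real.log_pow, Real.log_pow, ← mul_sub, abs_mul, Nat.abs_cast]
  have h3 : (w.mult : ℝ) ≤ 2 := by
    unfold InfinitePlace.mult
    split_ifs <;> norm_num
  gcongr

lemma abs_log_detFin_sub_le {N N' : NormFamily K E} (hN : N.IsClassical) (hN' : N'.IsClassical)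
    {v : HeightOneSpectrum (𝓞 K)} {α : v.adicCompletion K} (hα : 1 ≤ ‖α‖)
    (hC : ∀ y, N.fin v y ≤ ‖α‖ * N'.fin v y)
    (hC' : ∀ y, N'.fin v y ≤ ‖α‖ * N.fin v y) {m n : ℕ} (hmn : m ≤ n) (b : Basis (Fin m) K E) :
    |Real.log (N.detFin v b) - Real.log (N'.detFin v b)| ≤
      Real.log (n.factorial * ‖α‖ ^ n) := by
  obtain ⟨e, he⟩ := hN.exists_isLatticeBasis v b
  obtain ⟨e', he'⟩ := hN'.exists_isLatticeBasis v b
  have h0 : α ≠ 0 := by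
    rintro rfl
    rw [norm_zero] at hα
    linarith
  have h1 := abs_log_norm_det_sub_le e e' (b.baseChange (v.adicCompletion K))
    (norm_repr_le_of_isLatticeBasis hN h0
      (fun y hy => (hC y).trans (mul_le_of_le_one_right (norm_nonneg _) hy)) he he')
    (norm_repr_le_of_isLatticeBasis hN' h0
      (fun y hy => (hC' y).trans (mul_le_of_le_one_right (norm_nonneg _) hy)) he' he)
  rw [detFin_eq he, detFin_eq he']
  exact h1.trans (log_factorial_mul_pow_le hmn hα)

lemma detFin_congr {N N' : NormFamily K E} {v : HeightOneSpectrum (𝓞 K)}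
    (h : ∀ y, N.fin v y ≤ 1 ↔ N'.fin v y ≤ 1) {m : ℕ} (b : Basis (Fin m) K E) :
    N.detFin v b = N'.detFin v b := by
  have hiff : ∀ e : Basis (Fin m) (v.adicCompletion K) (v.adicCompletion K ⊗[K] E),
      N.IsLatticeBasis v e ↔ N'.IsLatticeBasis v e := fun e => forall_congr' fun c => by rw [h]
  by_cases hN : ∃ e : Basis (Fin m) (v.adicCompletion K) (v.adicCompletion K ⊗[K] E),
      N.IsLatticeBasis v e
  · obtain ⟨e, he⟩ := hN
    rw [detFin_eq he, detFin_eq ((hiff e).1 he)]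
  · rw [detFin, detFin, dif_neg hN, dif_neg fun ⟨e, he⟩ => hN ⟨e, (hiff e).2 he⟩]

/-- The supports of f and g are finite together, as the functions agree off B. If they are infinite,
both sums have the default value 0, so no finiteness is needed. -/
lemma abs_finsum_sub_finsum_le {ι : Type*} {f g : ι → ℝ} {D : ι → ℝ} (B : Finset ι)
    (hB : ∀ i ∉ B, f i = g i) (hD : ∀ i ∈ B, |f i - g i| ≤ D i) :
    |∑ᶠ i, f i - ∑ᶠ i, g i| ≤ ∑ i ∈ B, D i := by
  have hfin : (Function.support f).Finite ↔ (Function.support g).Finite := by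
    constructor <;> intro h <;> refine (h.union B.finite_toSet).subset fun i hi => ?_ <;>
      by_cases hiB : i ∈ B
    · exact Or.inr hiB
    · exact Or.inl (by rwa [Function.mem_support, hB i hiB])
    · exact Or.inr hiB
    · exact Or.inl (by rwa [Function.mem_support, ← hB i hiB])
  by_cases h : (Function.support f).Finite
  · rw [← finsum_sub_distrib h (hfin.1 h), finsum_eq_sum_of_support_subset (s := B)]
    · exact (Finset.abs_sum_le_sum_abs _ _).trans (Finset.sum_le_sum hD)
    · intro i hi
      by_contra hiB
      exact hi (sub_eq_zero.2 (hB i hiB))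
  · rw [finsum_of_infinite_support h, finsum_of_infinite_support fun h' => h (hfin.2 h'), sub_self,
      abs_zero]
    exact Finset.sum_nonneg fun i hi => (abs_nonneg _).trans (hD i hi)

/-- Both degrees use the same `finBasis K E`, so they are compared term by term. Places outside B
contribute nothing because `detFin` depends only on the unit ball. Bounding by n instead of the
dimension makes the constant uniform over all subspaces. -/
lemma abs_degree_sub_le {N N' : NormFamily K E} (hN : N.IsClassical) (hN' : N'.IsClassical)
    {C : InfinitePlace K → ℝ} (hC : ∀ w y, N.inf w y ≤ C w * N'.inf w y)
    (hC' : ∀ w y, N'.inf w y ≤ C w * N.inf w y) {B : Finset (HeightOneSpectrum (𝓞 K))}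
    {α : ∀ v : HeightOneSpectrum (𝓞 K), v.adicCompletion K} (hα : ∀ v, 1 ≤ ‖α v‖)
    (hD : ∀ v ∈ B, ∀ y, N.fin v y ≤ ‖α v‖ * N'.fin v y)
    (hD' : ∀ v ∈ B, ∀ y, N'.fin v y ≤ ‖α v‖ * N.fin v y)
    (hB : ∀ v ∉ B, ∀ y, N.fin v y ≤ 1 ↔ N'.fin v y ≤ 1) [Module.Finite K E] {n : ℕ}
    (hn : finrank K E ≤ n) :
    |N.degree - N'.degree| ≤ ∑ w, 2 * Real.log (n.factorial * max (C w) 1 ^ n) +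
      ∑ v ∈ B, Real.log (n.factorial * ‖α v‖ ^ n) := by
  rw [degree, degree, dif_pos ‹Module.Finite K E›, dif_pos ‹Module.Finite K E›, neg_sub_neg, add_sub_add_comm]
  refine (abs_add_le _ _).trans (add_le_add ?_ ?_)
  · rw [← Finset.sum_sub_distrib]
    refine (Finset.abs_sum_le_sum_abs _ _).trans (Finset.sum_le_sum fun w _ => ?_)
    exact abs_log_detInf_sub_le hN' hN (hC' w) (hC w) hn _
  · refine abs_finsum_sub_finsum_le B (fun v hv => ?_) fun v hv => ?_
    · rw [detFin_congr (hB v hv)]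
    · exact abs_log_detFin_sub_le hN' hN (hα v) (hD' v hv) (hD v hv) hn _

lemma abs_degree_restrict_sub_le {N N' : NormFamily K E} (hN : N.IsClassical)
    (hN' : N'.IsClassical) {C : InfinitePlace K → ℝ} (hC : ∀ w y, N.inf w y ≤ C w * N'.inf w y)
    (hC' : ∀ w y, N'.inf w y ≤ C w * N.inf w y) {B : Finset (HeightOneSpectrum (𝓞 K))}
    {α : ∀ v : HeightOneSpectrum (𝓞 K), v.adicCompletion K} (hα : ∀ v, 1 ≤ ‖α v‖)
    (hD : ∀ v ∈ B, ∀ y, N.fin v y ≤ ‖α v‖ * N'.fin v y)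
    (hD' : ∀ v ∈ B, ∀ y, N'.fin v y ≤ ‖α v‖ * N.fin v y)
    (hB : ∀ v ∉ B, ∀ y, N.fin v y ≤ 1 ↔ N'.fin v y ≤ 1) [Module.Finite K E] {n : ℕ}
    (hn : finrank K E ≤ n) (F : Submodule K E) :
    |(N.restrict F).degree - (N'.restrict F).degree| ≤
      ∑ w, 2 * Real.log (n.factorial * max (C w) 1 ^ n) +
      ∑ v ∈ B, Real.log (n.factorial * ‖α v‖ ^ n) :=
  abs_degree_sub_le (hN.restrict F) (hN'.restrict F) (fun w _ => hC w _) (fun w _ => hC' w _) hα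
    (fun v hv _ => hD v hv _) (fun v hv _ => hD' v hv _) (fun v hv _ => hB v hv _)
    ((Submodule.finrank_le F).trans hn)

end NormFamily

/-! ### The dimension of the tangent spaces -/

section TangentDimension

/-- A derivation corresponds to a linear map on Ω, which is free of rank n over a standard smooth
algebra, so n values determine it. -/
lemma exists_derivation_to_pi {R A K : Type*} [CommRing R] [CommRing A] [Field K] [Algebra R A]
    [Algebra A K] [Algebra R K] [IsScalarTower R A K] [Nontrivial A] {n : ℕ}
    [Algebra.IsStandardSmoothOfRelativeDimension n R A] :
    ∃ f : Derivation R A K →ₗ[K] (Fin n → K), Function.Injective f := by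
  have : Algebra.IsStandardSmooth R A :=
    Algebra.IsStandardSmoothOfRelativeDimension.isStandardSmooth n
  have hrank : finrank A (Ω[A⁄R]) = n := by
    rw [finrank, Algebra.IsStandardSmoothOfRelativeDimension.rank_kaehlerDifferential n]
    simp
  let β : Basis (Fin n) A (Ω[A⁄R]) := (finBasis A (Ω[A⁄R])).reindex (finCongr hrank)
  have hlift : ∀ (c : K) (d : Derivation R A K) (ω : Ω[A⁄R]),
      (c • d).liftKaehlerDifferential ω = c * d.liftKaehlerDifferential ω := by
    intro c d ω
    have : (c • d).liftKaehlerDifferential = c • d.liftKaehlerDifferential := by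
      refine Derivation.liftKaehlerDifferential_unique _ _ ?_
      ext a
      simp
    rw [this]
    rfl
  have hadd : ∀ (d d' : Derivation R A K), (d + d').liftKaehlerDifferential =
      d.liftKaehlerDifferential + d'.liftKaehlerDifferential := by
    intro d d'
    refine Derivation.liftKaehlerDifferential_unique _ _ ?_
    ext a
    simp
  refine ⟨{ toFun d i := d.liftKaehlerDifferential (β i), map_add' d d' := ?_,
            map_smul' c d := ?_ }, fun d d' h => ?_⟩
  · ext i
    simp [hadd]
  · ext i
    simp [hlift]
  · have h1 : d.liftKaehlerDifferential = d'.liftKaehlerDifferential :=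
      β.ext fun i => congrFun h i
    ext a
    rw [← Derivation.liftKaehlerDifferential_comp_D d, h1,
      Derivation.liftKaehlerDifferential_comp_D]

variable {V B : Scheme.{u}} {str : V ⟶ B}

lemma subsingleton_section_of_le_bot {X : Scheme.{u}} {U : X.Opens} (h : U ≤ ⊥) :
    Subsingleton Γ(X, U) := by
  obtain rfl := le_bot_iff.1 h
  infer_instance

/-- A derivation is determined by its restriction to an affine open neighbourhood of the image. -/
lemma tangentFields_eq_zero {T : Over V} {x : V} (hT : ∀ t, T.hom t = x) {W : V.Opens}
    (hW : IsAffineOpen W) (hx : x ∈ W) (D : tangentFields str T) (hD : D.1 W = 0) : D = 0 := by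
  refine tangentFields_ext fun U a => ?_
  change D.1 U a = 0
  by_cases hxU : x ∈ U
  swap
  · have : Subsingleton Γ(T.left, T.hom ⁻¹ᵁ U) := subsingleton_section_of_le_bot fun t ht => by
      exact hxU (hT t ▸ ht)
    exact Subsingleton.elim _ _
  obtain ⟨f, hfU, hxf⟩ := hW.exists_basicOpen_le (V := U) ⟨x, hxU⟩ hx
  have hfW : V.basicOpen f ≤ W := V.basicOpen_le f
  obtain ⟨hmul, -, hres⟩ := D.2
  have h0 : ∀ b : Γ(V, W), D.1 (V.basicOpen f) (res hfW b) = 0 := fun b => by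
    rw [hres, hD]
    exact map_zero _
  have hloc := hW.isLocalization_basicOpen f
  -- A function on the basic open set is a fraction b / f^j with b defined on W. The Leibniz rule
  -- gives f^j D(b / f^j) = 0, and f^j is a unit there.
  have h1 : D.1 (V.basicOpen f) (res hfU a) = 0 := by
    obtain ⟨⟨b, ⟨_, j, rfl⟩⟩, hb⟩ := IsLocalization.surj (Submonoid.powers f) (res hfU a)
    change res hfU a * res hfW (f ^ j) = res hfW b at hb
    have h2 := congrArg (D.1 (V.basicOpen f)) hb
    rw [hmul, h0, h0, mul_zero, zero_add] at h2
    have hu : IsUnit (res hfW (f ^ j)) := by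
      rw [map_pow]
      exact (RingedSpace.isUnit_res_basicOpen _ f).pow j
    exact (hu.map (T.hom.app (V.basicOpen f)).hom).mul_right_eq_zero.1 h2
  have h3 : res (T.hom.preimage_mono hfU) (D.1 U a) = 0 := (hres U _ hfU a).symm.trans h1
  -- The image of T is the point x, so U and the basic open set have the same preimage and the
  -- restriction loses nothing.
  have hle : T.hom ⁻¹ᵁ U ≤ T.hom ⁻¹ᵁ V.basicOpen f := fun t _ => by
    change T.hom t ∈ V.basicOpen f
    rwa [hT t]
  have h4 := congrArg (res hle) h3
  rw [res_res, map_zero] at h4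
  have h5 : res (le_refl (T.hom ⁻¹ᵁ U)) (D.1 U a) = D.1 U a :=
    congr($(T.left.presheaf.map_id _).hom (D.1 U a))
  rwa [h5] at h4

/-- A tangent vector at P is determined by the derivation it induces on the coordinate ring of one
standard smooth chart containing P, with values in K. -/
lemma finrank_fibre_tangentBundle_le {K : Type u} [Field K] {V : Scheme.{u}}
    {str : V ⟶ Spec (.of K)} {n : ℕ} (hn : SmoothOfRelativeDimension n str) (P : Points str K) :
    finrank K (Fibre (tangentBundle str) P) ≤ n := by
  let x : V := P.1 (IsLocalRing.closedPoint K)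
  have hT : ∀ t, (Over.mk P.1).hom t = x := fun t => by
    rw [show t = IsLocalRing.closedPoint K from Subsingleton.elim (α := Spec (.of K)) _ _]
    rfl
  obtain ⟨U, hU, W, hW, hx, e, hf⟩ := hn.exists_isStandardSmoothOfRelativeDimension x
  let T : Over V := Over.mk P.1
  have htop : (⊤ : T.left.Opens) ≤ T.hom ⁻¹ᵁ W := fun t _ => by
    change T.hom t ∈ W
    rwa [hT t]
  -- The image of P lies in W, so the functions on the preimage of W form a copy of K.
  let ψ : Γ(T.left, T.hom ⁻¹ᵁ W) →+* K := (Scheme.ΓSpecIso (.of K)).hom.hom.comp (res htop)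
  have hψ : Function.Injective ψ := by
    refine (ConcreteCategory.bijective_of_isIso (Scheme.ΓSpecIso (.of K)).hom).1.comp ?_
    refine Function.LeftInverse.injective (g := res le_top) fun a => ?_
    rw [res_res]
    exact congr($(T.left.presheaf.map_id _).hom a)
  have hψ' : ∀ c : K, ψ (res le_top ((Scheme.ΓSpecIso (.of K)).inv.hom c)) = c := fun c => by
    change (Scheme.ΓSpecIso (.of K)).hom.hom (res htop (res le_top _)) = c
    rw [res_res]
    have h1 : ∀ a : Γ(T.left, ⊤), res (le_refl ⊤) a = a :=
      fun a => congr($(T.left.presheaf.map_id _).hom a)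
    refine (congrArg (Scheme.ΓSpecIso (.of K)).hom.hom (h1 _)).trans ?_
    rw [← CommRingCat.comp_apply, Iso.inv_hom_id]
    rfl
  let α : Γ(Spec (.of K), U) →+* Γ(V, W) := (str.appLE U W e).hom
  let χ : Γ(V, W) →+* K := ψ.comp (T.hom.app W).hom
  algebraize [α, χ, χ.comp α]
  have : Nontrivial Γ(V, W) := χ.domain_nontrivial
  obtain ⟨f, hf⟩ := exists_derivation_to_pi (R := Γ(Spec (.of K), U)) (A := Γ(V, W)) (K := K)
    (n := n)
  let δ : tangentFields str T → Derivation Γ(Spec (.of K), U) Γ(V, W) K := fun D =>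
    Derivation.mk'
      { toFun a := ψ (D.1 W a)
        map_add' a b := by simp
        map_smul' c a := by
          obtain ⟨h1, h2, -⟩ := D.2
          rw [Algebra.smul_def, h1]
          have : D.1 W (algebraMap Γ(Spec (.of K), U) Γ(V, W) c) = 0 := h2 U W e c
          rw [this, mul_zero, add_zero, map_mul, RingHom.id_apply, Algebra.smul_def]
          rfl }
      fun a b => by
        change ψ (D.1 W (a * b)) = χ a * ψ (D.1 W b) + χ b * ψ (D.1 W a)
        rw [D.2.1, map_add, map_mul, map_mul]
        rfl
  let δₗ : Fibre (tangentBundle str) P →ₗ[K] Derivation Γ(Spec (.of K), U) Γ(V, W) K :=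
    { toFun := δ
      map_add' D D' := by
        ext a
        exact map_add ψ _ _
      map_smul' c D := by
        ext a
        exact (map_mul ψ _ _).trans (congrArg (· * _) (hψ' c)) }
  have hδ : Function.Injective δₗ := by
    rw [← LinearMap.ker_eq_bot, LinearMap.ker_eq_bot']
    intro D hD
    refine tangentFields_eq_zero (T := T) hT hW hx D ?_
    ext a
    refine hψ ((congr($hD a)).trans ?_)
    exact (map_zero ψ).symm
  have := LinearMap.finrank_le_finrank_of_injective (f := f ∘ₗ δₗ) (hf.comp hδ)
  simpa using this

end TangentDimension

/-! ### Points of projective space in the standard affine charts -/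

section ProjectiveSpace

open HomogeneousLocalization

attribute [local instance] MvPolynomial.gradedAlgebra

variable {K : Type u} [Field K] {n : ℕ}

variable (K n) in
/-- The grading of the homogeneous coordinate ring of projective space. -/
abbrev coordGrading : ℕ → Submodule K (MvPolynomial (Fin (n + 1)) K) :=
  MvPolynomial.homogeneousSubmodule (Fin (n + 1)) K

variable (K) in
lemma X_mem_coordGrading (j : Fin (n + 1)) : MvPolynomial.X j ∈ coordGrading K n 1 :=
  MvPolynomial.isHomogeneous_X K j

variable (K) in
/-- The function `X_l / X_j` on the standard affine chart `X_j ≠ 0`. -/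
def coordRatio (j l : Fin (n + 1)) : Away (coordGrading K n) (MvPolynomial.X j) :=
  Away.mk (coordGrading K n) (X_mem_coordGrading K j) 1 (MvPolynomial.X l)
    (by simpa using X_mem_coordGrading K l)

lemma adjoin_coord_eq_top :
    Algebra.adjoin (coordGrading K n 0)
      (Set.range (MvPolynomial.X : Fin (n + 1) → MvPolynomial (Fin (n + 1)) K)) = ⊤ := by
  rw [eq_top_iff]
  intro p _
  induction p using MvPolynomial.induction_on with
  | C a =>
    exact Subalgebra.algebraMap_mem _
      (⟨MvPolynomial.C a, MvPolynomial.isHomogeneous_C _ a⟩ : coordGrading K n 0)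
  | add p q hp hq => exact add_mem (hp trivial) (hq trivial)
  | mul_X p i hp => exact mul_mem (hp trivial) (Algebra.subset_adjoin ⟨i, rfl⟩)

/-- The degree-0 localization is generated over the constants by quotients of monomials by powers of
X_j, and each of these is a product of ratios X_i / X_j. -/
lemma subring_away_eq_top (j : Fin (n + 1))
    (R : Subring (Away (coordGrading K n) (MvPolynomial.X j)))
    (hK : ∀ c : K, fromZeroRingHom (coordGrading K n) _ (algebraMap K (coordGrading K n 0) c) ∈ R)
    (hT : ∀ l, coordRatio K j l ∈ R) : R = ⊤ := by
  have h0 : ∀ c : coordGrading K n 0, fromZeroRingHom (coordGrading K n) _ c ∈ R := by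
    rintro ⟨c, hc⟩
    obtain ⟨a, rfl⟩ : ∃ a, MvPolynomial.C a = c :=
      ⟨_, ((MvPolynomial.totalDegree_eq_zero_iff_eq_C).mp
        (Nat.le_zero.mp (MvPolynomial.IsHomogeneous.totalDegree_le hc))).symm⟩
    exact hK a
  have := Away.adjoin_mk_prod_pow_eq_top (X_mem_coordGrading K j) (Fin (n + 1))
    MvPolynomial.X adjoin_coord_eq_top (fun _ => 1) (X_mem_coordGrading K)
  rw [eq_top_iff]
  intro x _
  have hx : x ∈ (⊤ : Subalgebra (coordGrading K n 0)
    (Away (coordGrading K n) (MvPolynomial.X j : MvPolynomial (Fin (n + 1)) K))) := trivial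
  rw [← this] at hx
  induction hx using Algebra.adjoin_induction with
  | algebraMap r => exact h0 r
  | add x y _ _ hx hy => exact add_mem (hx trivial) (hy trivial)
  | mul x y _ _ hx hy => exact mul_mem (hx trivial) (hy trivial)
  | mem x hx =>
    obtain ⟨a, ai, hai, _, rfl⟩ := hx
    have : Away.mk (coordGrading K n) (X_mem_coordGrading K j) a
        (∏ i, MvPolynomial.X i ^ ai i)
        (hai ▸ SetLike.prod_pow_mem_graded _ _ _ _ fun i _ => X_mem_coordGrading K i) =
        ∏ i, coordRatio K j i ^ ai i := by
      apply val_injective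
      simp only [← HomogeneousLocalization.algebraMap_apply]
      simp only [map_pow, map_prod, coordRatio]
      simp only [HomogeneousLocalization.algebraMap_apply, Away.val_mk, Localization.mk_pow,
        Localization.mk_prod]
      congr 1
      ext
      simp only [smul_eq_mul, mul_one] at hai
      simp [Finset.prod_pow_eq_pow_sum, hai]
    rw [this]
    exact prod_mem fun i _ => pow_mem (hT i) _

lemma coordRatio_mul (i j l : Fin (n + 1)) :
    awayMap (coordGrading K n) (X_mem_coordGrading K j) rfl (coordRatio K i l) =
      awayMap (coordGrading K n) (X_mem_coordGrading K j) rfl (coordRatio K i j) *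
      awayMap (coordGrading K n) (X_mem_coordGrading K i) (mul_comm _ _) (coordRatio K j l) := by
  ext
  simp only [coordRatio, awayMap_mk, Away.val_mk, Localization.mk_mul,
        Localization.mk_eq_mk_iff, Localization.r_iff_exists, val_mul]
  use 1
  simp only [OneMemClass.coe_one, one_mul, Submonoid.coe_mul]
  ring

lemma coordRatio_self (j : Fin (n + 1)) : coordRatio K j j = 1 := by
  ext
  simp only [coordRatio, Away.val_mk, val_one]
  rw [← Localization.mk_one, Localization.mk_eq_mk_iff, Localization.r_iff_exists]
  use 1
  simp

lemma exists_awayι_factor {k : Type u} [NormedField k] (q : Spec (.of k) ⟶ Proj (coordGrading K n)) :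
    ∃ (j : Fin (n + 1)) (χ : Away (coordGrading K n) (MvPolynomial.X j) →+* k),
      q = Spec.map (CommRingCat.ofHom χ) ≫
        Proj.awayι (coordGrading K n) (MvPolynomial.X j) (X_mem_coordGrading K j) one_pos ∧
      ∀ l, ‖χ (coordRatio K j l)‖ ≤ 1 := by
  have : q (IsLocalRing.closedPoint k) ∈ (⊤ : (Proj (coordGrading K n)).Opens) := trivial
  rw [← Proj.iSup_basicOpen_eq_top' (coordGrading K n) MvPolynomial.X
    (fun i => ⟨1, X_mem_coordGrading K i⟩) adjoin_coord_eq_top,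
    TopologicalSpace.Opens.mem_iSup] at this
  obtain ⟨i, hi⟩ := this
  have : Set.range q ⊆ (Proj.awayι (coordGrading K n) (MvPolynomial.X i) (X_mem_coordGrading K i)
      one_pos).opensRange := by
    rw [Proj.opensRange_awayι]
    rintro _ ⟨x, rfl⟩
    obtain rfl := Subsingleton.elim x (IsLocalRing.closedPoint k)
    exact hi
  let φ : Spec (.of k) ⟶ _ := IsOpenImmersion.lift _ _ this
  let χ := (Spec.preimage φ).hom
  have hq : q = Spec.map (CommRingCat.ofHom χ) ≫
      Proj.awayι (coordGrading K n) (MvPolynomial.X i) (X_mem_coordGrading K i) one_pos := by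
    have : Spec.map (CommRingCat.ofHom χ) = φ := Spec.map_preimage φ
    rw [this]
    exact (IsOpenImmersion.lift_fac _ _ _).symm
  -- Choosing the homogeneous coordinate X_j of largest absolute value makes every ratio X_l / X_j
  -- of absolute value at most 1.
  obtain ⟨j, -, hj⟩ := Finset.exists_max_image Finset.univ (fun l => ‖χ (coordRatio K i l)‖) ⟨i, by simp⟩
  have hpos : 0 < ‖χ (coordRatio K i j)‖ := by
    refine lt_of_lt_of_le ?_ (hj i (Finset.mem_univ _))
    rw [coordRatio_self, map_one, norm_one]
    exact one_pos
  let := (awayMap (coordGrading K n) (X_mem_coordGrading K j)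
    (rfl : MvPolynomial.X i * MvPolynomial.X j = _)).toAlgebra
  have hloc := Away.isLocalization_mul (X_mem_coordGrading K i) (X_mem_coordGrading K j) rfl one_ne_zero
  have he : Away.isLocalizationElem (X_mem_coordGrading K i) (X_mem_coordGrading K j) =
      coordRatio K i j := by
    ext
    simp [coordRatio, Away.val_mk]
  rw [he] at hloc
  have hunit : IsUnit (χ (coordRatio K i j)) := isUnit_iff_ne_zero.mpr (norm_pos_iff.mp hpos)
  let ψ : Away (coordGrading K n) (MvPolynomial.X i * MvPolynomial.X j) →+* k :=
    IsLocalization.Away.lift _ hunit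
  have hψ (s) : ψ (awayMap (coordGrading K n) (X_mem_coordGrading K j) rfl s) = χ s :=
    IsLocalization.Away.lift_eq _ hunit s
  refine ⟨j, ψ.comp (awayMap (coordGrading K n) (X_mem_coordGrading K i) (mul_comm _ _)), ?_,
    fun l => ?_⟩
  · rw [CommRingCat.ofHom_comp, Spec.map_comp, Category.assoc, Proj.SpecMap_awayMap_awayι, hq,
      show χ = ψ.comp (awayMap (coordGrading K n) (X_mem_coordGrading K j) rfl) from
      RingHom.ext fun s => (hψ s).symm, CommRingCat.ofHom_comp, Spec.map_comp, Category.assoc,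
      Proj.SpecMap_awayMap_awayι]
  · have h1 := congrArg ψ (coordRatio_mul (K := K) i j l)
    rw [map_mul, hψ, hψ] at h1
    have h2 := hj l (Finset.mem_univ _)
    simp only [h1, norm_mul] at h2
    exact le_of_mul_le_mul_left (by simpa using h2) hpos

end ProjectiveSpace

/-! ### Evaluation of functions at points -/

section Evaluation

variable {K : Type u} [Field K] {V : Scheme.{u}} {str : V ⟶ Spec (.of K)}
  {k : Type u} [Field k] [Algebra K k]

variable (str) in
/-- The constant functions on an open subset of a `K`-scheme. -/
def constFun (U : V.Opens) : K →+* Γ(V, U) :=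
  (str.appLE ⊤ U le_top).hom.comp (Scheme.ΓSpecIso (.of K)).inv.hom

/-- Evaluation at a point of `U(k)`, as a ring homomorphism. -/
def PointsIn.evalHom {U : V.Opens} (P : PointsIn str k U) : Γ(V, U) →+* k :=
  (Scheme.ΓSpecIso (.of k)).hom.hom.comp (P.1.1.appLE U ⊤ P.2).hom

lemma appLE_congr {X Y : Scheme.{u}} {f g : X ⟶ Y} (h : f = g) {U : Y.Opens} {W : X.Opens}
    (e : W ≤ f ⁻¹ᵁ U) : f.appLE U W e = g.appLE U W (h ▸ e) := by
  subst h
  rfl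

lemma appLE_comp_appTop {X Y Z : Scheme.{u}} (f : Z ⟶ X) (g : X ⟶ Y) {U : Y.Opens}
    (e : ⊤ ≤ g ⁻¹ᵁ U) (e' : ⊤ ≤ (f ≫ g) ⁻¹ᵁ U) :
    g.appLE U ⊤ e ≫ f.appTop = (f ≫ g).appLE U ⊤ e' :=
  (congrArg (_ ≫ ·) (Scheme.Hom.appLE_eq_app f (U := ⊤)).symm).trans
    (Scheme.Hom.appLE_comp_appLE _ _ _ _ _ _ _)

lemma appLE_top_comp_appLE {X Y Z : Scheme.{u}} (f : Z ⟶ X) (g : X ⟶ Y) {U : X.Opens}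
    (e : ⊤ ≤ f ⁻¹ᵁ U) : g.appLE ⊤ U le_top ≫ f.appLE U ⊤ e = (f ≫ g).appTop :=
  (Scheme.Hom.appLE_comp_appLE _ _ _ _ _ _ _).trans (Scheme.Hom.appLE_eq_app (f ≫ g) (U := ⊤))

lemma app_comp_appLE {X Y Z : Scheme.{u}} (f : Z ⟶ X) (g : X ⟶ Y) {U : Y.Opens}
    {W : Z.Opens} (e : W ≤ f ⁻¹ᵁ (g ⁻¹ᵁ U)) : g.app U ≫ f.appLE (g ⁻¹ᵁ U) W e = (f ≫ g).appLE U W e :=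
  (congrArg (· ≫ _) (Scheme.Hom.appLE_eq_app g).symm).trans
    (Scheme.Hom.appLE_comp_appLE _ _ _ _ _ _ _)

lemma PointsIn.evalHom_constFun {U : V.Opens} (P : PointsIn str k U) (c : K) :
    P.evalHom (constFun str U c) = algebraMap K k c := by
  have h1 : str.appLE ⊤ U le_top ≫ P.1.1.appLE U ⊤ P.2 =
      (Spec.map (CommRingCat.ofHom (algebraMap K k))).appTop :=
    (Scheme.Hom.appLE_comp_appLE _ _ _ _ _ _ _).trans
      ((appLE_congr P.1.2 _).trans (Scheme.Hom.appLE_eq_app _))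
  have h2 : (Scheme.ΓSpecIso (.of K)).inv ≫ (str.appLE ⊤ U le_top ≫ P.1.1.appLE U ⊤ P.2) ≫
      (Scheme.ΓSpecIso (.of k)).hom = CommRingCat.ofHom (algebraMap K k) := by
    rw [h1, Scheme.ΓSpecIso_naturality, Iso.inv_hom_id_assoc]
  exact congr(($h2).hom c)

/-- In `isCompact_box` this recovers a point from a limit of evaluation maps. -/
lemma exists_pointsIn_evalHom_eq {U : V.Opens} (hU : IsAffineOpen U) (χ : Γ(V, U) →+* k)
    (hχ : ∀ c, χ (constFun str U c) = algebraMap K k c) :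
    ∃ P : PointsIn str k U, P.evalHom = χ := by
  have e : ⊤ ≤ (Spec.map (CommRingCat.ofHom χ) ≫ hU.fromSpec) ⁻¹ᵁ U := by
    intro x _
    have : hU.fromSpec (Spec.map (CommRingCat.ofHom χ) x) ∈ Set.range hU.fromSpec := ⟨_, rfl⟩
    rw [hU.range_fromSpec] at this
    exact this
  have h0 : (Spec.map (CommRingCat.ofHom χ) ≫ hU.fromSpec).appLE U ⊤ e =
      CommRingCat.ofHom χ ≫ (Scheme.ΓSpecIso (.of k)).inv := by
    have h1 : hU.fromSpec.appLE U ⊤ (by rw [IsAffineOpen.fromSpec_preimage_self]) =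
        (Scheme.ΓSpecIso Γ(V, U)).inv := by
      rw [Scheme.Hom.appLE, IsAffineOpen.fromSpec_app_self, Category.assoc, ← Functor.map_comp]
      exact (congrArg (_ ≫ ·) (CategoryTheory.Functor.map_id _ _)).trans (Category.comp_id _)
    rw [← appLE_comp_appTop _ _ (by rw [IsAffineOpen.fromSpec_preimage_self]) e, h1]
    exact (Scheme.ΓSpecIso_inv_naturality (CommRingCat.ofHom χ)).symm
  have hstr : (Spec.map (CommRingCat.ofHom χ) ≫ hU.fromSpec) ≫ str =
      Spec.map (CommRingCat.ofHom (algebraMap K k)) := by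
    apply ext_of_isAffine
    rw [← appLE_top_comp_appLE _ _ e, h0, ← cancel_epi (Scheme.ΓSpecIso (.of K)).inv,
      ← Scheme.ΓSpecIso_inv_naturality]
    refine (Category.assoc _ _ _).symm.trans ((Category.assoc _ _ _).symm.trans
      (congrArg (· ≫ _) ?_))
    ext c
    exact hχ c
  refine ⟨⟨⟨_, hstr⟩, e⟩, ?_⟩
  have h2 : (Spec.map (CommRingCat.ofHom χ) ≫ hU.fromSpec).appLE U ⊤ e ≫
      (Scheme.ΓSpecIso (.of k)).hom = CommRingCat.ofHom χ := by
    rw [h0, Category.assoc, Iso.inv_hom_id, Category.comp_id]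
  exact congr(($h2).hom)

end Evaluation

/-! ### Boxes -/

section Boxes

attribute [local instance] MvPolynomial.gradedAlgebra

variable {K : Type u} [Field K] {n : ℕ}

open HomogeneousLocalization

/-- It reconciles two descriptions of the functions on X_j ≠ 0: sections over an open subset of
Proj, and elements of the degree-0 localization. -/
lemma awayToSection_awayι (j : Fin (n + 1)) (e : ⊤ ≤ Proj.awayι (coordGrading K n)
      (MvPolynomial.X j) (X_mem_coordGrading K j) one_pos ⁻¹ᵁ
      Proj.basicOpen (coordGrading K n) (MvPolynomial.X j)) :
    Proj.awayToSection (coordGrading K n) (MvPolynomial.X j) ≫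
      (Proj.awayι (coordGrading K n) (MvPolynomial.X j) (X_mem_coordGrading K j) one_pos).appLE
        (Proj.basicOpen (coordGrading K n) (MvPolynomial.X j)) ⊤ e =
      (Scheme.ΓSpecIso _).inv := by
  have h1 := appLE_comp_ι (Proj.basicOpenIsoSpec (coordGrading K n) (MvPolynomial.X j)
    (X_mem_coordGrading K j) one_pos).inv e
  have h2 := Proj.basicOpenToSpec_app_top (coordGrading K n) (MvPolynomial.X j)
  have h3 : (Proj.basicOpenToSpec (coordGrading K n) (MvPolynomial.X j)).appTop ≫
      (Proj.basicOpenIsoSpec (coordGrading K n) (MvPolynomial.X j)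
        (X_mem_coordGrading K j) one_pos).inv.appTop = 𝟙 _ := by
    rw [← Proj.basicOpenIsoSpec_hom _ _ (X_mem_coordGrading K j) one_pos, ← Scheme.Hom.comp_appTop,
      Iso.inv_hom_id]
    rfl
  rw [← cancel_epi (Scheme.ΓSpecIso _).hom, Iso.hom_inv_id, ← h3]
  refine (congrArg (fun t => _ ≫ _ ≫ t) h1).trans ?_
  refine Eq.trans ?_ (congrArg (· ≫ _) h2.symm)
  simp only [Category.assoc]

lemma awayToSection_const (j : Fin (n + 1)) (c : K) :
    (Proj.awayToSection (coordGrading K n) (MvPolynomial.X j)).hom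
      (fromZeroRingHom (coordGrading K n) _ (algebraMap K (coordGrading K n 0) c)) =
    constFun (projectiveSpaceStr K n) _ c := by
  let D := Proj.basicOpen (coordGrading K n) (MvPolynomial.X j)
  let a := Proj.awayι (coordGrading K n) (MvPolynomial.X j) (X_mem_coordGrading K j) one_pos
  have e : ⊤ ≤ a ⁻¹ᵁ D := by
    intro x _
    have : a x ∈ a.opensRange := ⟨x, rfl⟩
    rwa [Proj.opensRange_awayι] at this
  have h := awayToSection_awayι (K := K) j e
  have hiso : IsIso (a.appLE D ⊤ e) := by
    have : IsIso (Proj.awayToSection (coordGrading K n) (MvPolynomial.X j)) := by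
      rw [← Proj.basicOpenIsoAway_hom _ _ (X_mem_coordGrading K j) one_pos]
      infer_instance
    rw [← IsIso.eq_inv_comp] at h
    rw [h]
    infer_instance
  let g : CommRingCat.of K ⟶ CommRingCat.of (Away (coordGrading K n) (MvPolynomial.X j)) :=
    CommRingCat.ofHom ((fromZeroRingHom (coordGrading K n) (.powers (MvPolynomial.X j))).comp
      (algebraMap K (coordGrading K n 0)))
  have h1 : a ≫ projectiveSpaceStr K n = Spec.map g := by
    rw [projectiveSpaceStr, Proj.awayι_toSpecZero_assoc, ← Spec.map_comp]
    rfl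
  have key : g ≫ Proj.awayToSection (coordGrading K n) (MvPolynomial.X j) =
      (Scheme.ΓSpecIso (.of K)).inv ≫ (projectiveSpaceStr K n).appLE ⊤ D le_top := by
    rw [← cancel_mono (a.appLE D ⊤ e), Category.assoc, Category.assoc, h,
      appLE_top_comp_appLE a _ e, h1, Scheme.ΓSpecIso_inv_naturality]
  exact congr(($key).hom c)

/-- A projective variety is covered by finitely many affine charts with finitely many generating
functions, such that each point with values in a normed field has integral coordinates in one of
these charts. -/
theorem exists_boxes {V : Scheme.{u}} {str : V ⟶ Spec (.of K)}
    (hV : ∃ (N : ℕ) (i : V ⟶ Proj (MvPolynomial.homogeneousSubmodule (Fin (N + 1)) K)),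
      IsClosedImmersion i ∧ i ≫ projectiveSpaceStr K N = str) :
    ∃ (N : ℕ) (U : Fin (N + 1) → V.affineOpens) (T : ∀ j, Fin (N + 1) → Γ(V, (U j).1)),
      (∀ (k : Type u) [NormedField k] [Algebra K k] (P : Points str k),
        ∃ (j : Fin (N + 1)) (h : ⊤ ≤ P.1 ⁻¹ᵁ (U j).1), ∀ l,
          ‖PointsIn.evalHom (⟨P, h⟩ : PointsIn str k (U j).1) (T j l)‖ ≤ 1) ∧
      ∀ (j : Fin (N + 1)) (R : Subring Γ(V, (U j).1)), (∀ c, constFun str (U j).1 c ∈ R) →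
        (∀ l, T j l ∈ R) → R = ⊤ := by
  obtain ⟨N, i, hi, rfl⟩ := hV
  let D (j : Fin (N + 1)) := Proj.basicOpen (coordGrading K N) (MvPolynomial.X j)
  have hD (j) : IsAffineOpen (D j) :=
    Proj.isAffineOpen_basicOpen _ _ (X_mem_coordGrading K j) one_pos
  let f (j) := (i.app (D j)).hom.comp (Proj.awayToSection (coordGrading K N) (MvPolynomial.X j)).hom
  have hf (j) : Function.Surjective (f j) := by
    have : IsIso (Proj.awayToSection (coordGrading K N) (MvPolynomial.X j)) := by
      rw [← Proj.basicOpenIsoAway_hom _ _ (X_mem_coordGrading K j) one_pos]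
      infer_instance
    exact (Scheme.Hom.app_surjective i (D j) (hD j)).comp
      (ConcreteCategory.bijective_of_isIso
        (Proj.awayToSection (coordGrading K N) (MvPolynomial.X j))).2
  -- The generators are the restrictions of X_l / X_j; they still generate, because a closed
  -- immersion is surjective on functions over affine open subsets.
  refine ⟨N, fun j => ⟨i ⁻¹ᵁ D j, (hD j).preimage i⟩, fun j l => f j (coordRatio K j l), ?_, ?_⟩
  · intro k _ _ P
    obtain ⟨j, χ, hχ, hle⟩ := exists_awayι_factor (P.1 ≫ i)
    let a := Proj.awayι (coordGrading K N) (MvPolynomial.X j) (X_mem_coordGrading K j) one_pos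
    have e : ⊤ ≤ a ⁻¹ᵁ D j := by
      intro x _
      have : a x ∈ a.opensRange := ⟨x, rfl⟩
      rwa [Proj.opensRange_awayι] at this
    have e1 : ⊤ ≤ (P.1 ≫ i) ⁻¹ᵁ D j := by
      rw [hχ]
      intro x _
      exact e (Set.mem_univ _)
    refine ⟨j, e1, fun l => ?_⟩
    convert! hle l using 2
    have h1 : i.app (D j) ≫ P.1.appLE (i ⁻¹ᵁ D j) ⊤ e1 =
        a.appLE (D j) ⊤ e ≫ (Spec.map (CommRingCat.ofHom χ)).appTop := by
      have e2 : ⊤ ≤ (Spec.map (CommRingCat.ofHom χ) ≫ a) ⁻¹ᵁ D j := fun x _ => e (Set.mem_univ _)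
      exact (app_comp_appLE _ _ e1).trans
        ((appLE_congr hχ _).trans (appLE_comp_appTop _ _ e e2).symm)
    have h3 : (Proj.awayToSection (coordGrading K N) (MvPolynomial.X j) ≫ i.app (D j) ≫
        P.1.appLE (i ⁻¹ᵁ D j) ⊤ e1) ≫ (Scheme.ΓSpecIso (.of k)).hom = CommRingCat.ofHom χ := by
      rw [h1]
      refine (congrArg (· ≫ _) (Category.assoc _ _ _).symm).trans ?_
      refine (congrArg (fun t => (t ≫ _) ≫ _) (awayToSection_awayι j e)).trans ?_
      rw [← Scheme.ΓSpecIso_inv_naturality]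
      exact (Category.assoc _ _ _).trans
        ((congrArg (_ ≫ ·) (Iso.inv_hom_id _)).trans (Category.comp_id _))
    exact congr(($h3).hom (coordRatio K j l))
  · intro j R hK hT
    have h := subring_away_eq_top j (R.comap (f j)) (fun c => ?_) hT
    · rw [eq_top_iff]
      intro x _
      obtain ⟨y, rfl⟩ := hf j x
      have : y ∈ R.comap (f j) := h ▸ trivial
      exact this
    · change f j _ ∈ R
      convert! hK c using 1
      refine (congrArg (i.app (D j)).hom (awayToSection_const j c)).trans ?_
      have : (projectiveSpaceStr K N).appLE ⊤ (D j) le_top ≫ i.app (D j) =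
          (i ≫ projectiveSpaceStr K N).appLE ⊤ (i ⁻¹ᵁ D j) le_top := by
        rw [← Scheme.Hom.appLE_eq_app]
        exact Scheme.Hom.appLE_comp_appLE _ _ _ _ _ _ _
      exact congr(($this).hom _)

end Boxes

/-! ### Comparison of norms by compactness -/

section Compactness

attribute [local instance] MvPolynomial.gradedAlgebra

variable {K : Type u} [Field K] {V : Scheme.{u}} {str : V ⟶ Spec (.of K)} {E : RelModule V}
  {k : Type u} [NormedField k] [Algebra K k]

variable (str k) in
/-- The set `U(k)`, with the coarsest topology for which functions on `U` are continuous. -/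
def EvalPoints (U : V.Opens) : Type u := PointsIn str k U

instance (U : V.Opens) : TopologicalSpace (EvalPoints str k U) :=
  TopologicalSpace.induced (fun P a => PointsIn.eval P a) inferInstance

lemma continuous_evalPoints_val {U : V.Opens} (hU : IsAffineOpen U) :
    Continuous fun P : EvalPoints str k U => (P.1 : Points str k) := by
  rw [continuous_iff_coinduced_le]
  exact le_iSup (fun U : V.affineOpens =>
    TopologicalSpace.coinduced (fun P : PointsIn str k U.1 => P.1)
      (TopologicalSpace.induced (fun P a => PointsIn.eval P a) inferInstance)) ⟨U, hU⟩

lemma continuous_evalPoints_eval {U : V.Opens} (a : Γ(V, U)) :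
    Continuous fun P : EvalPoints str k U => PointsIn.evalHom P a :=
  (continuous_apply a).comp continuous_induced_dom

lemma continuous_chart {U : V.Opens} {r : ℕ} {s : Fin r → E.obj (Over.mk U.ι)}
    (hs : E.IsFrame U s) : Continuous (chart E s : PointsIn str k U × (Fin r → k) → _) := by
  rw [continuous_iff_coinduced_le]
  exact le_iSup_of_le U (le_iSup_of_le r (le_iSup_of_le s (le_iSup_of_le hs le_rfl)))

lemma PointsIn.evalHom_ne_zero_iff {U : V.Opens} (P : PointsIn str k U) (a : Γ(V, U)) :
    P.evalHom a ≠ 0 ↔ P.1.1 (IsLocalRing.closedPoint k) ∈ V.basicOpen a := by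
  let b : Γ(Spec (.of k), ⊤) := (P.1.1.appLE U ⊤ P.2).hom a
  have h1 : (Spec (.of k)).basicOpen b = ⊤ ⊓ P.1.1 ⁻¹ᵁ V.basicOpen a :=
    Scheme.basicOpen_appLE _ _ _ P.2 a
  have h2 : P.1.1 (IsLocalRing.closedPoint k) ∈ V.basicOpen a ↔
      IsLocalRing.closedPoint k ∈ (Spec (.of k)).basicOpen b := by
    rw [h1, top_inf_eq]
    rfl
  let e : Γ(Spec (.of k), ⊤) ≃+* k := (Scheme.ΓSpecIso (.of k)).commRingCatIsoToRingEquiv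
  have h3 : P.evalHom a = e b := rfl
  rw [h2, h3]
  constructor
  · intro h
    have : IsUnit b := (MulEquiv.isUnit_map e).1 (isUnit_iff_ne_zero.mpr h)
    rw [Scheme.basicOpen_of_isUnit _ this]
    trivial
  · intro h h0
    rw [(map_eq_zero_iff e e.injective).1 h0, Scheme.basicOpen_zero] at h
    exact h

/-- A point is identified with its evaluation map in the product space Γ(V, U) → k. Being a
K-algebra homomorphism with |f(T_l)| ≤ 1 for all l is a closed condition. The functions bounded on
this set form a subring containing the constants and the T_l, hence all functions are bounded, and
Tychonoff's theorem applies. -/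
lemma isCompact_box [ProperSpace k] {U : V.Opens} (hU : IsAffineOpen U) {m : ℕ}
    (T : Fin m → Γ(V, U))
    (hT : ∀ R : Subring Γ(V, U), (∀ c, constFun str U c ∈ R) → (∀ l, T l ∈ R) → R = ⊤) :
    IsCompact {P : EvalPoints str k U | ∀ l, ‖PointsIn.evalHom P (T l)‖ ≤ 1} := by
  let Z : Set (Γ(V, U) → k) := {f | f 1 = 1 ∧ (∀ a b, f (a + b) = f a + f b) ∧
    (∀ a b, f (a * b) = f a * f b) ∧ (∀ c, f (constFun str U c) = algebraMap K k c) ∧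
    ∀ l, ‖f (T l)‖ ≤ 1}
  have hZc : IsClosed Z := by
    have hev (a : Γ(V, U)) : Continuous fun f : Γ(V, U) → k => f a := continuous_apply a
    have h2 : IsClosed {f : Γ(V, U) → k | ∀ a b, f (a + b) = f a + f b} := by
      simp only [Set.ofPred_forall]
      exact isClosed_iInter fun a => isClosed_iInter fun b =>
        isClosed_eq (hev _) ((hev _).add (hev _))
    have h3 : IsClosed {f : Γ(V, U) → k | ∀ a b, f (a * b) = f a * f b} := by
      simp only [Set.ofPred_forall]
      exact isClosed_iInter fun a => isClosed_iInter fun b =>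
        isClosed_eq (hev _) ((hev _).mul (hev _))
    have h4 : IsClosed {f : Γ(V, U) → k | ∀ c, f (constFun str U c) = algebraMap K k c} := by
      simp only [Set.ofPred_forall]
      exact isClosed_iInter fun c => isClosed_eq (hev _) continuous_const
    have h5 : IsClosed {f : Γ(V, U) → k | ∀ l, ‖f (T l)‖ ≤ 1} := by
      simp only [Set.ofPred_forall]
      exact isClosed_iInter fun l => isClosed_le (hev _).norm continuous_const
    exact (isClosed_eq (hev 1) continuous_const).inter (h2.inter (h3.inter (h4.inter h5)))
  let ringHom (f : Γ(V, U) → k) (hf : f ∈ Z) : Γ(V, U) →+* k :=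
    RingHom.mk' ⟨⟨f, hf.1⟩, hf.2.2.1⟩ hf.2.1
  let R : Subring Γ(V, U) :=
    { carrier := {a | ∃ C : ℝ, ∀ f ∈ Z, ‖f a‖ ≤ C}
      zero_mem' := ⟨0, fun f hf => by
        have : f 0 = 0 := map_zero (ringHom f hf)
        rw [this, norm_zero]⟩
      one_mem' := ⟨1, fun f hf => by rw [hf.1, norm_one]⟩
      add_mem' := by
        rintro a b ⟨C, hC⟩ ⟨C', hC'⟩
        exact ⟨C + C', fun f hf => by
          rw [hf.2.1]
          exact (norm_add_le _ _).trans (add_le_add (hC f hf) (hC' f hf))⟩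
      mul_mem' := by
        rintro a b ⟨C, hC⟩ ⟨C', hC'⟩
        exact ⟨C * C', fun f hf => by
          rw [hf.2.2.1, norm_mul]
          exact mul_le_mul (hC f hf) (hC' f hf) (norm_nonneg _)
            ((norm_nonneg _).trans (hC f hf))⟩
      neg_mem' := by
        rintro a ⟨C, hC⟩
        exact ⟨C, fun f hf => by
          have : f (-a) = -f a := map_neg (ringHom f hf) a
          rw [this, norm_neg]
          exact hC f hf⟩ }
  have hR : R = ⊤ := hT R
    (fun c => ⟨‖algebraMap K k c‖, fun f hf => by rw [hf.2.2.2.1]⟩)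
    (fun l => ⟨1, fun f hf => hf.2.2.2.2 l⟩)
  have hbd (a : Γ(V, U)) : ∃ C : ℝ, ∀ f ∈ Z, ‖f a‖ ≤ C := by
    have : a ∈ R := hR ▸ trivial
    exact this
  choose C hC using hbd
  have hZ : IsCompact Z :=
    (isCompact_univ_pi fun a => isCompact_closedBall (0 : k) (C a)).of_isClosed_subset hZc
      fun f hf a _ => mem_closedBall_zero_iff.mpr (hC a f hf)
  have hind : Topology.IsInducing
      (fun (P : EvalPoints str k U) (a : Γ(V, U)) => PointsIn.eval P a) := ⟨rfl⟩
  rw [hind.isCompact_iff]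
  convert! hZ using 1
  ext f
  constructor
  · rintro ⟨P, hP, rfl⟩
    exact ⟨map_one (PointsIn.evalHom P), map_add (PointsIn.evalHom P),
      map_mul (PointsIn.evalHom P), PointsIn.evalHom_constFun P, hP⟩
  · intro hf
    obtain ⟨P, hP⟩ := exists_pointsIn_evalHom_eq (str := str) hU (ringHom f hf) hf.2.2.2.1
    have h (a) : PointsIn.evalHom P a = f a := congr($hP a)
    refine ⟨P, fun l => ?_, funext h⟩
    rw [h]
    exact hf.2.2.2.2 l

/-- A continuous family of functions on the fibres of `E` that are positive outside the origin
and homogeneous of degree `e`. -/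
structure IsGauge (e : ℕ) (N : ∀ P : Points str k, Fibre E P → ℝ) : Prop where
  continuous : Continuous fun x : TotalPoints str E k => N x.1 x.2
  smul : ∀ P (c : k) y, N P (c • y) = ‖c‖ ^ e * N P y
  pos : ∀ P y, y ≠ 0 → 0 < N P y

/-- In a frame near P₀ both gauges become continuous functions on O × kʳ. Homogeneity reduces the
inequality to the compact unit sphere, and a strict inequality over P₀ persists over a
neighbourhood. -/
lemma IsGauge.exists_nhds_le_mul [ProperSpace k] (hE : E.HasLocalFrames) {e : ℕ} (he : e ≠ 0)
    {N N' : ∀ P : Points str k, Fibre E P → ℝ} (hN : IsGauge e N) (hN' : IsGauge e N')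
    {U : V.Opens} (hU : IsAffineOpen U) (P₀ : EvalPoints str k U) :
    ∃ t ∈ nhds P₀, ∃ C : ℝ, ∀ P ∈ t, ∀ y, N' P.1 y ≤ C * N P.1 y := by
  let pt (P : EvalPoints str k U) : V := P.1.1 (IsLocalRing.closedPoint k)
  obtain ⟨W, hW, r, s, hs⟩ := hE (pt P₀)
  have hpU : pt P₀ ∈ U := P₀.2 (Set.mem_univ _)
  obtain ⟨a, haW, ha⟩ := hU.exists_basicOpen_le ⟨pt P₀, hW⟩ hpU
  have hmem (P : EvalPoints str k U) : PointsIn.evalHom P a ≠ 0 ↔ pt P ∈ V.basicOpen a :=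
    PointsIn.evalHom_ne_zero_iff P a
  let O : Set (EvalPoints str k U) := {P | PointsIn.evalHom P a ≠ 0}
  have hO : IsOpen O := isOpen_ne.preimage (continuous_evalPoints_eval a)
  let ρ (P : O) : PointsIn str k W := ⟨P.1.1, fun x _ => by
    rw [Subsingleton.elim x (IsLocalRing.closedPoint k)]
    exact haW ((hmem P.1).1 P.2)⟩
  have hρ : Continuous ρ := by
    rw [continuous_induced_rng]
    exact (continuous_evalPoints_val hU).comp continuous_subtype_val
  let F (M : ∀ P : Points str k, Fibre E P → ℝ) (x : O × (Fin r → k)) : ℝ :=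
    M (ρ x.1).1 (∑ i, x.2 i • sectionValue E (s i) (ρ x.1))
  have hF {M : ∀ P : Points str k, Fibre E P → ℝ} (hM : IsGauge e M) : Continuous (F M) :=
    hM.continuous.comp ((continuous_chart hs).comp
      ((hρ.comp continuous_fst).prodMk continuous_snd))
  have hbij (P : O) := bijective_linearCombination hs (ρ P)
  have hFpos (P : O) (c : Fin r → k) (hc : c ≠ 0) : 0 < F N (P, c) := by
    refine hN.pos _ _ fun h => hc ((hbij P).1 (h.trans (map_zero _).symm))
  have hFsmul {M : ∀ P : Points str k, Fibre E P → ℝ} (hM : IsGauge e M) (P : O) (t : k)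
      (c : Fin r → k) : F M (P, t • c) = ‖t‖ ^ e * F M (P, c) := by
    refine Eq.trans ?_ (hM.smul _ t _)
    simp only [F, Finset.smul_sum, smul_smul, Pi.smul_apply, smul_eq_mul]
  let S : Set (Fin r → k) := Metric.sphere 0 1
  have hS : IsCompact S := isCompact_sphere 0 1
  have hS0 {c : Fin r → k} (hc : c ∈ S) : c ≠ 0 := fun h => by
    simp [S, h] at hc
  let Q₀ : O := ⟨P₀, (hmem P₀).2 ha⟩
  obtain ⟨C, hC⟩ : ∃ C : ℝ, ∀ c ∈ S, F N' (Q₀, c) < C * F N (Q₀, c) := by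
    have hcont : ContinuousOn (fun c => F N' (Q₀, c) / F N (Q₀, c)) S :=
      ((hF hN').comp (Continuous.prodMk_right Q₀)).continuousOn.div
        ((hF hN).comp (Continuous.prodMk_right Q₀)).continuousOn
        fun c hc => (hFpos Q₀ c (hS0 hc)).ne'
    obtain ⟨C, hC⟩ := hS.bddAbove_image hcont
    -- The added 1 makes the inequality strict, hence an open condition.
    refine ⟨C + 1, fun c hc => ?_⟩
    rw [← div_lt_iff₀ (hFpos Q₀ c (hS0 hc))]
    exact (hC ⟨c, hc, rfl⟩).trans_lt (lt_add_one C)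
  have hev : ∀ᶠ P in nhds Q₀, ∀ c ∈ S, F N' (P, c) < C * F N (P, c) := by
    refine hS.eventually_forall_of_forall_eventually fun c hc => ?_
    exact (isOpen_lt (hF hN') (continuous_const.mul (hF hN))).mem_nhds (hC c hc)
  refine ⟨_, hO.isOpenMap_subtype_val.image_mem_nhds hev, C, ?_⟩
  rintro _ ⟨P, hP, rfl⟩ y
  obtain ⟨c, rfl⟩ := (hbij P).2 y
  change F N' (P, c) ≤ C * F N (P, c)
  by_cases hc : c = 0
  · have h0 {M : ∀ P : Points str k, Fibre E P → ℝ} (hM : IsGauge e M) : F M (P, c) = 0 := by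
      rw [hc, ← zero_smul k (0 : Fin r → k), hFsmul hM]
      simp [he]
    rw [h0 hN, h0 hN', mul_zero]
  · have hr : Nonempty (Fin r) := by
      by_contra h
      rw [not_nonempty_iff] at h
      exact hc (Subsingleton.elim _ _)
    -- The sup norm of c is the absolute value of a coordinate, so c can be normalized by a scalar
    -- of k even when k is nonarchimedean.
    obtain ⟨i, -, hi⟩ := Finset.exists_max_image Finset.univ (fun i => ‖c i‖) Finset.univ_nonempty
    have hci : c i ≠ 0 := fun h => hc (funext fun j => by
      simpa [h] using hi j (Finset.mem_univ j))
    have hcS : (c i)⁻¹ • c ∈ S := by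
      rw [mem_sphere_zero_iff_norm, norm_smul, norm_inv]
      have : ‖c‖ = ‖c i‖ := le_antisymm
        ((pi_norm_le_iff_of_nonneg (norm_nonneg _)).2 fun j => hi j (Finset.mem_univ j))
        (norm_le_pi_norm c i)
      rw [this, inv_mul_cancel₀ (norm_ne_zero_iff.2 hci)]
    have h := (hP _ hcS).le
    have hcc : c = c i • (c i)⁻¹ • c := by rw [smul_smul, mul_inv_cancel₀ hci, one_smul]
    rw [hcc, hFsmul hN, hFsmul hN', mul_left_comm]
    exact mul_le_mul_of_nonneg_left h (by positivity)

/-- Two gauges on a vector bundle over a projective variety are equivalent. -/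
theorem IsGauge.exists_le_mul [ProperSpace k]
    (hV : ∃ (N : ℕ) (i : V ⟶ Proj (MvPolynomial.homogeneousSubmodule (Fin (N + 1)) K)),
      IsClosedImmersion i ∧ i ≫ projectiveSpaceStr K N = str)
    (hE : E.HasLocalFrames) {e : ℕ} (he : e ≠ 0)
    {N N' : ∀ P : Points str k, Fibre E P → ℝ} (hN : IsGauge e N) (hN' : IsGauge e N') :
    ∃ C : ℝ, ∀ P y, N' P y ≤ C * N P y := by
  obtain ⟨m, U, T, hbox, hgen⟩ := exists_boxes hV
  have hnn (P : Points str k) (y : Fibre E P) : 0 ≤ N P y := by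
    by_cases hy : y = 0
    · rw [hy, ← zero_smul k (0 : Fibre E P), hN.smul]
      simp [he]
    · exact (hN.pos P y hy).le
  have hj (j : Fin (m + 1)) : ∃ C : ℝ, ∀ P : EvalPoints str k (U j).1,
      (∀ l, ‖PointsIn.evalHom P (T j l)‖ ≤ 1) → ∀ y, N' P.1 y ≤ C * N P.1 y := by
    have hc := isCompact_box (str := str) (k := k) (U j).2 (T j) (hgen j)
    -- Bounds of this kind exist locally and pass to finite unions, so compactness makes them global
    -- on the box.
    refine hc.induction_on
      (p := fun t => ∃ C : ℝ, ∀ P : EvalPoints str k (U j).1, P ∈ t → ∀ y, N' P.1 y ≤ C * N P.1 y)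
      ⟨0, fun P hP => hP.elim⟩ ?_ ?_ ?_
    · rintro t t' h ⟨C, hC⟩
      exact ⟨C, fun P hP => hC P (h hP)⟩
    · rintro t t' ⟨C, hC⟩ ⟨C', hC'⟩
      refine ⟨max C C', fun P hP y => ?_⟩
      rcases hP with hP | hP
      · exact (hC P hP y).trans (mul_le_mul_of_nonneg_right (le_max_left _ _) (hnn _ _))
      · exact (hC' P hP y).trans (mul_le_mul_of_nonneg_right (le_max_right _ _) (hnn _ _))
    · intro P _
      obtain ⟨t, ht, h⟩ := hN.exists_nhds_le_mul hE he hN' (U j).2 P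
      exact ⟨t, mem_nhdsWithin_of_mem_nhds ht, h⟩
  choose C hC using hj
  refine ⟨∑ j, |C j|, fun P y => ?_⟩
  obtain ⟨j, h, hP⟩ := hbox k P
  refine (hC j ⟨P, h⟩ hP y).trans (mul_le_mul_of_nonneg_right ?_ (hnn _ _))
  exact (le_abs_self _).trans
    (Finset.single_le_sum (f := fun j => |C j|) (fun j _ => abs_nonneg _) (Finset.mem_univ j))

end Compactness

/-! ### Comparison of the norms at one place -/

section Place

variable {K : Type u} [Field K] [NumberField K] {V : Scheme.{u}} {str : V ⟶ Spec (.of K)}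
  {E : RelModule V}

attribute [local instance] MvPolynomial.gradedAlgebra

lemma IsEuclideanNorm.gauge {k : Type u} [NormedField k] {σ : k →+* ℝ} (hσ : ∀ c, |σ c| = ‖c‖)
    {M : Type u} [AddCommGroup M] [Module k M] {N : M → ℝ} (hN : IsEuclideanNorm σ N) :
    (∀ (c : k) y, N (c • y) = ‖c‖ ^ 1 * N y) ∧ ∀ y, y ≠ 0 → 0 < N y := by
  obtain ⟨b, -, hsmul, hsymm, hpos, hNb⟩ := hN
  refine ⟨fun c y => ?_, fun y hy => ?_⟩
  · rw [hNb, hNb, hsmul, ← hsymm, hsmul, ← mul_assoc, Real.sqrt_mul (mul_self_nonneg _),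
      Real.sqrt_mul_self_eq_abs, hσ, pow_one]
  · rw [hNb]
    exact Real.sqrt_pos.2 (hpos y hy)

lemma IsHermitianSquare.gauge {k : Type u} [NormedField k] {σ : k →+* ℂ} (hσ : ∀ c, ‖σ c‖ = ‖c‖)
    {M : Type u} [AddCommGroup M] [Module k M] {N : M → ℝ} (hN : IsHermitianSquare σ N) :
    (∀ (c : k) y, N (c • y) = ‖c‖ ^ 2 * N y) ∧ ∀ y, y ≠ 0 → 0 < N y := by
  obtain ⟨φ, -, hsmul, hsymm, hpos, hNφ⟩ := hN
  refine ⟨fun c y => ?_, fun y hy => ?_⟩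
  · have h : φ y (c • y) = star (σ c) * φ y y := by
      rw [hsymm, hsmul, star_mul', ← hsymm]
    have h2 : ((N (c • y) : ℝ) : ℂ) = ((‖c‖ ^ 2 * N y : ℝ) : ℂ) := by
      rw [hNφ, hsmul, h, ← mul_assoc]
      push_cast
      rw [hNφ, ← hσ c]
      congr 1
      exact Complex.mul_conj' (σ c)
    exact_mod_cast h2
  · have := congrArg Complex.re (hNφ y)
    rw [Complex.ofReal_re] at this
    rw [this]
    exact hpos y hy

lemma IsUltrametricNorm.gauge {k : Type u} [NormedField k]
    {M : Type u} [AddCommGroup M] [Module k M] {N : M → ℝ} (hN : IsUltrametricNorm k N) :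
    (∀ (c : k) y, N (c • y) = ‖c‖ ^ 1 * N y) ∧ ∀ y, y ≠ 0 → 0 < N y := by
  refine ⟨fun c y => by rw [hN.smul, pow_one], fun y hy => ?_⟩
  have h0 : N 0 = 0 := (hN.eq_zero_iff 0).2 rfl
  have h := hN.add_le y (-y)
  have hneg : N (-y) = N y := by
    rw [← neg_one_smul k y, hN.smul, norm_neg, norm_one, one_mul]
  rw [add_neg_cancel, h0, hneg, max_self] at h
  exact lt_of_le_of_ne h fun h => hy ((hN.eq_zero_iff y).1 h.symm)

variable (N N' : AdelicNorm str E)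

/-- The degree of homogeneity is 1 at a real place and 2 at a complex one; it depends on w alone and
so serves both norms. -/
lemma AdelicNorm.exists_isGauge_inf (w : InfinitePlace K) :
    ∃ e : ℕ, e ≠ 0 ∧ ∀ N : AdelicNorm str E, IsGauge e (N.inf w) := by
  rcases w.isReal_or_isComplex with hw | hw
  · have hσ (c : w.Completion) :
        |InfinitePlace.Completion.extensionEmbeddingOfIsReal hw c| = ‖c‖ := by
      have := (InfinitePlace.Completion.isometry_extensionEmbeddingOfIsReal hw).norm_map_of_map_zero
        (map_zero _) c
      exact this
    exact ⟨1, one_ne_zero, fun N => ⟨N.continuous_inf w,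
      fun P => ((N.euclidean w hw P).gauge hσ).1, fun P => ((N.euclidean w hw P).gauge hσ).2⟩⟩
  · have hσ (c : w.Completion) : ‖InfinitePlace.Completion.extensionEmbedding w c‖ = ‖c‖ :=
      (InfinitePlace.Completion.isometry_extensionEmbedding w).norm_map_of_map_zero (map_zero _) c
    exact ⟨2, two_ne_zero, fun N => ⟨N.continuous_inf w,
      fun P => ((N.hermitian w hw P).gauge hσ).1, fun P => ((N.hermitian w hw P).gauge hσ).2⟩⟩

lemma AdelicNorm.isGauge_fin (v : HeightOneSpectrum (𝓞 K)) : IsGauge 1 (N.fin v) :=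
  ⟨N.continuous_fin v, fun P => (N.ultrametric v P).gauge.1, fun P => (N.ultrametric v P).gauge.2⟩

lemma AdelicNorm.hasLocalFrames (N : AdelicNorm str E) : E.HasLocalFrames := by
  obtain ⟨S, m, -⟩ := N.exists_model
  exact m.hasLocalFrames

theorem AdelicNorm.exists_inf_le_mul
    (hV : ∃ (N : ℕ) (i : V ⟶ Proj (MvPolynomial.homogeneousSubmodule (Fin (N + 1)) K)),
      IsClosedImmersion i ∧ i ≫ projectiveSpaceStr K N = str) (w : InfinitePlace K) :
    ∃ C : ℝ, ∀ P y, N.inf w P y ≤ C * N'.inf w P y := by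
  obtain ⟨e, he, h⟩ := AdelicNorm.exists_isGauge_inf (str := str) (E := E) w
  exact (h N').exists_le_mul hV N.hasLocalFrames he (h N)

theorem AdelicNorm.exists_fin_le_mul
    (hV : ∃ (N : ℕ) (i : V ⟶ Proj (MvPolynomial.homogeneousSubmodule (Fin (N + 1)) K)),
      IsClosedImmersion i ∧ i ≫ projectiveSpaceStr K N = str) (v : HeightOneSpectrum (𝓞 K)) :
    ∃ C : ℝ, ∀ P y, N.fin v P y ≤ C * N'.fin v P y :=
  (N'.isGauge_fin v).exists_le_mul hV N.hasLocalFrames one_ne_zero (N.isGauge_fin v)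

end Place

/-! ### Generation of rings of functions -/

/-- The subring R is itself a cocone, so the identity of D factors through its inclusion. -/
lemma subring_eq_top_of_isPushout {A B C D : CommRingCat.{u}} {f : A ⟶ B} {g : A ⟶ C}
    {inl : B ⟶ D} {inr : C ⟶ D} (h : IsPushout f g inl inr) (R : Subring D)
    (hl : ∀ b, inl.hom b ∈ R) (hr : ∀ c, inr.hom c ∈ R) : R = ⊤ := by
  let i : CommRingCat.of R ⟶ D := CommRingCat.ofHom R.subtype
  let l : B ⟶ CommRingCat.of R := CommRingCat.ofHom (inl.hom.codRestrict R hl)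
  let r : C ⟶ CommRingCat.of R := CommRingCat.ofHom (inr.hom.codRestrict R hr)
  have hli : l ≫ i = inl := rfl
  have hri : r ≫ i = inr := rfl
  have w : f ≫ l = g ≫ r := by
    have : Mono i := ConcreteCategory.mono_of_injective i fun x y h => Subtype.ext h
    rw [← cancel_mono i, Category.assoc, Category.assoc, hli, hri, h.w]
  have hd : h.desc l r w ≫ i = 𝟙 D := by
    apply h.hom_ext
    · rw [h.inl_desc_assoc, hli, Category.comp_id]
    · rw [h.inr_desc_assoc, hri, Category.comp_id]
  rw [eq_top_iff]
  intro x _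
  have hx : ((h.desc l r w).hom x).1 = x := congr(($hd).hom x)
  rw [← hx]
  exact ((h.desc l r w).hom x).2

/-- As V is separated over B, U ⊓ U' is closed in the affine scheme U ×_B U', whose functions are
generated by those of the two factors. -/
lemma subring_inf_eq_top {V B : Scheme.{u}} (str : V ⟶ B) [IsSeparated str] [IsAffine B]
    {U U' : V.Opens} (hU : IsAffineOpen U) (hU' : IsAffineOpen U')
    (R : Subring Γ((U ⊓ U').toScheme, ⊤))
    (h : ∀ a, (V.homOfLE (inf_le_left : U ⊓ U' ≤ U)).appTop.hom a ∈ R)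
    (h' : ∀ a, (V.homOfLE (inf_le_right : U ⊓ U' ≤ U')).appTop.hom a ∈ R) : R = ⊤ := by
  have : IsAffine U.toScheme := hU
  have : IsAffine U'.toScheme := hU'
  let Z := Limits.pullback (U.ι ≫ str) (U'.ι ≫ str)
  have hp := isPullback_opens_inf U U'
  let l : (U ⊓ U').toScheme ⟶ Z := hp.isoPullback.hom ≫ Limits.pullback.mapDesc U.ι U'.ι str
  have hl1 : l ≫ Limits.pullback.fst _ _ = V.homOfLE (inf_le_left : U ⊓ U' ≤ U) := by
    refine (Category.assoc _ _ _).trans ((congrArg (_ ≫ ·) (Limits.pullback.lift_fst _ _ _)).trans ?_)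
    rw [Category.comp_id, hp.isoPullback_hom_fst]
  have hl2 : l ≫ Limits.pullback.snd _ _ = V.homOfLE (inf_le_right : U ⊓ U' ≤ U') := by
    refine (Category.assoc _ _ _).trans ((congrArg (_ ≫ ·) (Limits.pullback.lift_snd _ _ _)).trans ?_)
    rw [Category.comp_id, hp.isoPullback_hom_snd]
  have hZ := isPushout_appTop_of_isPullback (IsPullback.of_hasPullback (U.ι ≫ str) (U'.ι ≫ str))
  have hR := subring_eq_top_of_isPushout hZ (R.comap l.appTop.hom) (fun a => ?_) (fun a => ?_)
  · rw [eq_top_iff]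
    intro x _
    obtain ⟨z, rfl⟩ := (IsClosedImmersion.isAffine_surjective_of_isAffine l).2 x
    have : z ∈ R.comap l.appTop.hom := hR ▸ trivial
    exact this
  · have e := Scheme.Hom.comp_appTop l (Limits.pullback.fst (U.ι ≫ str) (U'.ι ≫ str))
    rw [hl1] at e
    have := h a
    rw [e] at this
    exact this
  · have e := Scheme.Hom.comp_appTop l (Limits.pullback.snd (U.ι ≫ str) (U'.ι ≫ str))
    rw [hl2] at e
    have := h' a
    rw [e] at this
    exact this

/-! ### Evaluation of global functions on open subschemes -/

section EvalTop

variable {K : Type u} [Field K] {V : Scheme.{u}} {str : V ⟶ Spec (.of K)} {E : RelModule V}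
  {k : Type u} [Field k] [Algebra K k]

/-- Evaluation at a point of `U(k)` of functions on the open subscheme `U`. -/
def PointsIn.evalTop {U : V.Opens} (P : PointsIn str k U) : Γ(U.toScheme, ⊤) →+* k :=
  (Scheme.ΓSpecIso (.of k)).hom.hom.comp P.toOver.left.appTop.hom

lemma PointsIn.evalTop_appTop {U : V.Opens} (P : PointsIn str k U) {Y : Scheme.{u}}
    (f : U.toScheme ⟶ Y) (a : Γ(Y, ⊤)) :
    P.evalTop (f.appTop.hom a) =
      (Scheme.ΓSpecIso (.of k)).hom.hom ((P.toOver.left ≫ f).appTop.hom a) := by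
  rw [Scheme.Hom.comp_appTop]
  rfl

lemma ΓSpecIso_hom_map_appTop {R S : CommRingCat.{u}} (f : R ⟶ S) (a : Γ(Spec R, ⊤)) :
    (Scheme.ΓSpecIso S).hom.hom ((Spec.map f).appTop.hom a) =
      f.hom ((Scheme.ΓSpecIso R).hom.hom a) :=
  congr(($(Scheme.ΓSpecIso_naturality f)).hom a)

lemma PointsIn.evalTop_const {U : V.Opens} (P : PointsIn str k U) (a : Γ(Spec (.of K), ⊤)) :
    P.evalTop ((U.ι ≫ str).appTop.hom a) =
      algebraMap K k ((Scheme.ΓSpecIso (.of K)).hom.hom a) := by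
  have h : P.toOver.left ≫ U.ι ≫ str = Spec.map (CommRingCat.ofHom (algebraMap K k)) := by
    rw [← Category.assoc]
    exact (congrArg (· ≫ str) (Over.w P.toOver)).trans P.1.2
  rw [evalTop_appTop, h]
  exact ΓSpecIso_hom_map_appTop _ _

/-- A point of `U'(k)` as a point of `U(k)`, if `U'` is contained in `U`. -/
def PointsIn.ofLE {U U' : V.Opens} (h : U' ≤ U) (P : PointsIn str k U') : PointsIn str k U :=
  ⟨P.1, P.2.trans (P.1.1.preimage_mono h)⟩

lemma PointsIn.evalTop_homOfLE {U U' : V.Opens} (h : U' ≤ U) (P : PointsIn str k U')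
    (a : Γ(U.toScheme, ⊤)) :
    P.evalTop ((V.homOfLE h).appTop.hom a) = (P.ofLE h).evalTop a := by
  have h : P.toOver.left ≫ V.homOfLE h = (P.ofLE h).toOver.left := by
    rw [← cancel_mono U.ι, Category.assoc, Scheme.homOfLE_ι]
    exact (Over.w P.toOver).trans (Over.w (P.ofLE h).toOver).symm
  rw [evalTop_appTop, h]
  rfl

lemma sectionValue_smul_evalTop {U : V.Opens} (a : Γ(U.toScheme, ⊤))
    (s : E.obj (Over.mk U.ι)) (P : PointsIn str k U) :
    sectionValue E ((E.module (Over.mk U.ι)).toSMul.smul a s) P =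
      P.evalTop a • sectionValue E s P := by
  rw [fibre_smul_def, sectionValue_eq]
  refine (E.map_smul _ _ _).trans ?_
  refine congrArg (fun a : Γ(Spec (.of k), ⊤) => (E.module (Over.mk P.1.1)).smul a _) ?_
  exact congr(($(Iso.hom_inv_id (Scheme.ΓSpecIso (.of k)))).hom (P.toOver.left.appTop.hom a)).symm

/-- On the intersection of the domains of two frames, the sections of the second one are linear
combinations of the sections of the first one. -/
lemma exists_transition {U U' : V.Opens} {r r' : ℕ} {s : Fin r → E.obj (Over.mk U.ι)}
    {s' : Fin r' → E.obj (Over.mk U'.ι)} (hs : E.IsFrame U s) :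
    ∃ M : Fin r' → Fin r → Γ((U ⊓ U').toScheme, ⊤), ∀ (k : Type u) [Field k] [Algebra K k]
      (P : PointsIn str k (U ⊓ U')) (j : Fin r'),
        sectionValue E (s' j) (P.ofLE inf_le_right) =
          ∑ l, P.evalTop (M j l) • sectionValue E (s l) (P.ofLE inf_le_left) := by
  have h (j : Fin r') := ((hs.restrict (inf_le_left : U ⊓ U' ≤ U)) (Over.mk (U ⊓ U').ι)
    (𝟙 _)).2 (E.resSection inf_le_right (s' j))
  choose M hM using h
  refine ⟨M, fun k _ _ P j => ?_⟩
  have h1 := sectionValue_resSection inf_le_right (s' j) P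
  refine h1.symm.trans ?_
  rw [← hM j, sectionValue_sum]
  refine Finset.sum_congr rfl fun l _ => ?_
  refine (sectionValue_smul_evalTop _ _ P).trans ?_
  rw [E.map_id]
  exact congrArg _ (sectionValue_resSection inf_le_left (s l) P)

end EvalTop

/-! ### Integral points of a model -/

section Integral

variable {K : Type u} [Field K] [NumberField K] {V : Scheme.{u}} {str : V ⟶ Spec (.of K)}
  {E : RelModule V} {S : Finset (HeightOneSpectrum (𝓞 K))} (m : Model str E S)
  {v : HeightOneSpectrum (𝓞 K)}

/-- The point `Q` extends to an integral point of the open subset `W` of the model. -/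
def Model.IntegralIn (W : m.scheme.Opens) (Q : Points str (v.adicCompletion K)) : Prop :=
  ∃ P : Spec (.of (v.adicCompletionIntegers K)) ⟶ m.scheme,
    specInteger v ≫ P = Q.1 ≫ m.generic ∧ ⊤ ≤ P ⁻¹ᵁ W

variable {m} in
lemma Model.IntegralIn.mem {W : m.scheme.Opens} {Q : Points str (v.adicCompletion K)}
    (h : m.IntegralIn W Q) : ⊤ ≤ Q.1 ⁻¹ᵁ (m.generic ⁻¹ᵁ W) := by
  obtain ⟨P, hP, hW⟩ := h
  change ⊤ ≤ (Q.1 ≫ m.generic) ⁻¹ᵁ W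
  rw [← hP]
  exact fun x _ => hW (Set.mem_univ _)

/-- The valuative criterion of properness; v ∉ S is what sends the S-integers into O_v. -/
lemma Model.exists_integralPoint (hv : v ∉ S) (Q : Points str (v.adicCompletion K)) :
    ∃ P : Spec (.of (v.adicCompletionIntegers K)) ⟶ m.scheme,
      specInteger v ≫ P = Q.1 ≫ m.generic := by
  have hmem (x : SInt S) : algebraMap K (v.adicCompletion K) x.1 ∈
      (v.adicCompletionIntegers K).toSubring :=
    (HeightOneSpectrum.valuedAdicCompletion_eq_valuation' v x.1).trans_le (x.2 v hv)
  let ι : SInt S →+* v.adicCompletionIntegers K :=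
    ((algebraMap K (v.adicCompletion K)).comp (algebraMap (SInt S) K)).codRestrict
      (v.adicCompletionIntegers K).toSubring hmem
  have w : CommSq (Q.1 ≫ m.generic) (specInteger v) m.toSpec (Spec.map (CommRingCat.ofHom ι)) := by
    constructor
    rw [Category.assoc, m.isPullback.w, ← Category.assoc, Q.2, ← Spec.map_comp, ← Spec.map_comp]
    rfl
  have hp := m.proper
  have hex : ValuativeCriterion.Existence m.toSpec := by
    have : UniversallyClosed m.toSpec := inferInstance
    rw [UniversallyClosed.eq_valuativeCriterion] at this
    exact this.1
  let sq : ValuativeCommSq m.toSpec :=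
    { R := v.adicCompletionIntegers K
      K := v.adicCompletion K
      i₁ := Q.1 ≫ m.generic
      i₂ := Spec.map (CommRingCat.ofHom ι)
      commSq := w }
  obtain ⟨⟨l⟩⟩ := hex sq
  exact ⟨l.l, l.fac_left⟩

/-- The spectrum of a local ring maps into any open subset that contains the image of its closed
point. -/
lemma Model.exists_integralIn_of_cover (hv : v ∉ S) {ι : Type*} (W : ι → m.scheme.Opens)
    (hW : ∀ x, ∃ i, x ∈ W i) (Q : Points str (v.adicCompletion K)) :
    ∃ i, m.IntegralIn (W i) Q := by
  obtain ⟨P, hP⟩ := m.exists_integralPoint hv Q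
  obtain ⟨i, hi⟩ := hW (P (IsLocalRing.closedPoint (v.adicCompletionIntegers K)))
  exact ⟨i, P, hP, (IsLocalRing.closed_point_mem_iff (U := P ⁻¹ᵁ W i).1 hi).ge⟩

/-- A model is covered by finitely many affine open subsets with frames. -/
lemma Model.exists_finite_cover : ∃ (ι : Type u) (_ : Finite ι) (W : ι → m.scheme.affineOpens)
    (r : ι → ℕ) (s : ∀ i, Fin (r i) → m.bundle.obj (Over.mk (W i).1.ι)),
    (∀ i, m.bundle.IsFrame (W i).1 (s i)) ∧ ∀ x, ∃ i, x ∈ (W i).1 := by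
  have hp := m.proper
  have hc : CompactSpace m.scheme := QuasiCompact.compactSpace_of_compactSpace m.toSpec
  have h (x : m.scheme) : ∃ (W : m.scheme.affineOpens) (r : ℕ)
      (s : Fin r → m.bundle.obj (Over.mk W.1.ι)), x ∈ W.1 ∧ m.bundle.IsFrame W.1 s := by
    obtain ⟨U, hxU, r, s, hs⟩ := m.isVectorBundle.exists_frame x
    obtain ⟨W, hW, hxW, hWU⟩ := exists_isAffineOpen_mem_and_subset hxU
    exact ⟨⟨W, hW⟩, r, _, hxW, hs.restrict hWU⟩
  choose W r s hx hs using h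
  obtain ⟨t, ht⟩ := hc.elim_nhds_subcover (fun x => ((W x).1 : Set m.scheme))
    fun x => (W x).1.2.mem_nhds (hx x)
  refine ⟨t, inferInstance, fun i => W i.1, fun i => r i.1, fun i => s i.1, fun i => hs i.1,
    fun x => ?_⟩
  have : x ∈ (⊤ : Set m.scheme) := trivial
  rw [← ht] at this
  simp only [Set.mem_iUnion] at this
  obtain ⟨i, hi, hxi⟩ := this
  exact ⟨⟨i, hi⟩, hxi⟩

/-- The point factors through a morphism Spec O_v → W, so f takes its value in O_v. -/
lemma Model.norm_evalTop_le_one {W : m.scheme.Opens} {Q : Points str (v.adicCompletion K)}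
    (h : m.IntegralIn W Q) (f : Γ(W.toScheme, ⊤)) :
    ‖PointsIn.evalTop (⟨Q, h.mem⟩ : PointsIn str _ (m.generic ⁻¹ᵁ W))
      ((m.generic ∣_ W).appTop.hom f)‖ ≤ 1 := by
  have hQ := h.mem
  obtain ⟨P, hP, hW⟩ := h
  let l : Spec (.of (v.adicCompletionIntegers K)) ⟶ W.toScheme := IsOpenImmersion.lift W.ι P (by
      rintro _ ⟨x, rfl⟩
      simpa using hW (Set.mem_univ x))
  have hl : l ≫ W.ι = P := IsOpenImmersion.lift_fac _ _ _
  let Q' : PointsIn str _ (m.generic ⁻¹ᵁ W) := ⟨Q, hQ⟩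
  have e : Q'.toOver.left ≫ (m.generic ∣_ W) = specInteger v ≫ l := by
    rw [← cancel_mono W.ι, Category.assoc, Category.assoc, hl, hP, morphismRestrict_ι,
      ← Category.assoc]
    exact congrArg (· ≫ m.generic) (Over.w Q'.toOver)
  have h1 := PointsIn.evalTop_appTop Q' (m.generic ∣_ W) f
  rw [e, Scheme.Hom.comp_appTop] at h1
  have h2 := ΓSpecIso_hom_map_appTop (CommRingCat.ofHom (algebraMap (v.adicCompletionIntegers K)
    (v.adicCompletion K))) (l.appTop.hom f)
  have h3 := h1.trans h2
  rw [norm_adicCompletion_le_one_iff_mem_range]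
  exact ⟨_, h3.symm⟩

/-- Pulling back along Spec ψ replaces coordinates in R by their images under ψ. The case R = O_v
describes the lattice in `Model.mem_lattice_iff`. -/
lemma Model.map_sum_smul {W : m.scheme.Opens} {r : ℕ} (s : Fin r → m.bundle.obj (Over.mk W.ι))
    {k : Type u} [Field k] [Algebra K k] {R : CommRingCat.{u}} (ψ : R ⟶ .of k)
    {P : Spec R ⟶ m.scheme} (g : Over.mk P ⟶ Over.mk W.ι)
    (Q : PointsIn str k (m.generic ⁻¹ᵁ W)) (h : Spec.map ψ ≫ P = Q.1.1 ≫ m.generic)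
    (a : Fin r → Γ((Over.mk P).left, ⊤)) :
    m.iso.equiv (Over.mk Q.1.1) (m.bundle.map (T := Over.mk P) (T' := Over.mk (Q.1.1 ≫ m.generic))
      (Over.homMk (Spec.map ψ) h) (∑ j, a j • m.bundle.map g (s j))) =
        ∑ j, (ψ.hom ((Scheme.ΓSpecIso R).hom.hom (a j)) : k) •
          sectionValue E (m.section (s j)) Q := by
  let φ : Over.mk (Q.1.1 ≫ m.generic) ⟶ Over.mk P := Over.homMk (Spec.map ψ) h
  have hsec (j : Fin r) : m.iso.equiv (Over.mk Q.1.1) (m.bundle.map φ (m.bundle.map g (s j))) =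
      sectionValue E (m.section (s j)) Q := by
    rw [sectionValue_eq]
    refine Eq.trans ?_ (m.map_section (s j) Q.toOver).symm
    refine congrArg (m.iso.equiv (Over.mk Q.1.1)) ?_
    rw [← m.bundle.map_comp]
    exact m.bundle.map_eq_of_opens _ _ _
  refine (congrArg (m.iso.equiv (Over.mk Q.1.1)) (map_sum (m.bundle.map φ) _ _)).trans ?_
  refine (map_sum (m.iso.equiv (Over.mk Q.1.1)) _ _).trans ?_
  refine Finset.sum_congr rfl fun j _ => ?_
  refine (congrArg (m.iso.equiv (Over.mk Q.1.1)) (m.bundle.map_smul φ _ _)).trans ?_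
  refine ((m.iso.equiv (Over.mk Q.1.1)).map_smul (φ.left.appTop.hom (a j)) _).trans ?_
  rw [hsec, fibre_smul_def]
  refine congrArg (fun b : Γ(Spec (.of k), ⊤) => (E.module (Over.mk Q.1.1)).smul b _) ?_
  refine Eq.trans ?_ (congrArg (Scheme.ΓSpecIso _).inv.hom (ΓSpecIso_hom_map_appTop ψ (a j)))
  exact congr(($(Iso.hom_inv_id (Scheme.ΓSpecIso (.of k)))).hom (φ.left.appTop.hom (a j))).symm

lemma Model.mem_lattice_iff {W : m.scheme.Opens} {r : ℕ}
    {s : Fin r → m.bundle.obj (Over.mk W.ι)} (hs : m.bundle.IsFrame W s)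
    (Q : PointsIn str (v.adicCompletion K) (m.generic ⁻¹ᵁ W))
    {P : Spec (.of (v.adicCompletionIntegers K)) ⟶ m.scheme}
    (h : specInteger v ≫ P = Q.1.1 ≫ m.generic) (hW : ⊤ ≤ P ⁻¹ᵁ W) (y : Fibre E Q.1) :
    y ∈ m.lattice Q.1 P h ↔ ∃ c : Fin r → v.adicCompletion K, (∀ j, ‖c j‖ ≤ 1) ∧
      ∑ j, c j • sectionValue E (m.section (s j)) Q = y := by
  let g : Over.mk P ⟶ Over.mk W.ι := Over.homMk (IsOpenImmersion.lift W.ι P (by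
      rintro _ ⟨x, rfl⟩
      simpa using hW (Set.mem_univ x))) (IsOpenImmersion.lift_fac _ _ _)
  have key := m.map_sum_smul s (CommRingCat.ofHom (algebraMap (v.adicCompletionIntegers K)
    (v.adicCompletion K))) g Q h
  constructor
  · rintro ⟨z, rfl⟩
    obtain ⟨a, rfl⟩ := (hs (Over.mk P) g).2 z
    exact ⟨_, fun j => (norm_adicCompletion_le_one_iff_mem_range v _).2 ⟨_, rfl⟩, (key a).symm⟩
  · rintro ⟨c, hc, rfl⟩
    choose b hb using fun j => (norm_adicCompletion_le_one_iff_mem_range v _).1 (hc j)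
    let a (j : Fin r) : Γ((Over.mk P).left, ⊤) :=
      (Scheme.ΓSpecIso (.of (v.adicCompletionIntegers K))).inv.hom (b j)
    refine ⟨∑ j, a j • m.bundle.map g (s j), (key a).trans ?_⟩
    refine Finset.sum_congr rfl fun j _ => ?_
    refine congrArg (fun t : v.adicCompletion K => t • _) ((congrArg _ ?_).trans (hb j))
    exact congr(($(Iso.inv_hom_id (Scheme.ΓSpecIso (.of (v.adicCompletionIntegers K))))).hom (b j))

end Integral

/-- The elements that belong to almost all the subrings of a family. -/
def eventuallySubring {R ι : Type*} [CommRing R] (l : Filter ι) (A : ι → Subring R) :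
    Subring R where
  carrier := {f | ∀ᶠ i in l, f ∈ A i}
  zero_mem' := Filter.Eventually.of_forall (p := fun i => 0 ∈ A i) fun _ => zero_mem _
  one_mem' := Filter.Eventually.of_forall (p := fun i => 1 ∈ A i) fun _ => one_mem _
  add_mem' {a b} ha hb := Filter.Eventually.mp (p := fun i => a ∈ A i) ha
    (Filter.Eventually.mono (p := fun i => b ∈ A i) hb fun _ hb ha => add_mem ha hb)
  mul_mem' {a b} ha hb := Filter.Eventually.mp (p := fun i => a ∈ A i) ha
    (Filter.Eventually.mono (p := fun i => b ∈ A i) hb fun _ hb ha => mul_mem ha hb)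
  neg_mem' {a} ha := Filter.Eventually.mono (p := fun i => a ∈ A i) ha fun _ ha => neg_mem ha

lemma mem_eventuallySubring {R ι : Type*} [CommRing R] {l : Filter ι} {A : ι → Subring R} {f : R} :
    f ∈ eventuallySubring l A ↔ ∀ᶠ i in l, f ∈ A i := Iff.rfl

/-! ### Comparison of lattices at almost all places -/

section AlmostAll

variable {K : Type u} [Field K] [NumberField K] {V : Scheme.{u}} {str : V ⟶ Spec (.of K)}
  {E : RelModule V} {S S' : Finset (HeightOneSpectrum (𝓞 K))} (m : Model str E S)
  (m' : Model str E S')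

include m in
lemma Model.isSeparated : IsSeparated str := by
  have := m.proper
  have h : IsSeparated m.toSpec := inferInstance
  exact MorphismProperty.of_isPullback m.isPullback h

lemma Model.isAffineOpen_preimage {W : m.scheme.Opens} (hW : IsAffineOpen W) :
    IsAffineOpen (m.generic ⁻¹ᵁ W) := by
  have h : IsAffineHom (Spec.map (CommRingCat.ofHom (algebraMap (SInt S) K))) := inferInstance
  have : IsAffineHom m.generic := MorphismProperty.of_isPullback m.isPullback.flip h
  exact hW.preimage m.generic

/-- The functions on the generic fibre of W are the tensor product of Γ(W) with K over the
S-integers, hence are generated by the two factors. -/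
lemma Model.subring_eq_top {W : m.scheme.Opens} (hW : IsAffineOpen W)
    (R : Subring Γ((m.generic ⁻¹ᵁ W).toScheme, ⊤))
    (hR : ∀ f, (m.generic ∣_ W).appTop.hom f ∈ R)
    (hK : ∀ c, ((m.generic ⁻¹ᵁ W).ι ≫ str).appTop.hom c ∈ R) : R = ⊤ := by
  have : IsAffine W.toScheme := hW
  have h := (isPullback_morphismRestrict m.generic W).paste_vert m.isPullback
  exact subring_eq_top_of_isPushout (isPushout_appTop_of_isPullback h) R hR hK

/-- The functions f with this property form a subring. It contains the functions coming from W and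
from W', which are integral at all the points considered, and the constants of K, which are integral
at almost all v. By separatedness these generate everything. -/
lemma Model.eventually_integral {W : m.scheme.Opens} (hW : IsAffineOpen W) {W' : m'.scheme.Opens}
    (hW' : IsAffineOpen W') (f : Γ((m.generic ⁻¹ᵁ W ⊓ m'.generic ⁻¹ᵁ W').toScheme, ⊤)) :
    ∀ᶠ v : HeightOneSpectrum (𝓞 K) in Filter.cofinite,
      ∀ Q : PointsIn str (v.adicCompletion K) (m.generic ⁻¹ᵁ W ⊓ m'.generic ⁻¹ᵁ W'),
        m.IntegralIn W Q.1 → m'.IntegralIn W' Q.1 → ‖Q.evalTop f‖ ≤ 1 := by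
  have := m.isSeparated
  let A (v : HeightOneSpectrum (𝓞 K)) :
      Subring Γ((m.generic ⁻¹ᵁ W ⊓ m'.generic ⁻¹ᵁ W').toScheme, ⊤) :=
    ⨅ (Q : PointsIn str (v.adicCompletion K) (m.generic ⁻¹ᵁ W ⊓ m'.generic ⁻¹ᵁ W'))
      (_ : m.IntegralIn W Q.1) (_ : m'.IntegralIn W' Q.1),
        (v.adicCompletionIntegers K).toSubring.comap Q.evalTop
  have hA (v) (f) : f ∈ A v ↔ ∀ Q : PointsIn str (v.adicCompletion K)
      (m.generic ⁻¹ᵁ W ⊓ m'.generic ⁻¹ᵁ W'), m.IntegralIn W Q.1 → m'.IntegralIn W' Q.1 →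
      ‖Q.evalTop f‖ ≤ 1 := by
    simp only [A, Subring.mem_iInf, norm_adicCompletion_le_one_iff]
    rfl
  let R := eventuallySubring Filter.cofinite A
  have hR : R = ⊤ := by
    refine subring_inf_eq_top str (m.isAffineOpen_preimage hW) (m'.isAffineOpen_preimage hW') R ?_ ?_
    · intro a
      have h := m.subring_eq_top hW (R.comap (V.homOfLE (inf_le_left :
        m.generic ⁻¹ᵁ W ⊓ m'.generic ⁻¹ᵁ W' ≤ _)).appTop.hom) (fun f => ?_) (fun c => ?_)
      · exact (h ▸ Subring.mem_top a : a ∈ R.comap _)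
      · refine Subring.mem_comap.2 (mem_eventuallySubring.2
          (.of_forall fun v => (hA v _).2 fun Q h _ => ?_))
        rw [PointsIn.evalTop_homOfLE]
        exact m.norm_evalTop_le_one h f
      · refine Subring.mem_comap.2 (mem_eventuallySubring.2 ((eventually_norm_algebraMap_le_one
          ((Scheme.ΓSpecIso (.of K)).hom.hom c)).mono fun v hv => (hA v _).2 fun Q _ _ => ?_))
        rw [PointsIn.evalTop_homOfLE, PointsIn.evalTop_const]
        exact hv
    · intro a
      have h := m'.subring_eq_top hW' (R.comap (V.homOfLE (inf_le_right :
        m.generic ⁻¹ᵁ W ⊓ m'.generic ⁻¹ᵁ W' ≤ _)).appTop.hom) (fun f => ?_) (fun c => ?_)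
      · exact (h ▸ Subring.mem_top a : a ∈ R.comap _)
      · refine Subring.mem_comap.2 (mem_eventuallySubring.2
          (.of_forall fun v => (hA v _).2 fun Q _ h => ?_))
        rw [PointsIn.evalTop_homOfLE]
        exact m'.norm_evalTop_le_one h f
      · refine Subring.mem_comap.2 (mem_eventuallySubring.2 ((eventually_norm_algebraMap_le_one
          ((Scheme.ΓSpecIso (.of K)).hom.hom c)).mono fun v hv => (hA v _).2 fun Q _ _ => ?_))
        rw [PointsIn.evalTop_homOfLE, PointsIn.evalTop_const]
        exact hv
  have hf : f ∈ R := hR ▸ Subring.mem_top f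
  exact (mem_eventuallySubring.1 hf).mono fun v hv => (hA v f).1 hv

lemma IsUltrametricNorm.sum_le_one {k : Type u} [NormedField k] {M : Type u} [AddCommGroup M]
    [Module k M] {N : M → ℝ} (hN : IsUltrametricNorm k N) {ι : Type*} (t : Finset ι) {c : ι → k}
    (hc : ∀ i, ‖c i‖ ≤ 1) {x : ι → M} (hx : ∀ i, N (x i) ≤ 1) : N (∑ i ∈ t, c i • x i) ≤ 1 := by
  classical
  induction t using Finset.induction_on with
  | empty =>
    rw [Finset.sum_empty, (hN.eq_zero_iff 0).2 rfl]
    exact zero_le_one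
  | insert i t hi ih =>
    rw [Finset.sum_insert hi]
    refine (hN.add_le _ _).trans (max_le ?_ ih)
    rw [hN.smul]
    exact (mul_le_of_le_one_right (norm_nonneg _) (hx i)).trans (hc i)

variable (N N' : AdelicNorm str E)

variable {m N} in
lemma Model.fin_le_one_iff (hm : ∀ v ∉ S, ∀ (Q : Points str (v.adicCompletion K))
      (P : Spec (.of (v.adicCompletionIntegers K)) ⟶ m.scheme)
      (h : specInteger v ≫ P = Q.1 ≫ m.generic), m.lattice Q P h = {y | N.fin v Q y ≤ 1})
    {v : HeightOneSpectrum (𝓞 K)} (hv : v ∉ S) {W : m.scheme.Opens} {r : ℕ}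
    {s : Fin r → m.bundle.obj (Over.mk W.ι)} (hs : m.bundle.IsFrame W s)
    (Q : PointsIn str (v.adicCompletion K) (m.generic ⁻¹ᵁ W)) (hQ : m.IntegralIn W Q.1)
    (y : Fibre E Q.1) :
    N.fin v Q.1 y ≤ 1 ↔ ∃ c : Fin r → v.adicCompletion K, (∀ j, ‖c j‖ ≤ 1) ∧
      ∑ j, c j • sectionValue E (m.section (s j)) Q = y := by
  obtain ⟨P, hP, hW⟩ := hQ
  rw [← m.mem_lattice_iff hs Q hP hW, hm v hv]
  rfl

/-- Outside S and S' every K_v-point is integral in some chart of each model. The finitely many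
pairs of charts give finitely many transition functions, which are integral at such points for
almost all v; the ultrametric inequality then puts one unit ball inside the other. -/
theorem AdelicNorm.eventually_fin_le_one : ∀ᶠ v : HeightOneSpectrum (𝓞 K) in Filter.cofinite,
    ∀ (Q : Points str (v.adicCompletion K)) (y : Fibre E Q), N'.fin v Q y ≤ 1 → N.fin v Q y ≤ 1 := by
  obtain ⟨S, m, hm⟩ := N.exists_model
  obtain ⟨S', m', hm'⟩ := N'.exists_model
  obtain ⟨ι, _, W, r, s, hs, hW⟩ := m.exists_finite_cover
  obtain ⟨ι', _, W', r', s', hs', hW'⟩ := m'.exists_finite_cover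
  choose M hM using fun i i' => exists_transition (str := str) (m.isFrame_section (hs i))
    (s' := fun j => m'.section (s' i' j))
  have hint : ∀ᶠ v : HeightOneSpectrum (𝓞 K) in Filter.cofinite, ∀ i i' j l,
      ∀ Q : PointsIn str (v.adicCompletion K)
          (m.generic ⁻¹ᵁ (W i).1 ⊓ m'.generic ⁻¹ᵁ (W' i').1),
        m.IntegralIn (W i).1 Q.1 → m'.IntegralIn (W' i').1 Q.1 → ‖Q.evalTop (M i i' j l)‖ ≤ 1 := by
    simp only [Filter.eventually_all]
    exact fun i i' j l => m.eventually_integral m' (W i).2 (W' i').2 _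
  filter_upwards [hint, S.finite_toSet.eventually_cofinite_notMem,
    S'.finite_toSet.eventually_cofinite_notMem] with v hv hS hS' Q y hy
  obtain ⟨i, hi⟩ := m.exists_integralIn_of_cover hS _ hW Q
  obtain ⟨i', hi'⟩ := m'.exists_integralIn_of_cover hS' _ hW' Q
  let Q₀ : PointsIn str (v.adicCompletion K)
    (m.generic ⁻¹ᵁ (W i).1 ⊓ m'.generic ⁻¹ᵁ (W' i').1) :=
      ⟨Q, fun x hx => ⟨hi.mem hx, hi'.mem hx⟩⟩
  obtain ⟨c, hc, rfl⟩ := (Model.fin_le_one_iff hm' hS' (hs' i') (Q₀.ofLE inf_le_right) hi' y).1 hy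
  refine (N.ultrametric v Q).sum_le_one _ hc fun j => ?_
  refine (Model.fin_le_one_iff hm hS (hs i) (Q₀.ofLE inf_le_left) hi _).2
    ⟨fun l => Q₀.evalTop (M i i' j l), fun l => hv i i' j l Q₀ hi hi', ?_⟩
  exact (hM i i' _ Q₀ j).symm

/-! ### Coherence at a rational point -/

/-- The transition matrices are integral in both directions, so the two bases span the same
O_v-lattice. -/
lemma NormFamily.IsLatticeBasis.change {F : Type u} [AddCommGroup F] [Module K F]
    {N : NormFamily K F} {v : HeightOneSpectrum (𝓞 K)} {r r' : ℕ} (b : Basis (Fin r) K F)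
    (b' : Basis (Fin r') K F) (hb' : N.IsLatticeBasis v (b'.baseChange (v.adicCompletion K)))
    (h : ∀ j l, ‖algebraMap K (v.adicCompletion K) (b.repr (b' j) l)‖ ≤ 1)
    (h' : ∀ l j, ‖algebraMap K (v.adicCompletion K) (b'.repr (b l) j)‖ ≤ 1) :
    N.IsLatticeBasis v (b.baseChange (v.adicCompletion K)) := by
  have key {r r' : ℕ} (b : Basis (Fin r) K F) (b' : Basis (Fin r') K F)
      (c : Fin r → v.adicCompletion K) :
      ∑ l, c l • b.baseChange (v.adicCompletion K) l =
        ∑ j, (∑ l, c l * algebraMap K (v.adicCompletion K) (b'.repr (b l) j)) •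
          b'.baseChange (v.adicCompletion K) j := by
    simp only [Finset.sum_smul]
    rw [Finset.sum_comm]
    refine Finset.sum_congr rfl fun l _ => ?_
    simp only [mul_smul, ← Finset.smul_sum]
    congr 1
    rw [← (b'.baseChange (v.adicCompletion K)).sum_repr (b.baseChange (v.adicCompletion K) l)]
    refine Finset.sum_congr rfl fun j _ => ?_
    congr 1
    rw [Basis.baseChange_apply, Basis.baseChange_repr_tmul, Algebra.algebraMap_eq_smul_one]
  have hsum {r : ℕ} {c d : Fin r → v.adicCompletion K} (hc : ∀ l, ‖c l‖ ≤ 1) (hd : ∀ l, ‖d l‖ ≤ 1) :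
      ‖∑ l, c l * d l‖ ≤ 1 := by
    simp only [norm_adicCompletion_le_one_iff] at hc hd ⊢
    exact sum_mem fun l _ => mul_mem (hc l) (hd l)
  intro c
  rw [key b b' c, hb']
  refine ⟨fun hc l => ?_, fun hc j => hsum hc fun l => h' l j⟩
  have h1 := (key b b' c).trans (key b' b _)
  have h2 := (b.baseChange (v.adicCompletion K)).linearIndependent
  rw [Fintype.linearIndependent_iff] at h2
  have h3 := h2 (fun l => c l - ∑ j, (∑ l, c l * algebraMap K (v.adicCompletion K)
    (b'.repr (b l) j)) * algebraMap K (v.adicCompletion K) (b.repr (b' j) l))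
    (by simp only [sub_smul, Finset.sum_sub_distrib]; exact sub_eq_zero.2 h1) l
  rw [sub_eq_zero.1 h3]
  exact hsum hc fun j => h j l

/-- The chart in which P becomes integral varies with v, but there are only finitely many charts.
Each one containing P yields a K-basis of the fibre, and for almost all v these bases span the same
lattice as the fixed basis b i₀. -/
theorem AdelicNorm.isCoherent_atPoint (P : Points str K) :
    (AdelicNorm.atPoint N P).IsCoherent := by
  obtain ⟨S, m, hm⟩ := N.exists_model
  obtain ⟨ι, _, W, r, s, hs, hW⟩ := m.exists_finite_cover
  let x := P.1 (IsLocalRing.closedPoint K)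
  have hmem {i : ι} (hi : m.generic x ∈ (W i).1) : ⊤ ≤ P.1 ⁻¹ᵁ (m.generic ⁻¹ᵁ (W i).1) := by
    intro z _
    rwa [Subsingleton.elim z (IsLocalRing.closedPoint K)]
  let b (i : {i // m.generic x ∈ (W i).1}) : Basis (Fin (r i.1)) K (Fibre E P) :=
    frameBasis (m.isFrame_section (hs i.1)) (⟨P, hmem i.2⟩ : PointsIn str K _)
  obtain ⟨i₀, hi₀⟩ := hW (m.generic x)
  refine ⟨r i₀, b ⟨i₀, hi₀⟩, ?_⟩
  have h1 : ∀ᶠ v : HeightOneSpectrum (𝓞 K) in Filter.cofinite, ∀ i j l,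
      ‖algebraMap K (v.adicCompletion K) ((b ⟨i₀, hi₀⟩).repr (b i j) l)‖ ≤ 1 := by
    simp only [Filter.eventually_all]
    exact fun i j l => eventually_norm_algebraMap_le_one _
  have h2 : ∀ᶠ v : HeightOneSpectrum (𝓞 K) in Filter.cofinite, ∀ i l j,
      ‖algebraMap K (v.adicCompletion K) ((b i).repr (b ⟨i₀, hi₀⟩ l) j)‖ ≤ 1 := by
    simp only [Filter.eventually_all]
    exact fun i j l => eventually_norm_algebraMap_le_one _
  filter_upwards [h1, h2, S.finite_toSet.eventually_cofinite_notMem] with v h1 h2 hS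
  obtain ⟨i, hi⟩ := m.exists_integralIn_of_cover hS _ hW (P.baseChange (v.adicCompletion K))
  have hix : m.generic x ∈ (W i).1 := by
    have := hi.mem (Set.mem_univ (IsLocalRing.closedPoint (v.adicCompletion K)))
    have e : P.1 (Spec.map (CommRingCat.ofHom (algebraMap K (v.adicCompletion K)))
        (IsLocalRing.closedPoint (v.adicCompletion K))) = x :=
      congrArg P.1 (Subsingleton.elim _ _)
    rw [← e]
    exact this
  refine NormFamily.IsLatticeBasis.change _ (b ⟨i, hix⟩) ?_ (h1 _) (h2 _)
  intro c
  let P' : PointsIn str K (m.generic ⁻¹ᵁ (W i).1) := ⟨P, hmem hix⟩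
  let e := frameBasis (m.isFrame_section (hs i)) (P'.baseChange (v.adicCompletion K))
  have h3 : fibreTensorₗ E P (v.adicCompletion K)
      (∑ j, c j • (b ⟨i, hix⟩).baseChange (v.adicCompletion K) j) = ∑ j, c j • e j := by
    rw [map_sum]
    refine Finset.sum_congr rfl fun j _ => ?_
    rw [map_smul]
    exact congrArg _ (fibreTensorₗ_frameBasis (m.isFrame_section (hs i)) P' j)
  have h4 : (AdelicNorm.atPoint N P).fin v
      (∑ j, c j • (b ⟨i, hix⟩).baseChange (v.adicCompletion K) j) =
      N.fin v (P'.baseChange (v.adicCompletion K)).1 (∑ j, c j • e j) :=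
    congrArg (N.fin v (P.baseChange (v.adicCompletion K))) h3
  rw [h4, Model.fin_le_one_iff hm hS (hs i) (P'.baseChange (v.adicCompletion K)) hi]
  constructor
  · rintro ⟨d, hd, h⟩
    have h5 : ∑ j, d j • e j = ∑ j, c j • e j := by
      rw [← h]
      exact Finset.sum_congr rfl fun j _ => congrArg _ (frameBasis_apply _ _ j)
    have h6 : d = c := by
      rw [← e.equivFun_symm_apply, ← e.equivFun_symm_apply] at h5
      exact e.equivFun.symm.injective h5
    exact h6 ▸ hd
  · exact fun hc => ⟨c, hc, Finset.sum_congr rfl fun j _ =>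
      congrArg _ (frameBasis_apply (m.isFrame_section (hs i)) _ j).symm⟩

end AlmostAll

/-! ### Comparison of the degrees -/

section Degrees

attribute [local instance] MvPolynomial.gradedAlgebra

variable {K : Type u} [Field K] [NumberField K] {V : Scheme.{u}} {str : V ⟶ Spec (.of K)}
  {E : RelModule V}

lemma AdelicNorm.isClassical_atPoint (N : AdelicNorm str E) (P : Points str K) :
    (AdelicNorm.atPoint N P).IsClassical where
  euclidean w hw := (N.euclidean w hw (P.baseChange w.Completion)).comp
    (fibreTensorₗ E P w.Completion) (fibreTensorₗ_injective N.hasLocalFrames P)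
  hermitian w hw := (N.hermitian w hw (P.baseChange w.Completion)).comp
    (fibreTensorₗ E P w.Completion) (fibreTensorₗ_injective N.hasLocalFrames P)
  ultrametric v := (N.ultrametric v (P.baseChange (v.adicCompletion K))).comp
    (fibreTensorₗ E P (v.adicCompletion K)) (fibreTensorₗ_injective N.hasLocalFrames P)

lemma AdelicNorm.degree_restrict_top (N : AdelicNorm str E) (P : Points str K) :
    ((AdelicNorm.atPoint N P).restrict ⊤).degree = (AdelicNorm.atPoint N P).degree :=
  (N.isClassical_atPoint P).degree_restrict_top (N.isCoherent_atPoint P)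
    ((N.isClassical_atPoint P).restrict ⊤)

/-- The compactness bounds are used at the infinite places and at the finitely many finite places
where the unit balls may differ. None of the constants involves P or F. -/
theorem AdelicNorm.exists_abs_degree_sub_le (N N' : AdelicNorm str E)
    (hV : ∃ (N : ℕ) (i : V ⟶ Proj (MvPolynomial.homogeneousSubmodule (Fin (N + 1)) K)),
      IsClosedImmersion i ∧ i ≫ projectiveSpaceStr K N = str) {n : ℕ}
    (hn : ∀ P : Points str K, finrank K (Fibre E P) ≤ n) :
    ∃ C : ℝ, ∀ (P : Points str K) (F : Submodule K (Fibre E P)),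
      |((AdelicNorm.atPoint N P).restrict F).degree -
        ((AdelicNorm.atPoint N' P).restrict F).degree| ≤ C := by
  choose C hC using N.exists_inf_le_mul N' hV
  choose C' hC' using N'.exists_inf_le_mul N hV
  choose D hD using N.exists_fin_le_mul N' hV
  choose D' hD' using N'.exists_fin_le_mul N hV
  -- The bounds at finite places are enlarged to absolute values of elements of K_v, so that vectors
  -- can be rescaled by them.
  have hα (v : HeightOneSpectrum (𝓞 K)) :
      ∃ α : v.adicCompletion K, max 1 (max (D v) (D' v)) < ‖α‖ := by
    obtain ⟨x, hx⟩ := exists_one_lt_norm_adicCompletion v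
    obtain ⟨i, hi⟩ := pow_unbounded_of_one_lt (max 1 (max (D v) (D' v))) hx
    exact ⟨x ^ i, by rwa [norm_pow]⟩
  choose α hα using hα
  have hev := (N.eventually_fin_le_one N').and (N'.eventually_fin_le_one N)
  rw [Filter.eventually_cofinite] at hev
  have hnn {M : AdelicNorm str E} {v : HeightOneSpectrum (𝓞 K)} (P) (y) : 0 ≤ M.fin v P y := by
    obtain ⟨c, hc⟩ := (M.ultrametric v P).mem_range y
    exact hc ▸ norm_nonneg c
  have hnn' {M : AdelicNorm str E} (P : Points str K) (w : InfinitePlace K) (y) :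
      0 ≤ (AdelicNorm.atPoint M P).inf w y :=
    (M.isClassical_atPoint P).inf_nonneg w y
  refine ⟨∑ w, 2 * Real.log (n.factorial * max (max (C w) (C' w)) 1 ^ n) +
    ∑ v ∈ hev.toFinset, Real.log (n.factorial * ‖α v‖ ^ n), fun P F => ?_⟩
  have : Module.Finite K (Fibre E P) := finite_fibre N.hasLocalFrames P
  refine NormFamily.abs_degree_restrict_sub_le (N.isClassical_atPoint P) (N'.isClassical_atPoint P)
    (C := fun w => max (C w) (C' w)) (B := hev.toFinset) (α := α) ?_ ?_ ?_ ?_ ?_ ?_ (hn P) F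
  · exact fun w y => (hC w _ _).trans (mul_le_mul_of_nonneg_right (le_max_left _ _) (hnn' P w y))
  · exact fun w y => (hC' w _ _).trans (mul_le_mul_of_nonneg_right (le_max_right _ _) (hnn' P w y))
  · exact fun v => (le_max_left _ _).trans (hα v).le
  · exact fun v _ y => (hD v _ _).trans (mul_le_mul_of_nonneg_right
      (((le_max_left _ _).trans (le_max_right _ _)).trans (hα v).le) (hnn _ _))
  · exact fun v _ y => (hD' v _ _).trans (mul_le_mul_of_nonneg_right
      (((le_max_right _ _).trans (le_max_right _ _)).trans (hα v).le) (hnn _ _))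
  · intro v hv y
    rw [Set.Finite.mem_toFinset, Set.mem_ofPred_eq, not_not] at hv
    exact ⟨hv.2 _ _, hv.1 _ _⟩

end Degrees

end Slopes

end

/-! ### Bounded differences of slopes and comparison of freenesses -/

theorem mainTheorem7 {K : Type u} [Field K] [NumberField K] {V : Scheme.{u}}
    (str : V ⟶ Spec (.of K)) (hV : Slopes.IsNice str) (n : ℕ) (hn : SmoothOfRelativeDimension n str)
    (N N' : Slopes.AdelicMetric str) :
    (∀ i : ℕ, 1 ≤ i → i ≤ n → ∃ C : ℝ, ∀ P : Slopes.Points str K,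
      |Slopes.AdelicMetric.slope N i P - Slopes.AdelicMetric.slope N' i P| ≤ C) ∧
    ∃ C : ℝ, 0 < C ∧ ∀ P : Slopes.Points str K, 0 < Slopes.AdelicMetric.height N P →
      |Slopes.AdelicMetric.freeness N n P - Slopes.AdelicMetric.freeness N' n P| <
        C / Slopes.AdelicMetric.height N P := by
  have hdim := Slopes.finrank_fibre_tangentBundle_le hn
  obtain ⟨C, hC⟩ := Slopes.AdelicNorm.exists_abs_degree_sub_le N N' hV.projective hdim
  exact Slopes.AdelicMetric.slope_freeness_of_degree N N' n
    (fun P => Slopes.finite_fibre (Slopes.AdelicNorm.hasLocalFrames N) P) hdim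
    (Slopes.AdelicNorm.degree_restrict_top N) (Slopes.AdelicNorm.degree_restrict_top N') hC
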